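/- Let $n \ge 2$ be an integer. For a partition $\lambda$ of $N$ let $\chi^\lambda$ denote the irreducible complex character of the symmetric group $S_N$ labelled by $\lambda$, that is, the character of the Specht module $S^\lambda$ over $\mathbb{C}$. Let $\operatorname{Inf}\chi^{(n-1,1)}$ be the character of the wreath product $S_2 \wr S_n$ obtained by inflating $\chi^{(n-1,1)}$ along the canonical surjection $S_2 \wr S_n \to S_n$, and let \[ \phi^{(2^n)}_{(n-1,1)} = \bigl(\operatorname{Inf}\chi^{(n-1,1)}\bigr)\big\uparrow_{S_2 \wr S_n}^{S_{2n}} \] be the twisted Foulkes character, where $S_2 \wr S_n \le S_{2n}$ acts imprimitively on $n$ blocks of size $2$. Then \[ \phi^{(2^n)}_{(n-1,1)} = \sum_{\gamma \vdash n} (a_{2\gamma}-1)\, \chi^{2\gamma} + \sum_\mu \chi^\mu . \] Here $2\gamma$ is the partition of $2n$ obtained by doubling each part of $\gamma$, $a_\lambda$ is the number of distinct parts (different part sizes) of a partition $\lambda$, and the second sum runs over all partitions $\mu$ of $2n$ in which all parts are even except for exactly two odd parts, and these two odd parts are distinct. -/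

import Mathlib

open Equiv (Perm)

noncomputable section

namespace Foulkes

/-- The Young diagram of a partition: its row lengths are the parts in weakly decreasing order. -/
def diagram {n : ℕ} (p : n.Partition) : YoungDiagram :=
  YoungDiagram.ofRowLens (p.parts.sort (· ≥ ·)) (p.parts.pairwise_sort (· ≥ ·)).sortedGE

/-- A tableau of shape `p`: a bijective filling of the cells of the diagram with the symbols
`0, …, n - 1`, recorded as the map that sends each symbol to its cell `(row, column)`. -/
abbrev Tableau {n : ℕ} (p : n.Partition) : Type :=
  Fin n ≃ (diagram p).cells

/-- The row in which a tableau has the symbol `x`. -/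
def rowOf {n : ℕ} {p : n.Partition} (t : Tableau p) (x : Fin n) : ℕ := (t x).1.1

/-- The column in which a tableau has the symbol `x`. -/
def colOf {n : ℕ} {p : n.Partition} (t : Tableau p) (x : Fin n) : ℕ := (t x).1.2

/-- A tabloid of shape `p`: a row-equivalence class of tableaux, recorded as the function that
sends each symbol to its row. -/
def Tabloid {n : ℕ} (p : n.Partition) : Type :=
  {r : Fin n → ℕ // ∃ t : Tableau p, rowOf t = r}

/-- The tabloid `{t}` of a tableau `t`. -/
def Tableau.tabloid {n : ℕ} {p : n.Partition} (t : Tableau p) : Tabloid p :=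
  ⟨rowOf t, t, rfl⟩

/-- `σ • t` is obtained from the tableau `t` by replacing each symbol `x` by `σ x`. -/
def Tableau.permute {n : ℕ} {p : n.Partition} (σ : Perm (Fin n)) (t : Tableau p) : Tableau p :=
  σ.symm.trans t

/-- The symmetric group permutes tabloids by replacing each symbol `x` by `σ x`. -/
instance {n : ℕ} (p : n.Partition) : MulAction (Perm (Fin n)) (Tabloid p) where
  smul σ T := ⟨fun x => T.1 (σ⁻¹ x), by
    obtain ⟨r, t, rfl⟩ := T
    exact ⟨Tableau.permute σ t, rfl⟩⟩
  one_smul _ := rfl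
  mul_smul _ _ _ := rfl

theorem tabloid_permute {n : ℕ} {p : n.Partition} (σ : Perm (Fin n)) (t : Tableau p) :
    (Tableau.permute σ t).tabloid = σ • t.tabloid := rfl

/-- The column stabilizer `C_t`: the permutations that keep every symbol in its column of `t`. -/
def colStabilizer {n : ℕ} {p : n.Partition} (t : Tableau p) : Finset (Perm (Fin n)) :=
  {σ | ∀ x, colOf t (σ x) = colOf t x}

/-- The polytabloid `e_t`, the sum over `σ ∈ C_t` of `sgn(σ) {σ • t}`, an element of the
permutation module on tabloids. -/
def polytabloid {n : ℕ} {p : n.Partition} (t : Tableau p) : MonoidAlgebra ℂ (Tabloid p) :=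
  ∑ σ ∈ colStabilizer t,
    MonoidAlgebra.single (σ • t.tabloid) (((Perm.sign σ : ℤˣ) : ℤ) : ℂ)

theorem ofMulAction_polytabloid {n : ℕ} {p : n.Partition} (g : Perm (Fin n)) (t : Tableau p) :
    Representation.ofMulAction ℂ (Perm (Fin n)) (Tabloid p) g (polytabloid t) =
      polytabloid (Tableau.permute g t) := by
  unfold polytabloid
  rw [map_sum]
  refine Finset.sum_bij' (fun σ _ => g * σ * g⁻¹) (fun σ _ => g⁻¹ * σ * g) ?_ ?_ ?_ ?_ ?_
  · intro σ hσ
    simp only [colStabilizer, Finset.mem_filter, Finset.mem_univ, true_and] at hσ ⊢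
    intro x
    have := hσ (g⁻¹ x)
    simpa [colOf, Tableau.permute] using this
  · intro σ hσ
    simp only [colStabilizer, Finset.mem_filter, Finset.mem_univ, true_and] at hσ ⊢
    intro x
    have := hσ (g x)
    simpa [colOf, Tableau.permute] using this
  · intro σ _
    group
  · intro σ _
    group
  · intro σ _
    rw [Representation.ofMulAction_single, tabloid_permute, smul_smul, smul_smul]
    rcases Int.units_eq_one_or (Perm.sign g) with h | h <;> simp [mul_assoc, h]

/-- The Specht module `S^p`: the span of all polytabloids `e_t`, as a subrepresentation of the
complex permutation module on tabloids. -/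
def specht {n : ℕ} (p : n.Partition) :
    Subrepresentation (Representation.ofMulAction ℂ (Perm (Fin n)) (Tabloid p)) where
  toSubmodule := Submodule.span ℂ (Set.range (polytabloid (p := p)))
  apply_mem_toSubmodule g v hv := by
    induction hv using Submodule.span_induction with
    | mem x hx =>
      obtain ⟨t, rfl⟩ := hx
      rw [ofMulAction_polytabloid]
      exact Submodule.subset_span ⟨_, rfl⟩
    | zero => simp
    | add x y _ _ hx hy => rw [map_add]; exact Submodule.add_mem _ hx hy
    | smul a x _ hx => rw [map_smul]; exact Submodule.smul_mem _ a hx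

/-- The irreducible character `χ^p` of the symmetric group: the character of the complex Specht
module `S^p`. -/
def chi {n : ℕ} (p : n.Partition) : Perm (Fin n) → ℂ :=
  (specht p).toRepresentation.character

/-- The wreath product `S_m ≀ S_n`, with `S_n` permuting the coordinates of `(S_m)^n`. -/
abbrev Wreath (m n : ℕ) : Type :=
  (Fin n → Perm (Fin m)) ⋊[mulAutArrow (G := Perm (Fin n)) (A := Fin n) (M := Perm (Fin m))]
    Perm (Fin n)

/-- The imprimitive action of `S_m ≀ S_n` on `n` blocks of size `m`: the pair `(f, σ)` sends the
point `a` of block `i` to the point `f (σ i) a` of block `σ i`. -/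
def Wreath.toPermProd (m n : ℕ) : Wreath m n →* Perm (Fin m × Fin n) where
  toFun w :=
    { toFun := fun x => (w.left (w.right x.2) x.1, w.right x.2)
      invFun := fun x => ((w.left x.2)⁻¹ x.1, w.right⁻¹ x.2)
      left_inv := fun x => by simp
      right_inv := fun x => by simp }
  map_one' := by ext x <;> simp
  map_mul' v w := by
    ext x
    · have h : ∀ y, (mulAutArrow (G := Perm (Fin n)) (A := Fin n) (M := Perm (Fin m)) v.right
          w.left) (v.right y) = w.left y := fun y => by
        change w.left (v.right⁻¹ (v.right y)) = w.left y
        simp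
      simp only [SemidirectProduct.mul_left, SemidirectProduct.mul_right, Perm.coe_mul,
        Function.comp_apply, Equiv.coe_fn_mk, Pi.mul_apply, h]
    · simp

/-- The embedding of `S_m ≀ S_n` in `S_{mn}`. -/
def Wreath.embedding (m n : ℕ) : Wreath m n →* Perm (Fin (m * n)) :=
  (finProdFinEquiv.permCongrHom.toMonoidHom).comp (Wreath.toPermProd m n)

/-- The twisted Foulkes character `φ^{(m^n)}_ν`: the inflation of `χ^ν` along the canonical
surjection `S_m ≀ S_n → S_n`, induced to `S_{mn}`. -/
def twistedFoulkes (m : ℕ) {n : ℕ} (ν : n.Partition) : Perm (Fin (m * n)) → ℂ :=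
  (Representation.ind (Wreath.embedding m n)
    ((specht ν).toRepresentation.comp
      (SemidirectProduct.rightHom : Wreath m n →* Perm (Fin n)))).character

/-- The partition `(n - 1, 1)` of `n`, for `n ≥ 2`. -/
def nearRow (n : ℕ) (hn : 2 ≤ n) : n.Partition where
  parts := {n - 1, 1}
  parts_pos := by
    intro i hi
    simp only [Multiset.insert_eq_cons, Multiset.mem_cons, Multiset.mem_singleton] at hi
    omega
  parts_sum := by
    simp only [Multiset.insert_eq_cons, Multiset.sum_cons, Multiset.sum_singleton]
    omega

/-- The partition `2γ` of `2n`, obtained by doubling each part of `γ`. -/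
def double {n : ℕ} (γ : n.Partition) : (2 * n).Partition where
  parts := γ.parts.map (2 * ·)
  parts_pos := by
    intro i hi
    obtain ⟨j, hj, rfl⟩ := Multiset.mem_map.1 hi
    have := γ.parts_pos hj
    omega
  parts_sum := by
    rw [Multiset.sum_map_mul_left, Multiset.map_id', γ.parts_sum]

/-- The number `a_p` of distinct parts (different part sizes) of a partition. -/
def numDistinctParts {n : ℕ} (p : n.Partition) : ℕ := p.parts.toFinset.card

/-- All parts of `p` are even except for exactly two odd parts, which are distinct. -/
def TwoDistinctOddParts {n : ℕ} (p : n.Partition) : Prop :=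
  (p.parts.filter Odd).card = 2 ∧ (p.parts.filter Odd).Nodup

instance {n : ℕ} : DecidablePred (TwoDistinctOddParts (n := n)) :=
  fun _ => inferInstanceAs (Decidable (_ ∧ _))

end Foulkes

end

/-! By Frobenius reciprocity, the multiplicity of `chi p` in the twisted Foulkes character is the
average over `S₂ ≀ S_n` of `chi p` times the inflation of the character of `(n - 1, 1)`. That
inflation is the number of fixed blocks minus one (`chi_nearRow`), so the multiplicity is `markedAvg
- blockAvg` (`ip_twistedFoulkes_nearRow`).

The plain average is 1 if all rows of `p` are even and 0 otherwise (`countsEven_blockAvg`). This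
goes by induction on the number of blocks. In `S_{2m+2}` the point stabilizer `S_{2m+1}` and `S₂ ≀
S_{m+1}` form a single double coset and meet in `S₂ ≀ S_m`. Hence, for a partition `q` of `2m + 1`,
the averages over all ways to add a cell to `q` and those over all ways to remove one have the same
sum (`sum_blockAvg_add`). As the averages are natural numbers and equal 1 on one-row partitions,
these relations determine them (`Branches.countsEven`).

In the marked average all blocks contribute equally, which reduces it to the stabilizer `S₂ × (S₂ ≀
S_{n-1})` of one block (`markedAvg_option`) and so to removing two cells from `p`
(`CountsEven.sum_remove_pairs`). An even partition gets 1 for each row longer than the next, hence 1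
for each distinct part. A partition with exactly two odd rows gets 1 from removing a cell in each,
and this is cancelled by a vertical domino of sign `-1` if the two rows are equal. Subtracting the
plain average turns `a` into `a - 1`.

Cells are removed at the level of integer vectors. By the determinantal formula `chi_eq_psi`, the
character of `p` is the alternating sum `psi (beta k p)` of permutation characters; restriction
lowers entries of the vector, and a vector with a repeated entry gives zero. The formula rests on
Specht modules: the signed column sums `kappa` yield orthonormality (`chi_orthonormal`), and `psi
(beta k p)` is triangular for dominance in both directions (`dominates_of_ip_psi_chi_ne_zero`,
`dominates_of_ip_psi_chi_ne_zero'`), so only `chi p` survives in its expansion, with coefficient 1.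
-/

open Equiv (Perm)

noncomputable section

namespace Foulkes

/-! ### Row lengths of partitions -/

/-- The `i`-th part (in decreasing order) of a partition, zero beyond its length. -/
def row {n : ℕ} (p : n.Partition) (i : ℕ) : ℕ := (diagram p).rowLen i

theorem mem_diagram {n : ℕ} (p : n.Partition) (i j : ℕ) : (i, j) ∈ diagram p ↔ j < row p i :=
  YoungDiagram.mem_iff_lt_rowLen

theorem row_antitone {n : ℕ} (p : n.Partition) : Antitone (row p) :=
  fun i j h => (diagram p).rowLen_anti i j h

theorem row_eq_getD {n : ℕ} (p : n.Partition) (i : ℕ) :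
    row p i = (p.parts.sort (· ≥ ·)).getD i 0 := by
  have key : ∀ j, j < row p i ↔ j < (p.parts.sort (· ≥ ·)).getD i 0 := by
    intro j
    rw [← mem_diagram, diagram, YoungDiagram.mem_ofRowLens]
    by_cases h : i < (p.parts.sort (· ≥ ·)).length
    · rw [List.getD_eq_getElem _ _ h]
      exact ⟨fun ⟨_, h'⟩ => h', fun h' => ⟨h, h'⟩⟩
    · rw [List.getD_eq_default _ _ (not_lt.1 h)]
      simp only [Nat.not_lt_zero, iff_false]
      rintro ⟨h', -⟩
      exact h h'
  exact le_antisymm (not_lt.1 fun h => lt_irrefl _ ((key _).1 h))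
    (not_lt.1 fun h => lt_irrefl _ ((key _).2 h))

theorem card_parts_le {n : ℕ} (p : n.Partition) : p.parts.card ≤ n := by
  have h : p.parts.card • 1 ≤ p.parts.sum :=
    Multiset.card_nsmul_le_sum fun x hx => p.parts_pos hx
  simpa [p.parts_sum] using h

theorem map_row_range {n : ℕ} (p : n.Partition) {k : ℕ} (hk : p.parts.card ≤ k) :
    (Multiset.range k).map (row p) = p.parts + Multiset.replicate (k - p.parts.card) 0 := by
  set L := p.parts.sort (· ≥ ·) with hL
  have hlen : L.length = p.parts.card := Multiset.length_sort _
  have hl : (List.range k).map (row p) = L ++ List.replicate (k - p.parts.card) 0 := by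
    apply List.ext_getElem
    · simp [hlen]; omega
    · intro i h₁ h₂
      simp only [List.length_map, List.length_range] at h₁
      simp only [List.getElem_map, List.getElem_range, row_eq_getD, ← hL]
      by_cases h : i < L.length
      · rw [List.getD_eq_getElem _ _ h, List.getElem_append_left h]
      · rw [List.getD_eq_default _ _ (not_lt.1 h), List.getElem_append_right (not_lt.1 h)]
        simp
  have := congrArg (fun l : List ℕ => (l : Multiset ℕ)) hl
  simp only [← Multiset.map_coe, ← Multiset.coe_add] at this
  rw [← Multiset.range] at this
  rw [this, hL, Multiset.sort_eq, Multiset.coe_replicate]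

theorem parts_eq_filter {n : ℕ} (p : n.Partition) {k : ℕ} (hk : p.parts.card ≤ k) :
    p.parts = ((Multiset.range k).map (row p)).filter (· ≠ 0) := by
  rw [map_row_range p hk, Multiset.filter_add, Multiset.filter_eq_self.2, Multiset.filter_eq_nil.2,
    add_zero]
  · intro a ha
    simp [Multiset.eq_of_mem_replicate ha]
  · intro a ha
    exact (p.parts_pos ha).ne'

theorem sum_row {n : ℕ} (p : n.Partition) {k : ℕ} (hk : p.parts.card ≤ k) :
    ∑ i ∈ Finset.range k, row p i = n := by
  rw [Finset.sum, Finset.range_val, map_row_range p hk]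
  simp [p.parts_sum]

theorem row_eq_zero {n : ℕ} (p : n.Partition) {k : ℕ} (hk : p.parts.card ≤ k) : row p k = 0 := by
  rw [row_eq_getD, List.getD_eq_default]
  simpa using hk

theorem row_injective {n : ℕ} : Function.Injective (row (n := n)) := by
  intro p q h
  ext1
  rw [parts_eq_filter p (card_parts_le p), h, ← parts_eq_filter q (card_parts_le q)]

theorem ext_of_row {n k : ℕ} {p q : n.Partition} (hp : p.parts.card ≤ k) (hq : q.parts.card ≤ k)
    (h : ∀ i < k, row p i = row q i) : p = q := by
  apply row_injective
  funext i
  rcases lt_or_ge i k with hi | hi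
  · exact h i hi
  · rw [row_eq_zero p (hp.trans hi), row_eq_zero q (hq.trans hi)]

theorem card_cells_eq_sum (μ : YoungDiagram) {k : ℕ} (hk : μ.rowLen k = 0) (r : ℕ) (hr : k ≤ r) :
    μ.cells.card = ∑ i ∈ Finset.range r, μ.rowLen i := by
  rw [Finset.card_eq_sum_card_fiberwise (f := Prod.fst) (t := Finset.range r)]
  · refine Finset.sum_congr rfl fun i _ => ?_
    rw [μ.rowLen_eq_card]
    rfl
  · rintro ⟨i, j⟩ h
    have h' : j < μ.rowLen i := YoungDiagram.mem_iff_lt_rowLen.1 ((YoungDiagram.mem_cells _).1 h)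
    simp only [Finset.coe_range, Set.mem_Iio]
    by_contra hc
    have := μ.rowLen_anti k i (hr.trans (not_lt.1 hc))
    omega

theorem card_cells {n : ℕ} (p : n.Partition) : (diagram p).cells.card = n := by
  rw [card_cells_eq_sum (diagram p) (row_eq_zero p le_rfl) _ le_rfl]
  exact sum_row p le_rfl

instance {n : ℕ} (p : n.Partition) : Nonempty (Tableau p) :=
  ⟨(Fintype.equivFinOfCardEq (by simpa using card_cells p)).symm⟩

/-- Every weakly decreasing sequence of sum `n` is the sequence of rows of a partition. -/
theorem exists_partition_row {n k : ℕ} (r : ℕ → ℕ) (hr : Antitone r) (hk : r k = 0)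
    (hs : ∑ i ∈ Finset.range k, r i = n) :
    ∃ p : n.Partition, row p = r ∧ p.parts.card ≤ k := by
  have hr0 : ∀ i, k ≤ i → r i = 0 := fun i hi => Nat.le_zero.1 (hk ▸ hr hi)
  let μ : YoungDiagram :=
    { cells := (Finset.range k).sigma (fun i => Finset.range (r i)) |>.map
        (Equiv.sigmaEquivProd ℕ ℕ).toEmbedding
      isLowerSet := by
        rintro ⟨a, b⟩ ⟨c, d⟩ ⟨h1, h2⟩ h
        simp only [Finset.coe_map, Set.mem_image, Finset.mem_coe, Finset.mem_sigma,
          Finset.mem_range] at h ⊢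
        obtain ⟨⟨x, y⟩, ⟨hx, hy⟩, he⟩ := h
        simp only [Equiv.coe_toEmbedding, Equiv.sigmaEquivProd_apply, Prod.mk.injEq] at he
        obtain ⟨rfl, rfl⟩ := he
        simp only at h1 h2 hx hy
        exact ⟨⟨c, d⟩, ⟨lt_of_le_of_lt h1 hx, lt_of_le_of_lt h2 (lt_of_lt_of_le hy (hr h1))⟩, rfl⟩ }
  have hμ : ∀ i j, (i, j) ∈ μ ↔ j < r i := by
    intro i j
    rw [← YoungDiagram.mem_cells]
    simp only [μ, Finset.mem_map, Finset.mem_sigma, Finset.mem_range]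
    constructor
    · rintro ⟨⟨x, y⟩, ⟨hx, hy⟩, he⟩
      simp only [Equiv.coe_toEmbedding, Equiv.sigmaEquivProd_apply, Prod.mk.injEq] at he
      obtain ⟨rfl, rfl⟩ := he
      exact hy
    · intro h
      refine ⟨⟨i, j⟩, ⟨?_, h⟩, rfl⟩
      by_contra hc
      have := hr0 i (not_lt.1 hc)
      simp only at h hc
      omega
  have hrow : ∀ i, μ.rowLen i = r i := fun i =>
    le_antisymm (not_lt.1 fun h => lt_irrefl _ ((hμ _ _).1 (YoungDiagram.mem_iff_lt_rowLen.2 h)))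
      (not_lt.1 fun h => lt_irrefl _ (YoungDiagram.mem_iff_lt_rowLen.1 ((hμ _ _).2 h)))
  have hcol : μ.colLen 0 ≤ k := by
    by_contra hc
    have := YoungDiagram.mem_iff_lt_colLen.2 (not_le.1 hc)
    rw [hμ, hk] at this
    omega
  have hsum : μ.rowLens.sum = n := by
    have h0 : μ.rowLen (μ.colLen 0) = 0 := by
      by_contra hc
      have := YoungDiagram.mem_iff_lt_rowLen.2 (Nat.pos_of_ne_zero hc)
      rw [YoungDiagram.mem_iff_lt_colLen] at this
      omega
    have := (card_cells_eq_sum μ h0 _ le_rfl).symm.trans (card_cells_eq_sum μ h0 k hcol)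
    rw [← hs]
    calc μ.rowLens.sum = ∑ i ∈ Finset.range (μ.colLen 0), μ.rowLen i := by
          rw [YoungDiagram.rowLens, Finset.sum_range]
          simp [← List.sum_ofFn, List.ofFn_eq_map, ← List.map_coe_finRange_eq_range]
          rfl
      _ = _ := by rw [this]; simp [hrow]
  let p : n.Partition :=
    { parts := μ.rowLens
      parts_pos := fun {i} hi => μ.pos_of_mem_rowLens i (by simpa using hi)
      parts_sum := by simpa using hsum }
  have hsort : p.parts.sort (· ≥ ·) = μ.rowLens := by
    change Multiset.sort (μ.rowLens : Multiset ℕ) (· ≥ ·) = _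
    rw [Multiset.coe_sort]
    apply List.mergeSort_of_pairwise
    simpa [List.SortedGE] using μ.rowLens_sorted.pairwise
  have hd : diagram p = μ := by
    rw [← YoungDiagram.ofRowLens_to_rowLens_eq_self (μ := μ), diagram]
    congr 1
  refine ⟨p, ?_, ?_⟩
  · funext i
    rw [row, hd, hrow]
  · change Multiset.card (μ.rowLens : Multiset ℕ) ≤ k
    simpa using hcol

/-! ### Homomorphisms out of Specht modules -/

section Kappa

variable {n : ℕ} {p : n.Partition} {V W : Type*} [AddCommGroup V] [Module ℂ V]
  [AddCommGroup W] [Module ℂ W]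

theorem mem_colStabilizer {t : Tableau p} {σ : Perm (Fin n)} :
    σ ∈ colStabilizer t ↔ ∀ x, colOf t (σ x) = colOf t x := by
  simp [colStabilizer]

theorem mul_mem_colStabilizer {t : Tableau p} {σ τ : Perm (Fin n)} (hσ : σ ∈ colStabilizer t)
    (hτ : τ ∈ colStabilizer t) : σ * τ ∈ colStabilizer t := by
  rw [mem_colStabilizer] at *
  intro x
  rw [Perm.mul_apply, hσ, hτ]

theorem inv_mem_colStabilizer {t : Tableau p} {σ : Perm (Fin n)} (hσ : σ ∈ colStabilizer t) :
    σ⁻¹ ∈ colStabilizer t := by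
  rw [mem_colStabilizer] at *
  intro x
  rw [← hσ (σ⁻¹ x)]
  simp

theorem swap_mem_colStabilizer {t : Tableau p} {x y : Fin n} (h : colOf t x = colOf t y) :
    Equiv.swap x y ∈ colStabilizer t := by
  rw [mem_colStabilizer]
  intro z
  rcases eq_or_ne z x with rfl | hx
  · rw [Equiv.swap_apply_left, h]
  · rcases eq_or_ne z y with rfl | hy
    · rw [Equiv.swap_apply_right, h]
    · rw [Equiv.swap_apply_of_ne_of_ne hx hy]

/-- The signed column sum of a tableau, acting on a representation. -/
def kappa (t : Tableau p) (ρ : Representation ℂ (Perm (Fin n)) V) : V →ₗ[ℂ] V :=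
  ∑ σ ∈ colStabilizer t, (((Perm.sign σ : ℤˣ) : ℤ) : ℂ) • ρ σ

theorem kappa_apply (t : Tableau p) (ρ : Representation ℂ (Perm (Fin n)) V) (v : V) :
    kappa t ρ v = ∑ σ ∈ colStabilizer t, (((Perm.sign σ : ℤˣ) : ℤ) : ℂ) • ρ σ v := by
  simp [kappa]

theorem sign_cast_mul_self (σ : Perm (Fin n)) :
    (((Perm.sign σ : ℤˣ) : ℤ) : ℂ) * (((Perm.sign σ : ℤˣ) : ℤ) : ℂ) = 1 := by
  rcases Int.units_eq_one_or (Perm.sign σ) with h | h <;> simp [h]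

theorem kappa_comp_of_mem (t : Tableau p) (ρ : Representation ℂ (Perm (Fin n)) V)
    {τ : Perm (Fin n)} (hτ : τ ∈ colStabilizer t) (v : V) :
    kappa t ρ (ρ τ v) = (((Perm.sign τ : ℤˣ) : ℤ) : ℂ) • kappa t ρ v := by
  rw [kappa_apply, kappa_apply, Finset.smul_sum]
  refine Finset.sum_bij' (fun σ _ => σ * τ) (fun σ _ => σ * τ⁻¹)
    (fun σ hσ => mul_mem_colStabilizer hσ hτ)
    (fun σ hσ => mul_mem_colStabilizer hσ (inv_mem_colStabilizer hτ)) (by simp) (by simp) ?_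
  intro σ _
  rw [map_mul, map_mul, smul_smul, Module.End.mul_apply]
  congr 1
  push_cast
  rw [mul_left_comm, sign_cast_mul_self, mul_one]

/-- Each column permutation is absorbed at the cost of its sign, which cancels the sign already
present. Thus `kappa` is idempotent up to the order of the column group, and `spechtVector t` is an
eigenvector with nonzero eigenvalue. -/
theorem kappa_kappa (t : Tableau p) (ρ : Representation ℂ (Perm (Fin n)) V) (v : V) :
    kappa t ρ (kappa t ρ v) = ((colStabilizer t).card : ℂ) • kappa t ρ v := by
  conv_lhs => rw [kappa_apply t ρ v, map_sum]
  rw [Finset.sum_congr rfl (g := fun _ => kappa t ρ v), Finset.sum_const, Nat.cast_smul_eq_nsmul]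
  intro σ hσ
  rw [map_smul, kappa_comp_of_mem t ρ hσ, smul_smul, sign_cast_mul_self, one_smul]

theorem map_kappa (t : Tableau p) {ρ : Representation ℂ (Perm (Fin n)) V}
    {ρ' : Representation ℂ (Perm (Fin n)) W} (f : ρ.IntertwiningMap ρ') (v : V) :
    f (kappa t ρ v) = kappa t ρ' (f v) := by
  rw [kappa_apply, kappa_apply, map_sum]
  refine Finset.sum_congr rfl fun σ _ => ?_
  rw [map_smul, f.isIntertwining]

theorem polytabloid_eq_kappa (t : Tableau p) :
    polytabloid t = kappa t (Representation.ofMulAction ℂ (Perm (Fin n)) (Tabloid p))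
      (MonoidAlgebra.single t.tabloid 1) := by
  rw [kappa_apply, polytabloid]
  refine Finset.sum_congr rfl fun σ _ => ?_
  rw [Representation.ofMulAction_single, MonoidAlgebra.smul_single, smul_eq_mul, mul_one]

theorem one_mem_colStabilizer (t : Tableau p) : 1 ∈ colStabilizer t := by
  simp [mem_colStabilizer]

theorem card_colStabilizer_ne_zero (t : Tableau p) : ((colStabilizer t).card : ℂ) ≠ 0 :=
  Nat.cast_ne_zero.2 (Finset.card_ne_zero_of_mem (one_mem_colStabilizer t))

instance : Finite (Tabloid p) :=
  Finite.of_surjective (Tableau.tabloid (p := p)) fun ⟨_, t, h⟩ => ⟨t, Subtype.ext h⟩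

instance {Y : Type*} [Finite Y] : FiniteDimensional ℂ (MonoidAlgebra ℂ Y) :=
  Module.Finite.equiv (MonoidAlgebra.coeffLinearEquiv ℂ).symm

theorem exists_permute_eq (t t' : Tableau p) : ∃ g, Tableau.permute g t = t' :=
  ⟨t.trans t'.symm, by ext x : 1; simp [Tableau.permute]⟩

/-- The polytabloid of `t` as a vector of the Specht module. -/
def spechtVector (t : Tableau p) : (specht p).toSubmodule :=
  ⟨polytabloid t, Submodule.subset_span ⟨t, rfl⟩⟩

theorem specht_apply_spechtVector (g : Perm (Fin n)) (t : Tableau p) :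
    (specht p).toRepresentation g (spechtVector t) = spechtVector (Tableau.permute g t) :=
  Subtype.ext (ofMulAction_polytabloid g t)

theorem span_range_spechtVector : Submodule.span ℂ (Set.range (spechtVector (p := p))) = ⊤ := by
  refine Eq.trans (congrArg (Submodule.span ℂ) ?_)
    (Submodule.span_span_coe_preimage (R := ℂ) (s := Set.range (polytabloid (p := p))))
  ext v
  simp only [Set.mem_range, spechtVector, Subtype.ext_iff]
  rfl

theorem kappa_spechtVector (t : Tableau p) :
    kappa t (specht p).toRepresentation (spechtVector t) =
      ((colStabilizer t).card : ℂ) • spechtVector t := by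
  apply Subtype.ext
  rw [kappa_apply]
  have h := kappa_kappa t (Representation.ofMulAction ℂ (Perm (Fin n)) (Tabloid p))
    (MonoidAlgebra.single t.tabloid 1)
  rw [← polytabloid_eq_kappa, kappa_apply] at h
  simpa [spechtVector, Subrepresentation.toRepresentation] using h

/-- Evaluation at a polytabloid, on homomorphisms out of a Specht module. -/
def evalPolytabloid (t : Tableau p) (ρ : Representation ℂ (Perm (Fin n)) V) :
    (specht p).toRepresentation.IntertwiningMap ρ →ₗ[ℂ] V where
  toFun f := f (spechtVector t)
  map_add' _ _ := rfl
  map_smul' _ _ := rfl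

/-- A Specht module is cyclic: the group permutes the spanning polytabloids transitively, so the
image of one of them determines an intertwining map. -/
theorem evalPolytabloid_injective (t : Tableau p) (ρ : Representation ℂ (Perm (Fin n)) V) :
    Function.Injective (evalPolytabloid t ρ) := by
  rw [injective_iff_map_eq_zero]
  intro f hf
  apply Representation.IntertwiningMap.ext
  refine LinearMap.ext_on_range span_range_spechtVector fun t' => ?_
  obtain ⟨g, rfl⟩ := exists_permute_eq t t'
  rw [← specht_apply_spechtVector]
  have := f.isIntertwining _ _ g (spechtVector t)
  have hf' : f (spechtVector t) = 0 := hf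
  rw [hf', map_zero] at this
  exact this

theorem evalPolytabloid_mem (t : Tableau p) (ρ : Representation ℂ (Perm (Fin n)) V)
    (f : (specht p).toRepresentation.IntertwiningMap ρ) :
    evalPolytabloid t ρ f ∈ LinearMap.range (kappa t ρ) := by
  refine ⟨((colStabilizer t).card : ℂ)⁻¹ • f (spechtVector t), ?_⟩
  rw [map_smul, ← map_kappa, kappa_spechtVector, map_smul,
    inv_smul_smul₀ (card_colStabilizer_ne_zero t)]
  rfl

/-- The source of all upper bounds on multiplicities of Specht modules. The only lower bound needed
comes from the identity map. -/
theorem finrank_hom_specht_le [FiniteDimensional ℂ V] (t : Tableau p)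
    (ρ : Representation ℂ (Perm (Fin n)) V) :
    Module.finrank ℂ ((specht p).toRepresentation.IntertwiningMap ρ) ≤
      Module.finrank ℂ (LinearMap.range (kappa t ρ)) :=
  LinearMap.finrank_le_finrank_of_injective
    (f := (evalPolytabloid t ρ).codRestrict _ (evalPolytabloid_mem t ρ))
    fun _ _ h => evalPolytabloid_injective t ρ (congrArg Subtype.val h)

/-- A transposition in the column group that fixes `y` makes the image of `y` equal to its own
negative. -/
theorem kappa_single_eq_zero {Y : Type*} [MulAction (Perm (Fin n)) Y] (t : Tableau p) (y : Y)
    {a b : Fin n} (hab : a ≠ b) (hc : colOf t a = colOf t b) (hy : Equiv.swap a b • y = y) (c : ℂ) :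
    kappa t (Representation.ofMulAction ℂ (Perm (Fin n)) Y) (MonoidAlgebra.single y c) = 0 := by
  have h := kappa_comp_of_mem t (Representation.ofMulAction ℂ (Perm (Fin n)) Y)
    (swap_mem_colStabilizer hc) (MonoidAlgebra.single y c)
  rw [Representation.ofMulAction_single, hy, Perm.sign_swap hab] at h
  simp only [Units.val_neg, Units.val_one, Int.cast_neg, Int.cast_one, neg_smul, one_smul] at h
  generalize kappa t (Representation.ofMulAction ℂ (Perm (Fin n)) Y) (MonoidAlgebra.single y c) = v
    at h
  have h2 : (2 : ℂ) • v = 0 := by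
    rw [two_smul]
    nth_rewrite 1 [h]
    exact neg_add_cancel v
  exact (smul_eq_zero.1 h2).resolve_left two_ne_zero

theorem linearMap_range_le_of_single {Y : Type*} (f : MonoidAlgebra ℂ Y →ₗ[ℂ] W)
    (S : Submodule ℂ W) (h : ∀ y, f (MonoidAlgebra.single y 1) ∈ S) : LinearMap.range f ≤ S := by
  rintro _ ⟨v, rfl⟩
  induction v using MonoidAlgebra.induction_linear with
  | zero => simp
  | add x y hx hy => rw [map_add]; exact S.add_mem hx hy
  | single y c =>
    rw [← mul_one c, ← smul_eq_mul, ← MonoidAlgebra.smul_single, map_smul]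
    exact S.smul_mem _ (h y)

theorem finrank_hom_specht_eq_zero {Y : Type*} [Finite Y] [MulAction (Perm (Fin n)) Y]
    (t : Tableau p)
    (h : ∀ y : Y, ∃ a b, a ≠ b ∧ colOf t a = colOf t b ∧ Equiv.swap a b • y = y) :
    Module.finrank ℂ ((specht p).toRepresentation.IntertwiningMap
      (Representation.ofMulAction ℂ (Perm (Fin n)) Y)) = 0 := by
  have h0 : LinearMap.range (kappa t (Representation.ofMulAction ℂ (Perm (Fin n)) Y)) ≤ ⊥ := by
    refine linearMap_range_le_of_single _ _ fun y => ?_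
    obtain ⟨a, b, hab, hc, hy⟩ := h y
    rw [kappa_single_eq_zero t y hab hc hy]
    exact Submodule.zero_mem _
  have := finrank_hom_specht_le t (Representation.ofMulAction ℂ (Perm (Fin n)) Y)
  rw [le_bot_iff.1 h0] at this
  simpa using this

end Kappa

/-! ### Fillings that are injective on columns -/

section Column

variable {n : ℕ} {p : n.Partition}

theorem mem_cells_iff (p : n.Partition) (c : ℕ × ℕ) : c ∈ (diagram p).cells ↔ c.2 < row p c.1 := by
  rw [YoungDiagram.mem_cells, ← mem_diagram]

theorem colOf_lt (t : Tableau p) (x : Fin n) : colOf t x < row p (rowOf t x) :=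
  (mem_cells_iff p _).1 (t x).2

theorem tableau_ext (t : Tableau p) {x y : Fin n} (hr : rowOf t x = rowOf t y)
    (hc : colOf t x = colOf t y) : x = y :=
  t.injective (Subtype.ext (Prod.ext hr hc))

theorem exists_cell (t : Tableau p) {i j : ℕ} (h : j < row p i) :
    ∃ x, rowOf t x = i ∧ colOf t x = j :=
  ⟨t.symm ⟨(i, j), (mem_cells_iff p _).2 h⟩, by simp [rowOf], by simp [colOf]⟩

theorem card_rowOf_eq (t : Tableau p) (i : ℕ) :
    (Finset.univ.filter fun x => rowOf t x = i).card = row p i := by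
  rw [← Finset.card_range (row p i)]
  refine Finset.card_bij (fun x _ => colOf t x) ?_ ?_ ?_
  · intro x hx
    have := colOf_lt t x
    simp only [Finset.mem_filter, Finset.mem_univ, true_and] at hx
    rw [hx] at this
    simpa using this
  · intro x hx y hy h
    simp only [Finset.mem_filter, Finset.mem_univ, true_and] at hx hy
    exact tableau_ext t (hx.trans hy.symm) h
  · intro j hj
    obtain ⟨x, hx, hx'⟩ := exists_cell t (Finset.mem_range.1 hj)
    exact ⟨x, by simp [hx], hx'⟩

theorem card_rowOf_lt (t : Tableau p) (r : ℕ) :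
    (Finset.univ.filter fun x => rowOf t x < r).card = ∑ i ∈ Finset.range r, row p i := by
  rw [Finset.card_eq_sum_card_fiberwise (f := rowOf t) (t := Finset.range r)]
  · refine Finset.sum_congr rfl fun i hi => ?_
    rw [← card_rowOf_eq t i, Finset.filter_filter]
    congr 1
    ext x
    simp only [Finset.mem_filter, Finset.mem_univ, true_and, Finset.mem_range] at hi ⊢
    exact ⟨fun h => h.2, fun h => ⟨h ▸ hi, h⟩⟩
  · intro x hx
    simpa using hx

/-- On column `c` the filling is injective, so values in `J` occur at most `min(|J|, height of the
column)` times; this minimum is the number of cells of the column in the first `|J|` rows. -/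
theorem card_column_le {C : Type*} [DecidableEq C] (t : Tableau p) (f : Fin n → C)
    (hf : ∀ x y, colOf t x = colOf t y → f x = f y → x = y) (J : Finset C) (c : ℕ) :
    (Finset.univ.filter fun x => colOf t x = c ∧ f x ∈ J).card ≤
      (Finset.univ.filter fun x => colOf t x = c ∧ rowOf t x < J.card).card := by
  by_cases h : ∀ x, colOf t x = c → rowOf t x < J.card
  · refine Finset.card_le_card fun x hx => ?_
    simp only [Finset.mem_filter, Finset.mem_univ, true_and] at hx ⊢
    exact ⟨hx.1, h x hx.1⟩
  · push Not at h
    obtain ⟨x, hxc, hx⟩ := h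
    calc _ ≤ J.card := by
          refine Finset.card_le_card_of_injOn f ?_ ?_
          · intro y hy
            simp only [Finset.coe_filter, Finset.mem_univ, true_and, Set.mem_ofPred_eq] at hy
            exact hy.2
          · intro y hy z hz hyz
            simp only [Finset.coe_filter, Finset.mem_univ, true_and, Set.mem_ofPred_eq] at hy hz
            exact hf y z (hy.1.trans hz.1.symm) hyz
      _ = (Finset.range J.card).card := by simp
      _ ≤ _ := by
          refine Finset.card_le_card_of_surjOn (rowOf t) ?_
          intro i hi
          simp only [Finset.coe_range, Set.mem_Iio] at hi
          have hlt : c < row p i :=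
            lt_of_lt_of_le (hxc ▸ colOf_lt t x) (row_antitone p (hi.le.trans hx))
          obtain ⟨y, hy, hyc⟩ := exists_cell t hlt
          exact ⟨y, by simp [hyc, hy, hi], hy⟩

theorem card_filter_eq_sum_column (t : Tableau p) (P : Fin n → Prop) [DecidablePred P] :
    (Finset.univ.filter P).card =
      ∑ c ∈ Finset.univ.image (colOf t), (Finset.univ.filter fun x => colOf t x = c ∧ P x).card := by
  rw [Finset.card_eq_sum_card_fiberwise (f := colOf t) (t := Finset.univ.image (colOf t))]
  · refine Finset.sum_congr rfl fun c _ => ?_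
    rw [Finset.filter_filter]
    simp only [and_comm]
  · intro x _
    simp

/-- A filling without repetitions in the columns of `t` uses any `r` symbols at most as often as
the diagram has cells in its first `r` rows. -/
theorem card_filter_mem_le {C : Type*} [DecidableEq C] (t : Tableau p) (f : Fin n → C)
    (hf : ∀ x y, colOf t x = colOf t y → f x = f y → x = y) (J : Finset C) :
    (Finset.univ.filter fun x => f x ∈ J).card ≤ ∑ i ∈ Finset.range J.card, row p i := by
  rw [← card_rowOf_lt t, card_filter_eq_sum_column t, card_filter_eq_sum_column t]
  exact Finset.sum_le_sum fun c _ => card_column_le t f hf J c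

/-- If no column of `t` contains two symbols from one row of `T`, every symbol can be moved inside
its column to the row it has in `T`. The point to prove is that the target cell lies in the diagram.
-/
theorem exists_colStabilizer_smul (t : Tableau p) (T : Tabloid p)
    (hT : ∀ x y, colOf t x = colOf t y → T.1 x = T.1 y → x = y) :
    ∃ σ ∈ colStabilizer t, T = σ • t.tabloid := by
  -- Tabloids of the same shape have equally many symbols in the rows above `T.1 x`, so the
  -- columnwise bound is an equality in every column. If the column of `x` had no cell in row `T.1
  -- x`, then all its symbols, including `x`, would lie in `T` strictly above that row.
  have hlt : ∀ x, colOf t x < row p (T.1 x) := by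
    intro x
    by_contra hx
    have hsum : ∑ c ∈ Finset.univ.image (colOf t),
          (Finset.univ.filter fun y => colOf t y = c ∧ T.1 y ∈ Finset.range (T.1 x)).card =
        ∑ c ∈ Finset.univ.image (colOf t),
          (Finset.univ.filter fun y => colOf t y = c ∧ rowOf t y < T.1 x).card := by
      rw [← card_filter_eq_sum_column t, ← card_filter_eq_sum_column t, card_rowOf_lt]
      obtain ⟨s, hs⟩ := T.2
      rw [← card_rowOf_lt s, hs]
      simp
    have hle : ∀ c ∈ Finset.univ.image (colOf t),
        (Finset.univ.filter fun y => colOf t y = c ∧ T.1 y ∈ Finset.range (T.1 x)).card ≤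
        (Finset.univ.filter fun y => colOf t y = c ∧ rowOf t y < T.1 x).card := by
      intro c _
      have := card_column_le t T.1 hT (Finset.range (T.1 x)) c
      rwa [Finset.card_range] at this
    have heq := (Finset.sum_eq_sum_iff_of_le hle).1 hsum (colOf t x) (by simp)
    have hall : (Finset.univ.filter fun y => colOf t y = colOf t x ∧ rowOf t y < T.1 x) =
        Finset.univ.filter fun y => colOf t y = colOf t x := by
      ext y
      simp only [Finset.mem_filter, Finset.mem_univ, true_and, and_iff_left_iff_imp]
      intro hy
      by_contra hc
      have h1 := colOf_lt t y
      have h2 := row_antitone p (not_lt.1 hc)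
      omega
    rw [hall] at heq
    have hsub : (Finset.univ.filter fun y => colOf t y = colOf t x ∧
        T.1 y ∈ Finset.range (T.1 x)) ⊆ Finset.univ.filter fun y => colOf t y = colOf t x := by
      intro y hy
      simp only [Finset.mem_filter, Finset.mem_univ, true_and] at hy ⊢
      exact hy.1
    have hmem := Finset.eq_of_subset_of_card_le hsub heq.ge
    have : x ∈ Finset.univ.filter fun y => colOf t y = colOf t x ∧
        T.1 y ∈ Finset.range (T.1 x) := by
      rw [hmem]; simp
    simp at this
  let g : Fin n → (diagram p).cells := fun x => ⟨(T.1 x, colOf t x), (mem_cells_iff p _).2 (hlt x)⟩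
  have hg : Function.Bijective g := by
    rw [Fintype.bijective_iff_injective_and_card]
    refine ⟨fun x y h => ?_, by simpa using (card_cells p).symm⟩
    simp only [g, Subtype.mk.injEq, Prod.mk.injEq] at h
    exact hT x y h.2 h.1
  let τ : Perm (Fin n) := (Equiv.ofBijective g hg).trans t.symm
  have hτ : ∀ x, t (τ x) = g x := fun x => by simp [τ]
  have hcol : τ ∈ colStabilizer t := by
    rw [mem_colStabilizer]
    intro x
    simp [colOf, hτ, g]
  refine ⟨τ⁻¹, inv_mem_colStabilizer hcol, Subtype.ext (funext fun x => ?_)⟩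
  change T.1 x = rowOf t (τ⁻¹⁻¹ x)
  simp [rowOf, hτ, g]

theorem swap_smul_tabloid (T : Tabloid p) {a b : Fin n} (h : T.1 a = T.1 b) :
    Equiv.swap a b • T = T := by
  apply Subtype.ext
  funext x
  change T.1 ((Equiv.swap a b)⁻¹ x) = T.1 x
  rw [Equiv.swap_inv]
  rcases eq_or_ne x a with rfl | hx
  · rw [Equiv.swap_apply_left, h]
  · rcases eq_or_ne x b with rfl | hy
    · rw [Equiv.swap_apply_right, h]
    · rw [Equiv.swap_apply_of_ne_of_ne hx hy]

/-- The coefficient at `t.tabloid` is 1, because only the identity preserves both the rows and the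
columns of `t`. -/
theorem polytabloid_ne_zero (t : Tableau p) : polytabloid t ≠ 0 := by
  intro h
  have h1 : (polytabloid t).coeff t.tabloid = 1 := by
    rw [polytabloid, MonoidAlgebra.coeff_sum, Finsupp.finsetSum_apply,
      Finset.sum_eq_single_of_mem 1 (one_mem_colStabilizer t)]
    · simp
    · intro σ hσ hne
      rw [MonoidAlgebra.coeff_single]
      refine Finsupp.single_eq_of_ne fun he => ?_
      apply hne
      ext x : 1
      have hr : rowOf t (σ⁻¹ (σ x)) = rowOf t (σ x) := congrFun (congrArg Subtype.val he.symm) (σ x)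
      rw [Perm.inv_def, Equiv.symm_apply_apply] at hr
      exact (tableau_ext t hr (mem_colStabilizer.1 hσ x).symm).symm
  rw [h] at h1
  simp at h1

/-- `kappa t` sends a tabloid to plus or minus `polytabloid t` if the columns of `t` separate its
rows, and to zero otherwise, so its range lies in a line. -/
theorem finrank_hom_specht_tabloid_le :
    Module.finrank ℂ ((specht p).toRepresentation.IntertwiningMap
      (Representation.ofMulAction ℂ (Perm (Fin n)) (Tabloid p))) ≤ 1 := by
  obtain ⟨t⟩ : Nonempty (Tableau p) := inferInstance
  refine (finrank_hom_specht_le t _).trans ?_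
  have h : LinearMap.range (kappa t (Representation.ofMulAction ℂ (Perm (Fin n)) (Tabloid p))) ≤
      Submodule.span ℂ {polytabloid t} := by
    refine linearMap_range_le_of_single _ _ fun T => ?_
    by_cases hT : ∀ x y, colOf t x = colOf t y → T.1 x = T.1 y → x = y
    · obtain ⟨σ, hσ, rfl⟩ := exists_colStabilizer_smul t T hT
      rw [← Representation.ofMulAction_single, kappa_comp_of_mem t _ hσ, ← polytabloid_eq_kappa]
      exact Submodule.smul_mem _ _ (Submodule.mem_span_singleton_self _)
    · push Not at hT
      obtain ⟨x, y, hc, hr, hne⟩ := hT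
      rw [kappa_single_eq_zero t T hne hc (swap_smul_tabloid T hr)]
      exact Submodule.zero_mem _
  exact (Submodule.finrank_mono h).trans (finrank_span_singleton (polytabloid_ne_zero t)).le

/-- The inclusion of a Specht submodule in the permutation module. -/
def spechtInclusion (p : n.Partition) : (specht p).toRepresentation.IntertwiningMap
    (Representation.ofMulAction ℂ (Perm (Fin n)) (Tabloid p)) :=
  ⟨(specht p).toSubmodule.subtype, fun _ => rfl⟩

theorem finrank_hom_specht_le_tabloid {m : ℕ} {V : Type*} [AddCommGroup V] [Module ℂ V]
    [FiniteDimensional ℂ V]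
    (q : m.Partition) (ρ : Representation ℂ (Perm (Fin m)) V) :
    Module.finrank ℂ (ρ.IntertwiningMap (specht q).toRepresentation) ≤
      Module.finrank ℂ (ρ.IntertwiningMap
        (Representation.ofMulAction ℂ (Perm (Fin m)) (Tabloid q))) := by
  let F : ρ.IntertwiningMap (specht q).toRepresentation →ₗ[ℂ] ρ.IntertwiningMap
        (Representation.ofMulAction ℂ (Perm (Fin m)) (Tabloid q)) :=
    { toFun := fun f => (spechtInclusion q).comp f
      map_add' := fun f g => by
        apply Representation.IntertwiningMap.ext; ext1 v; simp
      map_smul' := fun c f => by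
        rw [Representation.IntertwiningMap.comp_smul]; rfl }
  have : FiniteDimensional ℂ (ρ.IntertwiningMap
        (Representation.ofMulAction ℂ (Perm (Fin m)) (Tabloid q))) :=
    Module.Finite.equiv (Representation.invariantsEquivIntertwiningMap _ _)
  refine LinearMap.finrank_le_finrank_of_injective (f := F) fun f g h => ?_
  apply Representation.IntertwiningMap.ext
  ext1 v
  have := congrArg (fun k => k v) h
  exact Subtype.ext this

theorem finrank_end_specht_pos (p : n.Partition) :
    0 < Module.finrank ℂ ((specht p).toRepresentation.IntertwiningMap
      (specht p).toRepresentation) := by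
  have : FiniteDimensional ℂ ((specht p).toRepresentation.IntertwiningMap
      (specht p).toRepresentation) :=
    Module.Finite.equiv (Representation.invariantsEquivIntertwiningMap _ _)
  obtain ⟨t⟩ : Nonempty (Tableau p) := inferInstance
  have h := LinearMap.finrank_le_finrank_of_injective
    (f := LinearMap.toSpanSingleton ℂ ((specht p).toRepresentation.IntertwiningMap
      (specht p).toRepresentation) (.id _)) fun a b h => ?_
  · rwa [Module.finrank_self] at h
  have := congrArg (fun k => k (spechtVector t)) h
  have h2 : a • polytabloid t = b • polytabloid t := congrArg Subtype.val this
  rw [← sub_eq_zero, ← sub_smul] at h2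
  exact sub_eq_zero.1 ((smul_eq_zero.1 h2).resolve_right (polytabloid_ne_zero t))

theorem finrank_end_specht (p : n.Partition) :
    Module.finrank ℂ ((specht p).toRepresentation.IntertwiningMap
      (specht p).toRepresentation) = 1 :=
  le_antisymm ((finrank_hom_specht_le_tabloid p _).trans finrank_hom_specht_tabloid_le)
    (finrank_end_specht_pos p)

theorem finrank_hom_specht_tabloid :
    Module.finrank ℂ ((specht p).toRepresentation.IntertwiningMap
      (Representation.ofMulAction ℂ (Perm (Fin n)) (Tabloid p))) = 1 :=
  le_antisymm finrank_hom_specht_tabloid_le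
    ((finrank_end_specht p).ge.trans (finrank_hom_specht_le_tabloid p _))

end Column

/-! ### Class functions on symmetric groups -/

section ClassFunctions

variable {X : Type*} [Fintype X] [DecidableEq X]

/-- The averaged bilinear form on functions on a finite group. -/
def ip {G : Type*} [Fintype G] (F H : G → ℂ) : ℂ := (Fintype.card G : ℂ)⁻¹ * (F ⬝ᵥ H)

section
variable {G : Type*} [Fintype G]

theorem ip_def (F H : G → ℂ) : ip F H = (Fintype.card G : ℂ)⁻¹ * ∑ g, F g * H g := rfl

theorem ip_comm (F H : G → ℂ) : ip F H = ip H F := by rw [ip, ip, dotProduct_comm]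

theorem ip_sum_left {ι : Type*} (s : Finset ι) (F : ι → G → ℂ) (H : G → ℂ) :
    ip (∑ i ∈ s, F i) H = ∑ i ∈ s, ip (F i) H := by
  simp only [ip, sum_dotProduct, Finset.mul_sum]

theorem ip_smul_left (c : ℂ) (F H : G → ℂ) : ip (c • F) H = c * ip F H := by
  simp only [ip, smul_dotProduct, smul_eq_mul]; ring

end

/-- The functions that are constant on conjugacy classes. -/
def classFunctions (G : Type*) [Group G] : Submodule ℂ (G → ℂ) where
  carrier := {F | ∀ g h, F (h * g * h⁻¹) = F g}
  add_mem' hF hH g h := by simp only [Pi.add_apply, hF g h, hH g h]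
  zero_mem' _ _ := rfl
  smul_mem' c F hF g h := by simp only [Pi.smul_apply, hF g h]

theorem character_mem_classFunctions {G V : Type*} [Group G] [AddCommGroup V] [Module ℂ V]
    (ρ : Representation ℂ G V) : ρ.character ∈ classFunctions G :=
  fun g h => by rw [Representation.char_conj]

theorem chi_mem_classFunctions {n : ℕ} (p : n.Partition) : chi p ∈ classFunctions _ :=
  character_mem_classFunctions _

theorem classFunctions_eq_of_isConj {G : Type*} [Group G] {F : G → ℂ} (hF : F ∈ classFunctions G)
    {g h : G} (hc : IsConj g h) : F g = F h := by
  obtain ⟨c, rfl⟩ := isConj_iff.1 hc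
  exact (hF g c).symm

/-- A permutation is conjugate to its inverse. This lets the bilinear form `ip`, which has no
inverse or complex conjugate in it, compute dimensions of spaces of intertwining maps. -/
theorem classFunctions_inv {F : Perm X → ℂ} (hF : F ∈ classFunctions (Perm X)) (g : Perm X) :
    F g⁻¹ = F g :=
  classFunctions_eq_of_isConj hF (Perm.isConj_of_cycleType_eq (Perm.cycleType_inv g))

theorem ip_character {V W : Type*} [AddCommGroup V] [Module ℂ V] [FiniteDimensional ℂ V]
    [AddCommGroup W] [Module ℂ W] [FiniteDimensional ℂ W] (ρ : Representation ℂ (Perm X) V)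
    (ρ' : Representation ℂ (Perm X) W) :
    ip ρ'.character ρ.character = Module.finrank ℂ (ρ.IntertwiningMap ρ') := by
  have : Invertible (Nat.card (Perm X) : ℂ) :=
    invertibleOfNonzero (Nat.cast_ne_zero.2 Nat.card_pos.ne')
  rw [← Representation.card_inv_mul_sum_char_mul_char_eq_finrank, ip_def, Nat.card_eq_fintype_card]
  simp only [classFunctions_inv (character_mem_classFunctions ρ)]

theorem character_ofMulAction {G Y : Type*} [Group G] [MulAction G Y] [Fintype Y] [DecidableEq Y]
    (g : G) : (Representation.ofMulAction ℂ G Y).character g =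
      ((Finset.univ.filter fun y : Y => g • y = y).card : ℂ) := by
  let b : Module.Basis Y ℂ (MonoidAlgebra ℂ Y) := .ofRepr (MonoidAlgebra.coeffLinearEquiv ℂ)
  rw [Representation.character, LinearMap.trace_eq_matrix_trace ℂ b, Matrix.trace,
    Finset.card_filter, Nat.cast_sum]
  refine Finset.sum_congr rfl fun y _ => ?_
  have hb : b y = MonoidAlgebra.single y 1 := rfl
  have hr : ∀ v, b.repr v = v.coeff := fun _ => rfl
  rw [Matrix.diag_apply, LinearMap.toMatrix_apply, hb, Representation.ofMulAction_single, hr,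
    MonoidAlgebra.coeff_single, Finsupp.single_apply]
  split_ifs <;> simp

end ClassFunctions

/-! ### Functions with prescribed fibre sizes -/

section Content

variable {X C : Type*} [Fintype X] [DecidableEq C]

/-- The number of points that `f` sends to `c`. -/
def content (f : X → C) (c : C) : ℕ := (Finset.univ.filter fun x => f x = c).card

theorem content_comp_equiv {Y : Type*} [Fintype Y] (e : Y ≃ X) (f : X → C) :
    content (f ∘ e) = content f := by
  funext c
  refine Finset.card_bij (fun y _ => e y) ?_ ?_ ?_
  · intro y hy; simpa using hy
  · intro a _ b _ h; exact e.injective h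
  · intro x hx; exact ⟨e.symm x, by simpa using hx, by simp⟩

theorem card_filter_mem_eq_sum_content (f : X → C) (J : Finset C) :
    (Finset.univ.filter fun x => f x ∈ J).card = ∑ c ∈ J, content f c := by
  rw [Finset.card_eq_sum_card_fiberwise (f := f) (t := J)]
  · refine Finset.sum_congr rfl fun c hc => ?_
    rw [Finset.filter_filter, content]
    congr 1
    ext x
    simp only [Finset.mem_filter, Finset.mem_univ, true_and]
    exact ⟨fun h => h.2, fun h => ⟨h ▸ hc, h⟩⟩
  · intro x hx; simpa using hx

/-- The functions with prescribed fibre sizes. -/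
abbrev ContentFn (X : Type*) [Fintype X] {C : Type*} [DecidableEq C] (α : C → ℕ) :=
  {f : X → C // content f = α}

instance (α : C → ℕ) : MulAction (Perm X) (ContentFn X α) where
  smul σ f := ⟨fun x => f.1 (σ⁻¹ x), (content_comp_equiv (σ⁻¹) f.1).trans f.2⟩
  one_smul _ := rfl
  mul_smul _ _ _ := rfl

theorem ContentFn.smul_val {α : C → ℕ} (σ : Perm X) (f : ContentFn X α) (x : X) :
    (σ • f).1 x = f.1 (σ⁻¹ x) := rfl

theorem ContentFn.smul_eq_iff {α : C → ℕ} (σ : Perm X) (f : ContentFn X α) :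
    σ • f = f ↔ ∀ x, f.1 (σ x) = f.1 x := by
  rw [Subtype.ext_iff, funext_iff]
  constructor
  · intro h x
    rw [← h (σ x), ContentFn.smul_val, Perm.inv_def, Equiv.symm_apply_apply]
  · intro h x
    rw [ContentFn.smul_val, ← h, Perm.inv_def, Equiv.apply_symm_apply]

variable [Fintype C]

theorem nonempty_contentFn (α : C → ℕ) (h : ∑ c, α c = Fintype.card X) :
    Nonempty (ContentFn X α) := by
  obtain ⟨e⟩ : Nonempty (X ≃ Σ c, Fin (α c)) :=
    ⟨Fintype.equivOfCardEq (by simp [h])⟩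
  refine ⟨⟨fun x => (e x).1, ?_⟩⟩
  have h1 := content_comp_equiv e (Sigma.fst : (Σ c, Fin (α c)) → C)
  refine h1.trans (funext fun c => ?_)
  rw [content, ← Fintype.card_subtype, Fintype.card_congr (Equiv.sigmaSubtype c), Fintype.card_fin]

variable [DecidableEq X]

/-- The character of the permutation module on functions with prescribed fibre sizes. -/
def permChar (α : C → ℕ) (σ : Perm X) : ℂ :=
  ((Finset.univ.filter fun f : X → C => (∀ x, f (σ x) = f x) ∧ content f = α).card : ℂ)

theorem character_contentFn (α : C → ℕ) :
    (Representation.ofMulAction ℂ (Perm X) (ContentFn X α)).character = permChar α := by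
  funext σ
  rw [character_ofMulAction, permChar, Nat.cast_inj]
  refine Finset.card_bij (fun f _ => f.1) ?_ ?_ ?_
  · intro f hf
    simp only [Finset.mem_filter, Finset.mem_univ, true_and] at hf ⊢
    exact ⟨(ContentFn.smul_eq_iff σ f).1 hf, f.2⟩
  · intro f _ g _ h; exact Subtype.ext h
  · intro f hf
    simp only [Finset.mem_filter, Finset.mem_univ, true_and] at hf
    exact ⟨⟨f, hf.2⟩, Finset.mem_filter.2 ⟨Finset.mem_univ _, (ContentFn.smul_eq_iff σ ⟨f, hf.2⟩).2 hf.1⟩, rfl⟩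

instance (α : C → ℕ) : MulAction.IsPretransitive (Perm X) (ContentFn X α) where
  exists_smul_eq f g := by
    have e : ∀ c, {x // f.1 x = c} ≃ {x // g.1 x = c} := fun c =>
      Fintype.equivOfCardEq (by
        rw [Fintype.card_subtype, Fintype.card_subtype]
        exact congrFun (f.2.trans g.2.symm) c)
    refine ⟨Equiv.ofFiberEquiv e, Subtype.ext (funext fun x => ?_)⟩
    rw [ContentFn.smul_val]
    have := Equiv.ofFiberEquiv_map e ((Equiv.ofFiberEquiv e)⁻¹ x)
    rw [← this, Perm.inv_def, Equiv.apply_symm_apply]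

/-- Burnside's lemma for a transitive action. -/
theorem sum_permChar (α : C → ℕ) (h : ∑ c, α c = Fintype.card X) :
    ∑ σ : Perm X, permChar α σ = Fintype.card (Perm X) := by
  have := nonempty_contentFn (X := X) α h
  classical
  have ho : Subsingleton (MulAction.orbitRel.Quotient (Perm X) (ContentFn X α)) :=
    MulAction.pretransitive_iff_subsingleton_quotient _ _ |>.1 inferInstance
  have : Unique (MulAction.orbitRel.Quotient (Perm X) (ContentFn X α)) :=
    { default := Quotient.mk'' (Classical.arbitrary _), uniq := fun a => Subsingleton.elim _ _ }
  have hb := MulAction.sum_card_fixedBy_eq_card_orbits_mul_card_group (Perm X) (ContentFn X α)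
  rw [Fintype.card_unique, one_mul] at hb
  rw [← hb, Nat.cast_sum]
  refine Finset.sum_congr rfl fun σ _ => ?_
  rw [← character_contentFn, character_ofMulAction, ← Fintype.card_subtype]
  exact congrArg _ (Fintype.card_congr (Equiv.refl _))

end Content

/-! ### Orthogonality relations -/

section Orthogonality

variable {n : ℕ}

/-- The dominance order: `p` dominates `q`. -/
def Dominates (p q : n.Partition) : Prop :=
  ∀ r, ∑ i ∈ Finset.range r, row q i ≤ ∑ i ∈ Finset.range r, row p i

theorem Dominates.antisymm {p q : n.Partition} (h : Dominates p q) (h' : Dominates q p) :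
    p = q := by
  apply row_injective
  funext i
  have h1 := le_antisymm (h i) (h' i)
  have h2 := le_antisymm (h (i + 1)) (h' (i + 1))
  rw [Finset.sum_range_succ, Finset.sum_range_succ] at h2
  omega

theorem Dominates.trans {p q r : n.Partition} (h : Dominates p q) (h' : Dominates q r) :
    Dominates p r := fun i => (h' i).trans (h i)

/-- Pigeonhole: if the first `r` rows of `q` hold more symbols than those of `p`, every `q`-tabloid
has two symbols of one row in a common column of `t`, and `kappa t` kills it. -/
theorem dominates_of_finrank_hom_ne_zero {p q : n.Partition}
    (h : Module.finrank ℂ ((specht p).toRepresentation.IntertwiningMap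
      (Representation.ofMulAction ℂ (Perm (Fin n)) (Tabloid q))) ≠ 0) : Dominates p q := by
  intro r
  by_contra hr
  obtain ⟨t⟩ : Nonempty (Tableau p) := inferInstance
  refine h (finrank_hom_specht_eq_zero t fun T => ?_)
  by_contra hT
  push Not at hT
  have hle := card_filter_mem_le t T.1
    (fun x y hc he => by_contra fun hne => hT x y hne hc (swap_smul_tabloid T he))
    (Finset.range r)
  obtain ⟨s, hs⟩ := T.2
  rw [Finset.card_range, ← hs] at hle
  have := card_rowOf_lt s r
  simp only [Finset.mem_range] at hle
  omega

/-- A nonzero pairing forces dominance in both directions. -/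
theorem chi_orthonormal (p q : n.Partition) : ip (chi p) (chi q) = if p = q then 1 else 0 := by
  have hz : ∀ p q : n.Partition, ¬ Dominates q p → ip (chi p) (chi q) = 0 := by
    intro p q h
    rw [chi, chi, ip_character, Nat.cast_eq_zero]
    have h0 : Module.finrank ℂ ((specht q).toRepresentation.IntertwiningMap
      (Representation.ofMulAction ℂ (Perm (Fin n)) (Tabloid p))) = 0 :=
        by_contra fun hc => h (dominates_of_finrank_hom_ne_zero hc)
    exact Nat.le_zero.1 ((finrank_hom_specht_le_tabloid p _).trans h0.le)
  split_ifs with h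
  · subst h
    rw [chi, ip_character, finrank_end_specht, Nat.cast_one]
  · by_cases h1 : Dominates q p
    · rw [ip_comm]
      exact hz q p fun h2 => h (h2.antisymm h1)
    · exact hz p q h1

/-- The same pigeonhole for an arbitrary set `J` of values, since the contents occurring in
`psi_eq_sum_permChar` need not be sorted. -/
theorem ip_permChar_chi_eq_zero {C : Type*} [DecidableEq C] [Fintype C] (α : C → ℕ)
    (p : n.Partition) (J : Finset C)
    (h : ∑ i ∈ Finset.range J.card, row p i < ∑ c ∈ J, α c) :
    ip (permChar α) (chi p) = 0 := by
  rw [← character_contentFn, chi, ip_character, Nat.cast_eq_zero]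
  obtain ⟨t⟩ : Nonempty (Tableau p) := inferInstance
  refine finrank_hom_specht_eq_zero t fun f => ?_
  by_contra hf
  push Not at hf
  have hswap : ∀ a b, f.1 a = f.1 b → Equiv.swap a b • f = f := by
    intro a b hab
    rw [ContentFn.smul_eq_iff]
    intro x
    rcases eq_or_ne x a with rfl | hx
    · rw [Equiv.swap_apply_left, hab]
    · rcases eq_or_ne x b with rfl | hy
      · rw [Equiv.swap_apply_right, hab]
      · rw [Equiv.swap_apply_of_ne_of_ne hx hy]
  have hle := card_filter_mem_le t f.1
    (fun x y hc he => by_contra fun hne => hf x y hne hc (hswap x y he)) J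
  rw [card_filter_mem_eq_sum_content, f.2] at hle
  omega

/-- The tabloids of shape `p` are the functions whose fibre sizes are the rows of `p`. -/
theorem character_tabloid (p : n.Partition) {k : ℕ} (hk : p.parts.card ≤ k) :
    (Representation.ofMulAction ℂ (Perm (Fin n)) (Tabloid p)).character =
      permChar fun i : Fin k => row p i := by
  classical
  have := Fintype.ofFinite (Tabloid p)
  have hlt : ∀ (T : Tabloid p) x, T.1 x < k := by
    intro T x
    obtain ⟨s, hs⟩ := T.2
    rw [← hs]
    by_contra hc
    have := row_antitone p (not_lt.1 hc)
    rw [row_eq_zero p hk] at this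
    have := colOf_lt s x
    omega
  funext σ
  rw [character_ofMulAction, permChar, Nat.cast_inj]
  refine Finset.card_bij (fun T _ x => ⟨T.1 x, hlt T x⟩) ?_ ?_ ?_
  · intro T hT
    simp only [Finset.mem_filter, Finset.mem_univ, true_and, Fin.mk.injEq] at hT ⊢
    constructor
    · intro x
      have h : T.1 (σ⁻¹ (σ x)) = T.1 (σ x) := congrFun (congrArg Subtype.val hT) (σ x)
      rw [← h, Perm.inv_def, Equiv.symm_apply_apply]
    · funext i
      obtain ⟨s, hs⟩ := T.2
      rw [← card_rowOf_eq s, content, hs]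
      simp only [Fin.ext_iff]
  · intro T _ T' _ h
    exact Subtype.ext (funext fun x => congrArg Fin.val (congrFun h x))
  · intro f hf
    simp only [Finset.mem_filter, Finset.mem_univ, true_and] at hf
    have e : ∀ i : Fin k, {x // f x = i} ≃ Fin (row p i) := fun i =>
      Fintype.equivFinOfCardEq (by
        rw [Fintype.card_subtype]
        exact congrFun hf.2 i)
    let g : Fin n → (diagram p).cells := fun x =>
      ⟨((f x : ℕ), (e (f x) ⟨x, rfl⟩ : ℕ)), (mem_cells_iff p _).2 (e (f x) ⟨x, rfl⟩).2⟩
    have hg : Function.Bijective g := by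
      rw [Fintype.bijective_iff_injective_and_card]
      refine ⟨fun x y h => ?_, by simpa using (card_cells p).symm⟩
      simp only [g, Subtype.mk.injEq, Prod.mk.injEq] at h
      obtain ⟨h1, h2⟩ := h
      have hfx : f x = f y := Fin.ext h1
      have key : ∀ i (hx : f x = i) (hy : f y = i), (e i ⟨x, hx⟩ : ℕ) = e i ⟨y, hy⟩ → x = y := by
        intro i hx hy he
        exact congrArg Subtype.val ((e i).injective (Fin.ext he))
      refine key (f x) rfl hfx.symm (h2.trans ?_)
      generalize_proofs hy
      have aux : ∀ i (h' : f y = i), (e (f y) ⟨y, rfl⟩ : ℕ) = e i ⟨y, h'⟩ := by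
        rintro i rfl; rfl
      exact aux _ _
    have hT : ∃ t : Tableau p, rowOf t = fun x => (f x : ℕ) := ⟨Equiv.ofBijective g hg, rfl⟩
    refine ⟨⟨fun x => f x, hT⟩, Finset.mem_filter.2 ⟨Finset.mem_univ _, ?_⟩, rfl⟩
    apply Subtype.ext
    funext x
    change (f (σ⁻¹ x) : ℕ) = f x
    rw [← hf.1, Perm.inv_def, Equiv.apply_symm_apply]

theorem ip_permChar_chi_self (p : n.Partition) {k : ℕ} (hk : p.parts.card ≤ k) :
    ip (permChar fun i : Fin k => row p i) (chi p) = 1 := by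
  rw [← character_tabloid p hk, chi, ip_character, finrank_hom_specht_tabloid, Nat.cast_one]

theorem linearIndependent_chi : LinearIndependent ℂ (chi (n := n)) := by
  classical
  rw [Fintype.linearIndependent_iff]
  intro c hc p
  have h := congrArg (fun F => ip F (chi p)) hc
  simp only [ip_sum_left, ip_smul_left, chi_orthonormal] at h
  simpa [ip] using h

theorem finrank_classFunctions_le :
    Module.finrank ℂ (classFunctions (Perm (Fin n))) ≤ Fintype.card n.Partition := by
  classical
  let P := (Fintype.card (Fin n)).Partition
  -- One representative per cycle type determines a class function. The default `1` is harmless: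
  -- injectivity evaluates `rep` only at cycle types of actual permutations.
  let rep : P → Perm (Fin n) := fun q =>
    if h : ∃ σ : Perm (Fin n), σ.partition = q then h.choose else 1
  let L : classFunctions (Perm (Fin n)) →ₗ[ℂ] (P → ℂ) :=
    { toFun := fun F q => F.1 (rep q)
      map_add' := fun _ _ => rfl
      map_smul' := fun _ _ => rfl }
  have hL : Function.Injective L := by
    intro F F' h
    apply Subtype.ext
    funext σ
    have hσ : ∃ τ : Perm (Fin n), τ.partition = σ.partition := ⟨σ, rfl⟩
    have hrep : rep σ.partition = hσ.choose := dif_pos hσ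
    have hc : IsConj (rep σ.partition) σ := by
      rw [hrep, Perm.partition_eq_of_isConj]
      exact hσ.choose_spec
    rw [← classFunctions_eq_of_isConj F.2 hc, ← classFunctions_eq_of_isConj F'.2 hc]
    exact congrFun h σ.partition
  have := LinearMap.finrank_le_finrank_of_injective hL
  rw [Module.finrank_fintype_fun_eq_card] at this
  convert this using 2
  simp [P]

/-- The irreducible characters form an orthonormal basis of the class functions. -/
theorem eq_sum_ip_chi {F : Perm (Fin n) → ℂ} (hF : F ∈ classFunctions (Perm (Fin n))) :
    F = ∑ p : n.Partition, ip F (chi p) • chi p := by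
  classical
  have hle : Submodule.span ℂ (Set.range (chi (n := n))) ≤ classFunctions (Perm (Fin n)) := by
    rw [Submodule.span_le]
    rintro _ ⟨p, rfl⟩
    exact chi_mem_classFunctions p
  have heq := Submodule.eq_of_le_of_finrank_le hle
    (by rw [finrank_span_eq_card linearIndependent_chi]; exact finrank_classFunctions_le)
  rw [← heq, Submodule.mem_span_range_iff_exists_fun] at hF
  obtain ⟨c, rfl⟩ := hF
  refine Finset.sum_congr rfl fun p _ => ?_
  congr 1
  simp [ip_sum_left, ip_smul_left, chi_orthonormal]

end Orthogonality

/-! ### Alternating sums of permutation characters -/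

section Alternating

variable {k : ℕ}

/-- The alternating function that is the sign on the orbit of `(0, -1, …, 1 - k)`. -/
def altDet (α : Fin k → ℤ) : ℂ :=
  (Matrix.of fun i j : Fin k => if α i = -(j : ℤ) then (1 : ℂ) else 0).det

/-- Alternating functions of integer vectors. -/
def IsAlternating (A : (Fin k → ℤ) → ℂ) : Prop :=
  ∀ (β : Fin k → ℤ) (u : Perm (Fin k)), A (β ∘ u) = (((Perm.sign u : ℤˣ) : ℤ) : ℂ) * A β

theorem isAlternating_altDet : IsAlternating (altDet (k := k)) :=
  fun β u => Matrix.det_permute u (Matrix.of fun i j : Fin k => if β i = -(j : ℤ) then (1 : ℂ) else 0)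

theorem IsAlternating.swap {A : (Fin k → ℤ) → ℂ} (hA : IsAlternating A) (β : Fin k → ℤ)
    {i j : Fin k} (hij : i ≠ j) : A (β ∘ Equiv.swap i j) = -A β := by
  rw [hA, Perm.sign_swap hij]
  simp

theorem IsAlternating.eq_zero {A : (Fin k → ℤ) → ℂ} (hA : IsAlternating A) {β : Fin k → ℤ}
    {i j : Fin k} (hij : i ≠ j) (h : β i = β j) : A β = 0 := by
  have hs : β ∘ Equiv.swap i j = β := by
    funext x
    rcases eq_or_ne x i with rfl | hx
    · simp [h]
    · rcases eq_or_ne x j with rfl | hy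
      · simp [h]
      · simp [Equiv.swap_apply_of_ne_of_ne hx hy]
  have := hA.swap β hij
  rw [hs] at this
  exact self_eq_neg.1 this

theorem altDet_eq_zero_of_lt {α : Fin k → ℤ} (i : Fin k) (h : α i < -((k : ℤ) - 1)) :
    altDet α = 0 := by
  refine Matrix.det_eq_zero_of_row_eq_zero i fun j => ?_
  rw [Matrix.of_apply, if_neg]
  have := j.2
  omega

theorem altDet_eq_zero_of_pos {α : Fin k → ℤ} (i : Fin k) (h : 0 < α i) :
    altDet α = 0 := by
  refine Matrix.det_eq_zero_of_row_eq_zero i fun j => ?_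
  rw [Matrix.of_apply, if_neg]
  omega

theorem altDet_eq_sum (α : Fin k → ℤ) : altDet α =
    ∑ w : Perm (Fin k), (((Perm.sign w : ℤˣ) : ℤ) : ℂ) *
      if (∀ j, α j = -((w⁻¹ j : Fin k) : ℤ)) then 1 else 0 := by
  rw [altDet, Matrix.det_apply']
  refine Finset.sum_congr rfl fun w _ => ?_
  congr 1
  simp only [Matrix.of_apply]
  rw [Finset.prod_ite_zero]
  simp only [Finset.prod_const_one]
  refine if_congr ?_ rfl rfl
  constructor
  · intro h j
    simpa using h (w⁻¹ j) (Finset.mem_univ _)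
  · intro h i _
    simpa using h (w i)

theorem content_sumElim {X Y : Type*} [Fintype X] [Fintype Y] (f : X → Fin k) (g : Y → Fin k) :
    content (Sum.elim f g) = content f + content g := by
  funext c
  simp only [content, Pi.add_apply, ← Fintype.card_subtype]
  rw [← Fintype.card_sum]
  exact Fintype.card_congr Equiv.subtypeSum

variable {X Y : Type*} [Fintype X] [DecidableEq X] [Fintype Y] [DecidableEq Y]

/-- The alternating sum of permutation characters attached to an integer vector. -/
def psi (β : Fin k → ℤ) (σ : Perm X) : ℂ :=
  ∑ f : X → Fin k with ∀ x, f (σ x) = f x, altDet fun i => β i - content f i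

theorem psi_permCongr (β : Fin k → ℤ) (e : X ≃ Y) (σ : Perm X) :
    psi β (e.permCongr σ) = psi β σ := by
  rw [psi, psi]
  refine Finset.sum_bij' (fun f _ => f ∘ e) (fun f _ => f ∘ e.symm) ?_ ?_ ?_ ?_ ?_
  · intro f hf
    simp only [Finset.mem_filter, Finset.mem_univ, true_and] at hf ⊢
    intro x
    simpa using hf (e x)
  · intro f hf
    simp only [Finset.mem_filter, Finset.mem_univ, true_and] at hf ⊢
    intro x
    simpa using hf (e.symm x)
  · intro f _; ext x; simp
  · intro f _; ext x; simp
  · intro f _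
    rw [content_comp_equiv]

theorem psi_mem_classFunctions (β : Fin k → ℤ) : psi (X := X) β ∈ classFunctions (Perm X) := by
  intro g h
  rw [← psi_permCongr β h g]
  rfl

theorem isAlternating_psi (σ : Perm X) : IsAlternating fun β : Fin k → ℤ => psi β σ := by
  intro β u
  simp only [psi]
  rw [Finset.mul_sum]
  refine Finset.sum_bij' (fun f _ => u ∘ f) (fun f _ => u.symm ∘ f) ?_ ?_ ?_ ?_ ?_
  · intro f hf
    simp only [Finset.mem_filter, Finset.mem_univ, true_and] at hf ⊢
    intro x
    simp [hf]
  · intro f hf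
    simp only [Finset.mem_filter, Finset.mem_univ, true_and] at hf ⊢
    intro x
    simp [hf]
  · intro f _; ext x; simp
  · intro f _; ext x; simp
  · intro f _
    rw [← isAlternating_altDet]
    congr 1
    funext i
    simp [content]

theorem psi_eq_zero_of_lt {β : Fin k → ℤ} (i : Fin k) (h : β i < -((k : ℤ) - 1)) (σ : Perm X) :
    psi β σ = 0 := by
  refine Finset.sum_eq_zero fun f _ => altDet_eq_zero_of_lt i ?_
  omega

/-- The source of all restriction rules: an invariant function on `X ⊕ Y` is a pair of invariant
functions and contents add, so the part on `X` merely shifts `β`. -/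
theorem psi_sumCongr (β : Fin k → ℤ) (σ : Perm X) (τ : Perm Y) :
    psi β (Equiv.sumCongr σ τ) =
      ∑ f : X → Fin k with ∀ x, f (σ x) = f x, psi (fun i => β i - content f i) τ := by
  simp only [psi]
  rw [Finset.sum_sigma']
  refine Finset.sum_bij' (fun f _ => ⟨f ∘ Sum.inl, f ∘ Sum.inr⟩) (fun f _ => Sum.elim f.1 f.2)
    ?_ ?_ ?_ ?_ ?_
  · intro f hf
    simp only [Finset.mem_filter, Finset.mem_univ, true_and, Finset.mem_sigma] at hf ⊢
    exact ⟨fun x => hf (.inl x), fun x => hf (.inr x)⟩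
  · intro f hf
    simp only [Finset.mem_filter, Finset.mem_univ, true_and, Finset.mem_sigma] at hf ⊢
    rintro (x | x)
    · exact hf.1 x
    · exact hf.2 x
  · intro f _; simp
  · intro f _; simp
  · intro f _
    congr 1
    funext i
    conv_lhs => rw [← Sum.elim_comp_inl_inr f, content_sumElim]
    simp only [Pi.add_apply]
    push_cast
    ring

theorem content_const_unit (i : Fin k) :
    (fun j => (content (fun _ : Unit => i) j : ℤ)) = Pi.single i 1 := by
  funext j
  by_cases h : i = j
  · subst h; simp [content]
  · simp [content, h, Ne.symm h]

/-- The branching rule for alternating sums. -/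
theorem psi_optionCongr (β : Fin k → ℤ) (σ : Perm X) :
    psi β (Equiv.optionCongr σ) = ∑ i, psi (β - Pi.single i 1) σ := by
  have h : Equiv.optionCongr σ =
      ((Equiv.sumComm _ _).trans (Equiv.optionEquivSumPUnit X).symm).permCongr
        (Equiv.sumCongr (1 : Perm Unit) σ) := by
    ext x : 1
    cases x <;> simp [Equiv.permCongr_apply]
  rw [h, psi_permCongr, psi_sumCongr, Finset.filter_true_of_mem (by simp)]
  rw [← (Equiv.funUnique Unit (Fin k)).symm.sum_comp]
  refine Finset.sum_congr rfl fun i _ => ?_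
  congr 1
  funext j
  rw [Pi.sub_apply, ← content_const_unit]
  rfl

theorem psi_sumCongr_one (β : Fin k → ℤ) (τ : Perm Y) :
    psi β (Equiv.sumCongr (1 : Perm (Fin 2)) τ) =
      ∑ i, ∑ j, psi (β - Pi.single i 1 - Pi.single j 1) τ := by
  rw [psi_sumCongr]
  simp only [Perm.one_apply, implies_true, Finset.filter_true]
  rw [← Finset.sum_product', Finset.univ_product_univ, ← (finTwoArrowEquiv (Fin k)).symm.sum_comp]
  refine Finset.sum_congr rfl fun p _ => ?_
  congr 1
  funext i
  simp only [Pi.sub_apply, content, finTwoArrowEquiv_symm_apply, Finset.card_filter,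
    Fin.sum_univ_two, Pi.single_apply, eq_comm (a := i), Matrix.cons_val_zero, Matrix.cons_val_one]
  by_cases h1 : p.1 = i <;> by_cases h2 : p.2 = i <;> simp [h1, h2, sub_sub]

/-- A function invariant under the swap is constant on the two points, so a single entry drops by 2.
Averaged with `psi_sumCongr_one`, this is the identity `h₂ = (p₁² + p₂) / 2`. -/
theorem psi_sumCongr_swap (β : Fin k → ℤ) (τ : Perm Y) :
    psi β (Equiv.sumCongr (Equiv.swap (0 : Fin 2) 1) τ) = ∑ i, psi (β - Pi.single i 2) τ := by
  rw [psi_sumCongr]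
  refine Finset.sum_bij' (fun f _ => f 0) (fun i _ _ => i) (by simp) (by simp) ?_ (by simp) ?_
  · intro f hf
    simp only [Finset.mem_filter, Finset.mem_univ, true_and] at hf
    have := hf 0
    rw [Equiv.swap_apply_left] at this
    funext x
    fin_cases x
    · rfl
    · exact this.symm
  · intro f hf
    simp only [Finset.mem_filter, Finset.mem_univ, true_and] at hf
    have := hf 0
    rw [Equiv.swap_apply_left] at this
    congr 1
    funext i
    simp only [Pi.sub_apply, content, Finset.card_filter, Fin.sum_univ_two, this, Pi.single_apply,
      eq_comm (a := i)]
    split_ifs <;> simp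

/-- The expansion in permutation characters. -/
theorem psi_eq_sum_permChar (β : Fin k → ℤ) : psi (X := X) β =
    ∑ w : Perm (Fin k), (((Perm.sign w : ℤˣ) : ℤ) : ℂ) •
      if (∀ j, 0 ≤ β j + ((w⁻¹ j : Fin k) : ℤ)) then
        permChar (fun j => (β j + ((w⁻¹ j : Fin k) : ℤ)).toNat) else 0 := by
  funext σ
  simp only [psi, altDet_eq_sum]
  rw [Finset.sum_comm, Finset.sum_apply]
  refine Finset.sum_congr rfl fun w _ => ?_
  rw [← Finset.mul_sum, Pi.smul_apply, smul_eq_mul]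
  congr 1
  split_ifs with h
  · rw [permChar, ← Finset.sum_filter, Finset.filter_filter, Finset.sum_const, nsmul_one]
    congr 2
    ext f
    simp only [Finset.mem_filter, Finset.mem_univ, true_and, funext_iff]
    refine and_congr_right fun _ => forall_congr' fun j => ?_
    have := h j
    omega
  · rw [Pi.zero_apply]
    refine Finset.sum_eq_zero fun f _ => if_neg fun hf => h fun j => ?_
    have := hf j
    omega

end Alternating

/-! ### The determinantal formula for the irreducible characters -/

section Strips

variable {k : ℕ}

/-- The integer vectors obtained from `β` by lowering its entries by `m` in total. -/
def lowerings (β : Fin k → ℤ) (m : ℕ) : Finset (Fin k → ℤ) :=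
  (Finset.piAntidiag Finset.univ m).image fun a i => β i - (a i : ℤ)

theorem mem_lowerings {β γ : Fin k → ℤ} {m : ℕ} :
    γ ∈ lowerings β m ↔ (∀ i, γ i ≤ β i) ∧ ∑ i, (β i - γ i) = m := by
  simp only [lowerings, Finset.mem_image, Finset.mem_piAntidiag, Finset.mem_univ, implies_true,
    and_true]
  constructor
  · rintro ⟨a, ha, rfl⟩
    refine ⟨fun i => by simp, ?_⟩
    simp only [sub_sub_cancel, ← ha]
    push_cast
    rfl
  · rintro ⟨h, hs⟩
    refine ⟨fun i => (β i - γ i).toNat, ?_, ?_⟩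
    · zify
      rw [← hs]
      refine Finset.sum_congr rfl fun i _ => ?_
      have := h i
      omega
    · funext i
      have := h i
      simp only
      omega

theorem sum_lowerings (β : Fin k → ℤ) (m : ℕ) (A : (Fin k → ℤ) → ℂ) :
    ∑ γ ∈ lowerings β m, A γ =
      ∑ a ∈ Finset.piAntidiag (Finset.univ : Finset (Fin k)) m, A fun i => β i - (a i : ℤ) := by
  rw [lowerings, Finset.sum_image]
  intro a _ b _ h
  funext i
  have := congrFun h i
  simp only at this
  omega

theorem swap_mem_lowerings {β γ : Fin k → ℤ} {m : ℕ} (hγ : γ ∈ lowerings β m) {i j : Fin k}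
    (hi : γ i ≤ β j) (hj : γ j ≤ β i) : γ ∘ Equiv.swap i j ∈ lowerings β m := by
  rw [mem_lowerings] at hγ ⊢
  refine ⟨fun x => ?_, ?_⟩
  · rcases eq_or_ne x i with rfl | hx
    · simpa using hj
    · rcases eq_or_ne x j with rfl | hy
      · simpa using hi
      · simpa [Equiv.swap_apply_of_ne_of_ne hx hy] using hγ.1 x
  · rw [← hγ.2, Finset.sum_sub_distrib, Finset.sum_sub_distrib]
    congr 1
    exact Equiv.sum_comp (Equiv.swap i j) γ

/-- An alternating function summed over all lowerings of a strictly decreasing vector only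
sees the lowerings that form a horizontal strip. -/
theorem exists_strip_of_sum_lowerings_ne_zero {A : (Fin k → ℤ) → ℂ} (hA : IsAlternating A)
    {β : Fin k → ℤ} (hβ : StrictAnti β) {m : ℕ} (h : ∑ γ ∈ lowerings β m, A γ ≠ 0) :
    ∃ γ ∈ lowerings β m, A γ ≠ 0 ∧ ∀ i (hi : i + 1 < k), β ⟨i + 1, hi⟩ < γ ⟨i, by omega⟩ := by
  classical
  by_contra hcon
  push Not at hcon
  apply h
  -- An index is bad if the strip condition fails there. Swapping the entry at the first bad index
  -- with the next one stays among the lowerings, reverses the sign of `A`, and keeps the first bad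
  -- index, as earlier entries are untouched. The bad terms therefore cancel in pairs.
  let bad : (Fin k → ℤ) → ℕ → Prop := fun γ i =>
    ∃ hi : i + 1 < k, γ ⟨i, by omega⟩ ≤ β ⟨i + 1, hi⟩
  have hb : ∀ γ ∈ lowerings β m, A γ ≠ 0 → ∃ i, bad γ i := fun γ hγ h0 => by
    obtain ⟨i, hi, hle⟩ := hcon γ hγ h0
    exact ⟨i, hi, hle⟩
  let T : (Fin k → ℤ) → Fin k → ℤ := fun γ =>
    if hγ : ∃ i, bad γ i then γ ∘ Equiv.swap ⟨Nat.find hγ, by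
        obtain ⟨hi, -⟩ := Nat.find_spec hγ; omega⟩
      ⟨Nat.find hγ + 1, (Nat.find_spec hγ).1⟩ else γ
  have hT : ∀ γ (hγ : ∃ i, bad γ i), ∃ i, ∃ hi : i + 1 < k, bad γ i ∧ (∀ j < i, ¬ bad γ j) ∧
      T γ = γ ∘ Equiv.swap ⟨i, by omega⟩ ⟨i + 1, hi⟩ := fun γ hγ =>
    ⟨Nat.find hγ, (Nat.find_spec hγ).1, Nat.find_spec hγ, fun j hj => Nat.find_min hγ hj,
      dif_pos hγ⟩
  have hT' : ∀ γ i (hi : i + 1 < k), bad γ i → (∀ j < i, ¬ bad γ j) →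
      T γ = γ ∘ Equiv.swap ⟨i, by omega⟩ ⟨i + 1, hi⟩ := by
    intro γ i hi h1 h2
    obtain ⟨i', hi', h1', h2', e⟩ := hT γ ⟨i, h1⟩
    have : i' = i := by
      rcases lt_trichotomy i' i with h | h | h
      · exact absurd h1' (h2 _ h)
      · exact h
      · exact absurd h1 (h2' _ h)
    subst this
    exact e
  rw [← Finset.sum_filter_add_sum_filter_not _ (fun γ => ∃ i, bad γ i)]
  have hgood : ∑ γ ∈ (lowerings β m).filter (fun γ => ¬ ∃ i, bad γ i), A γ = 0 := by
    refine Finset.sum_eq_zero fun γ hγ => ?_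
    rw [Finset.mem_filter] at hγ
    by_contra h0
    exact hγ.2 (hb γ hγ.1 h0)
  rw [hgood, add_zero]
  refine Finset.sum_involution (fun γ _ => T γ) ?_ ?_ ?_ ?_
  · intro γ hγ
    obtain ⟨i, hi, -, -, e⟩ := hT γ (Finset.mem_filter.1 hγ).2
    rw [e, hA.swap _ (by simp), add_neg_cancel]
  · intro γ hγ h0 he
    obtain ⟨i, hi, -, -, e⟩ := hT γ (Finset.mem_filter.1 hγ).2
    have h1 : A (T γ) = -A γ := by rw [e, hA.swap _ (by simp)]
    rw [he] at h1
    exact h0 (self_eq_neg.1 h1)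
  · intro γ hγ
    obtain ⟨hmem, hbad⟩ := Finset.mem_filter.1 hγ
    obtain ⟨i, hi, ⟨_, hle⟩, -, e⟩ := hT γ hbad
    rw [e, Finset.mem_filter]
    have hj : γ ⟨i + 1, hi⟩ ≤ β ⟨i + 1, hi⟩ := (mem_lowerings.1 hmem).1 _
    have hlt : β ⟨i + 1, hi⟩ < β ⟨i, by omega⟩ := hβ (by simp)
    exact ⟨swap_mem_lowerings hmem hle (hj.trans hlt.le), i, hi, by simpa using hj⟩
  · intro γ hγ
    obtain ⟨hmem, hbad⟩ := Finset.mem_filter.1 hγ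
    obtain ⟨i, hi, ⟨_, hle⟩, hmin, e⟩ := hT γ hbad
    have hj : γ ⟨i + 1, hi⟩ ≤ β ⟨i + 1, hi⟩ := (mem_lowerings.1 hmem).1 _
    rw [hT' (T γ) i hi ⟨hi, by simpa [e] using hj⟩, e]
    · funext x; simp
    · rintro j hji ⟨hj', hle'⟩
      refine hmin j hji ⟨hj', ?_⟩
      rw [e, Function.comp_apply, Equiv.swap_apply_of_ne_of_ne] at hle'
      · exact hle'
      · simp; omega
      · simp; omega

/-- Iterated sums of `altDet` over lowerings of sizes `μ 0, …, μ (l - 1)`. -/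
def iterLower (μ : ℕ → ℕ) : ℕ → (Fin k → ℤ) → ℂ
  | 0 => altDet
  | l + 1 => fun β => ∑ γ ∈ lowerings β (μ l), iterLower μ l γ

theorem isAlternating_iterLower (μ : ℕ → ℕ) (l : ℕ) :
    IsAlternating (iterLower (k := k) μ l) := by
  induction l with
  | zero => exact isAlternating_altDet
  | succ l ih =>
    intro β u
    simp only [iterLower]
    rw [Finset.mul_sum]
    refine Finset.sum_bij' (fun γ _ => γ ∘ u.symm) (fun γ _ => γ ∘ u) ?_ ?_ ?_ ?_ ?_
    · intro γ hγ
      rw [mem_lowerings] at hγ ⊢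
      refine ⟨fun i => by simpa using hγ.1 (u.symm i), ?_⟩
      rw [← hγ.2, ← Equiv.sum_comp u]
      simp
    · intro γ hγ
      rw [mem_lowerings] at hγ ⊢
      refine ⟨fun i => hγ.1 (u i), ?_⟩
      rw [← hγ.2, ← Equiv.sum_comp u (fun i => β i - γ i)]
      rfl
    · intro γ _; funext x; simp
    · intro γ _; funext x; simp
    · intro γ _
      rw [← ih]
      congr 1
      funext x; simp

/-- A nonzero coefficient forces dominance. -/
theorem bounds_of_iterLower_ne_zero (μ : ℕ → ℕ) (l : ℕ) (β : Fin k → ℤ) (hβ : StrictAnti β)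
    (h : iterLower μ l β ≠ 0) :
    (∀ i : Fin k, l ≤ i → β i + i ≤ 0) ∧
      ∀ j ≤ l, (∑ i : Fin k, if j ≤ (i : ℕ) then β i + i else 0) ≤
        ∑ i ∈ Finset.Ico j l, (μ i : ℤ) := by
  induction l generalizing β with
  | zero =>
    -- A nonzero determinant has no positive entry in its vector, so `β 0 ≤ 0`; strict decrease
    -- carries the bound to the later entries.
    have h0 : ∀ i : Fin k, β i + i ≤ 0 := by
      intro ⟨i, hi⟩
      induction i with
      | zero =>
        by_contra hc
        exact h (altDet_eq_zero_of_pos ⟨0, hi⟩ (by simpa using hc))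
      | succ i ih =>
        have h1 := ih (by omega)
        have h2 : β ⟨i + 1, hi⟩ < β ⟨i, by omega⟩ := hβ (by simp)
        simp only at h1 ⊢
        push_cast
        omega
    refine ⟨fun i _ => h0 i, fun j hj => ?_⟩
    obtain rfl : j = 0 := Nat.le_zero.1 hj
    simpa using Finset.sum_nonpos fun i _ => h0 i
  | succ l ih =>
    obtain ⟨γ, hγ, h0, hs⟩ :=
      exists_strip_of_sum_lowerings_ne_zero (isAlternating_iterLower μ l) hβ h
    rw [mem_lowerings] at hγ
    have hγa : StrictAnti γ := by
      intro i j hij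
      have hi : (i : ℕ) + 1 < k := by have := j.2; have : (i : ℕ) < j := hij; omega
      have h1 := hs i hi
      have h2 : β j ≤ β ⟨i + 1, hi⟩ := hβ.antitone (by
        have : (i : ℕ) < j := hij
        exact Fin.mk_le_of_le_val this)
      have h3 := hγ.1 j
      simp only [Fin.eta] at h1
      omega
    obtain ⟨ih1, ih2⟩ := ih γ hγa h0
    -- In terms of rows, the strip condition says that row `i + 1` before the lowering is at most
    -- row `i` after it. Each lowering thus weakens the bound on the number of rows by only one.
    have hA : ∀ i : Fin k, l + 1 ≤ i → β i + i ≤ 0 := by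
      intro ⟨i, hi⟩ hl
      simp only at hl
      obtain ⟨i, rfl⟩ : ∃ i', i = i' + 1 := ⟨i - 1, by omega⟩
      have h1 := hs i hi
      have h2 := ih1 ⟨i, by omega⟩ (by simp only; omega)
      simp only at h2 ⊢
      push_cast
      omega
    refine ⟨hA, fun j hj => ?_⟩
    rcases Nat.lt_or_ge l j with hlj | hlj
    · obtain rfl : j = l + 1 := by omega
      rw [Finset.Ico_self, Finset.sum_empty]
      refine Finset.sum_nonpos fun i _ => ?_
      split_ifs with hi
      · exact hA i hi
      · exact le_rfl
    · rw [Finset.sum_Ico_succ_top hlj, ← hγ.2]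
      calc (∑ i : Fin k, if j ≤ (i : ℕ) then β i + i else 0)
          ≤ ∑ i : Fin k, ((if j ≤ (i : ℕ) then γ i + i else 0) + (β i - γ i)) := by
            refine Finset.sum_le_sum fun i _ => ?_
            have := hγ.1 i
            split_ifs <;> omega
        _ ≤ _ := by
            rw [Finset.sum_add_distrib]
            exact add_le_add (ih2 j hlj) le_rfl

end Strips

/-! ### Two-sided triangularity of the alternating sums and the determinantal formula. -/

section Determinantal

variable {k : ℕ}

/-- Unrolls the recursion: successive lowerings form one matrix with row sums `μ j`, the index set
that appears in `psi_mul_permChar`. -/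
theorem sum_piFinset_altDet (μ : ℕ → ℕ) (l : ℕ) (β : Fin k → ℤ) :
    ∑ A ∈ Fintype.piFinset fun j : Fin l => Finset.piAntidiag (Finset.univ : Finset (Fin k)) (μ j),
      altDet (fun i => β i - ∑ j, (A j i : ℤ)) = iterLower μ l β := by
  induction l generalizing β with
  | zero =>
    have : (Fintype.piFinset fun j : Fin 0 =>
        Finset.piAntidiag (Finset.univ : Finset (Fin k)) (μ j)) = Finset.univ := by
      ext A; simp
    rw [this]
    simp [iterLower]
  | succ l ih =>
    simp only [iterLower]
    rw [sum_lowerings]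
    simp only [← ih]
    rw [← Finset.sum_product']
    symm
    refine Finset.sum_equiv (Fin.snocEquiv fun _ => Fin k → ℕ) ?_ ?_
    · rintro ⟨a, A⟩
      simp only [Finset.mem_product, Fintype.mem_piFinset, Fin.forall_fin_succ', Fin.snocEquiv_apply,
        Fin.snoc_castSucc, Fin.snoc_last, Fin.val_castSucc, Fin.val_last]
      exact and_comm
    · rintro ⟨a, A⟩ _
      congr 1
      funext i
      simp only [Fin.snocEquiv_apply, Fin.sum_univ_castSucc, Fin.snoc_castSucc, Fin.snoc_last]
      ring

theorem content_fst {X C D : Type*} [Fintype X] [DecidableEq C] [DecidableEq D] [Fintype D]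
    (h : X → C × D) (c : C) : content (fun x => (h x).1) c = ∑ d, content h (c, d) := by
  rw [content, Finset.card_eq_sum_card_fiberwise (f := fun x => (h x).2) (t := Finset.univ)]
  · refine Finset.sum_congr rfl fun d _ => ?_
    rw [content, Finset.filter_filter]
    simp only [Prod.ext_iff]
  · intro x _; simp

theorem content_snd {X C D : Type*} [Fintype X] [DecidableEq C] [DecidableEq D] [Fintype C]
    (h : X → C × D) (d : D) : content (fun x => (h x).2) d = ∑ c, content h (c, d) := by
  rw [content, Finset.card_eq_sum_card_fiberwise (f := fun x => (h x).1) (t := Finset.univ)]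
  · refine Finset.sum_congr rfl fun c _ => ?_
    rw [content, Finset.filter_filter]
    simp only [Prod.ext_iff, and_comm]
  · intro x _; simp

variable {X : Type*} [Fintype X] [DecidableEq X]

/-- Two invariant functions are one invariant function into the product, and these are sorted by
their matrix of contents, whose column sums give the content seen by `altDet`. -/
theorem psi_mul_permChar (β : Fin k → ℤ) {l : ℕ} (α : Fin l → ℕ) (σ : Perm X) :
    psi β σ * permChar α σ =
      ∑ A ∈ Fintype.piFinset fun j => Finset.piAntidiag (Finset.univ : Finset (Fin k)) (α j),
        altDet (fun i => β i - ∑ j, (A j i : ℤ)) *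
          permChar (fun c : Fin l × Fin k => A c.1 c.2) σ := by
  classical
  let T : Finset (X → Fin l × Fin k) := Finset.univ.filter fun h =>
    (∀ x, h (σ x) = h x) ∧ content (fun x => (h x).1) = α
  trans ∑ h ∈ T, altDet fun i => β i - content (fun x => (h x).2) i
  · rw [psi, permChar, ← nsmul_one, Finset.sum_mul]
    simp only [nsmul_one, mul_comm _ (Nat.cast _ : ℂ), ← nsmul_eq_mul, ← Finset.sum_const]
    rw [← Finset.sum_product']
    refine Finset.sum_bij' (fun fg _ x => (fg.2 x, fg.1 x))
      (fun h _ => (fun x => (h x).2, fun x => (h x).1)) ?_ ?_ ?_ ?_ ?_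
    · rintro ⟨f, g⟩ hfg
      simp only [Finset.mem_product, Finset.mem_filter, Finset.mem_univ, true_and, T] at hfg ⊢
      exact ⟨fun x => Prod.ext (hfg.2.1 x) (hfg.1 x), hfg.2.2⟩
    · intro h hh
      simp only [Finset.mem_product, Finset.mem_filter, Finset.mem_univ, true_and, T] at hh ⊢
      exact ⟨fun x => by rw [hh.1], fun x => by rw [hh.1], hh.2⟩
    · intro _ _; rfl
    · intro _ _; rfl
    · intro _ _; rfl
  · rw [← Finset.sum_fiberwise_of_maps_to (t := Fintype.piFinset fun j =>
      Finset.piAntidiag (Finset.univ : Finset (Fin k)) (α j))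
      (g := fun h j i => content h (j, i))]
    · refine Finset.sum_congr rfl fun A hA => ?_
      rw [permChar, mul_comm, ← nsmul_eq_mul, ← Finset.sum_const, Finset.filter_filter]
      refine Finset.sum_congr ?_ ?_
      · ext h
        simp only [Finset.mem_filter, Finset.mem_univ, true_and, and_assoc]
        refine and_congr_right fun _ => ?_
        simp only [funext_iff, Prod.forall]
        constructor
        · exact fun hh => hh.2
        · intro hh
          refine ⟨fun j => ?_, hh⟩
          rw [content_fst]
          simp only [hh]
          simpa using (Fintype.mem_piFinset.1 hA j)
      · intro h hh
        simp only [Finset.mem_filter, Finset.mem_univ, true_and, funext_iff, Prod.forall] at hh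
        congr 1
        funext i
        rw [content_snd]
        simp only [hh.2]
        push_cast
        rfl
    · intro h hh
      simp only [Finset.mem_filter, Finset.mem_univ, true_and, T] at hh
      rw [Fintype.mem_piFinset]
      intro j
      simp [← content_fst, hh.2]

theorem ip_psi_permChar (β : Fin k → ℤ) {l : ℕ} (μ : ℕ → ℕ)
    (h : ∑ j : Fin l, μ j = Fintype.card X) :
    ip (psi (X := X) β) (permChar fun j : Fin l => μ j) = iterLower μ l β := by
  rw [ip_def]
  simp only [psi_mul_permChar]
  rw [Finset.sum_comm, ← sum_piFinset_altDet, Finset.mul_sum]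
  refine Finset.sum_congr rfl fun A hA => ?_
  rw [← Finset.mul_sum, sum_permChar, mul_comm, mul_assoc, mul_inv_cancel₀, mul_one]
  · exact Nat.cast_ne_zero.2 Fintype.card_ne_zero
  · rw [← h, Fintype.sum_prod_type]
    refine Finset.sum_congr rfl fun j _ => ?_
    simpa using (Fintype.mem_piFinset.1 hA j)

/-- The strictly decreasing vector `(λ₀, λ₁ - 1, λ₂ - 2, …)` of a partition. -/
def beta {n : ℕ} (k : ℕ) (p : n.Partition) (i : Fin k) : ℤ := row p i - (i : ℤ)

theorem beta_strictAnti {n : ℕ} (p : n.Partition) : StrictAnti (beta k p) := by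
  intro i j hij
  have h1 := row_antitone p (Fin.le_def.1 hij.le)
  have h2 : (i : ℕ) < j := hij
  simp only [beta]
  omega

variable {n : ℕ}

theorem sum_if_le_add (f : Fin k → ℤ) (r : ℕ) :
    (∑ i : Fin k, if (i : ℕ) < r then f i else 0) + (∑ i : Fin k, if r ≤ (i : ℕ) then f i else 0) =
      ∑ i, f i := by
  rw [← Finset.sum_add_distrib]
  refine Finset.sum_congr rfl fun i _ => ?_
  split_ifs <;> omega

theorem sum_if_lt_row (p : n.Partition) (hk : p.parts.card ≤ k) (r : ℕ) :
    (∑ i : Fin k, if (i : ℕ) < r then (row p i : ℤ) else 0) = ∑ i ∈ Finset.range r, (row p i : ℤ) := by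
  rw [← Finset.sum_range (fun i => if i < r then (row p i : ℤ) else 0)]
  rw [← Finset.sum_filter]
  refine Finset.sum_subset (fun i hi => ?_) (fun i hi hi' => ?_)
  · simp at hi ⊢; exact hi.2
  · simp only [Finset.mem_filter, Finset.mem_range, not_and'] at hi hi'
    rw [row_eq_zero p (hk.trans (not_lt.1 (hi' hi)))]
    rfl

/-- The bounds for `iterLower` compare tails: those of `p` are at most those of `q`. Both totals are
`n`, so the initial sums compare the other way. -/
theorem dominates_of_ip_psi_permChar_ne_zero {p q : n.Partition} (hk : p.parts.card ≤ k)
    (h : ip (psi (X := Fin n) (beta k p)) (permChar fun j : Fin q.parts.card => row q j) ≠ 0) :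
    Dominates p q := by
  have hq := sum_row q le_rfl
  rw [ip_psi_permChar _ (row q) (by rw [Fintype.card_fin, ← Finset.sum_range]; exact hq)] at h
  obtain ⟨-, h2⟩ := bounds_of_iterLower_ne_zero _ _ _ (beta_strictAnti p) h
  simp only [beta, sub_add_cancel] at h2
  have hle : ∀ r ≤ q.parts.card,
      ∑ i ∈ Finset.range r, row q i ≤ ∑ i ∈ Finset.range r, row p i := by
    intro r hr
    have h3 := h2 r hr
    have h4 := sum_if_le_add (fun i : Fin k => (row p i : ℤ)) r
    rw [sum_if_lt_row p hk, ← Finset.sum_range (fun i => (row p i : ℤ)), ← Nat.cast_sum,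
      ← Nat.cast_sum, sum_row p hk] at h4
    have h5 := Finset.sum_range_add_sum_Ico (row q) hr
    rw [hq] at h5
    have h6 : ∑ i ∈ Finset.Ico r q.parts.card, (row q i : ℤ) =
      ((∑ i ∈ Finset.Ico r q.parts.card, row q i : ℕ) : ℤ) := by push_cast; rfl
    rw [h6] at h3
    omega
  intro r
  rcases le_total r q.parts.card with hr | hr
  · exact hle r hr
  · rw [sum_row q hr]
    exact hq.ge.trans ((hle _ le_rfl).trans (Finset.sum_le_sum_of_subset (by simpa using hr)))

theorem sum_range_le_sum_perm (u : Perm (Fin k)) (r : ℕ) :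
    (∑ i : Fin k, if (i : ℕ) < r then (i : ℤ) else 0) ≤
      ∑ i : Fin k, if (i : ℕ) < r then ((u i : Fin k) : ℤ) else 0 := by
  -- compare `∑ (x - r)` over the two sets of positions
  have h1 : ∑ i : Fin k, (if (i : ℕ) < r then ((u i : Fin k) : ℤ) - r else 0) ≥
      ∑ i : Fin k, (if ((u i : Fin k) : ℕ) < r then ((u i : Fin k) : ℤ) - r else 0) := by
    refine Finset.sum_le_sum fun i _ => ?_
    split_ifs <;> omega
  rw [Equiv.sum_comp u (fun i : Fin k => if (i : ℕ) < r then (i : ℤ) - r else 0)] at h1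
  have h2 : ∀ f : Fin k → ℤ, ∑ i : Fin k, (if (i : ℕ) < r then f i - r else 0) =
      (∑ i : Fin k, if (i : ℕ) < r then f i else 0) - ∑ i : Fin k, if (i : ℕ) < r then (r : ℤ) else 0 := by
    intro f
    rw [← Finset.sum_sub_distrib]
    refine Finset.sum_congr rfl fun i _ => ?_
    split_ifs <;> simp
  rw [h2, h2] at h1
  omega

/-- By `sum_range_le_sum_perm` all these initial sums are equal, and consecutive differences read
off `u j = j`. -/
theorem perm_eq_one_of_sum_le (u : Perm (Fin k))
    (h : ∀ r, (∑ i : Fin k, if (i : ℕ) < r then ((u i : Fin k) : ℤ) else 0) ≤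
      ∑ i : Fin k, if (i : ℕ) < r then (i : ℤ) else 0) : u = 1 := by
  have heq := fun r => le_antisymm (h r) (sum_range_le_sum_perm u r)
  have hstep : ∀ (f : Fin k → ℤ) (j : Fin k),
      (∑ i : Fin k, if (i : ℕ) < j + 1 then f i else 0) =
        (∑ i : Fin k, if (i : ℕ) < j then f i else 0) + f j := by
    intro f j
    have : f j = ∑ i, if i = j then f i else 0 := by simp
    rw [this, ← Finset.sum_add_distrib]
    refine Finset.sum_congr rfl fun i _ => ?_
    by_cases hij : i = j
    · subst hij; simp
    · have : (i : ℕ) ≠ j := fun h => hij (Fin.ext h)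
      simp only [hij, if_false, add_zero]
      refine if_congr ?_ rfl rfl
      omega
  ext j
  have h1 := heq (j + 1)
  rw [hstep, hstep, heq j] at h1
  simp only [Perm.one_apply]
  omega

/-- The content attached to `w` has entries `row p j + w⁻¹ j - j`. Its initial sums are at least
those of `p`, because `r` distinct indices sum to at least `0 + ⋯ + (r - 1)`, and at most those of
`q` if `chi q` occurs. For `q = p` equality holds throughout, which forces `w = 1`. -/
theorem ip_psi_chi_cases {p q : n.Partition} (hk : p.parts.card ≤ k)
    (w : Perm (Fin k)) (h0 : ∀ j, 0 ≤ beta k p j + ((w⁻¹ j : Fin k) : ℤ))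
    (h : ip (permChar (X := Fin n) fun j => (beta k p j + ((w⁻¹ j : Fin k) : ℤ)).toNat) (chi q) ≠ 0) :
    Dominates q p ∧ (q = p → w = 1) := by
  have hr : ∀ r, (∑ i ∈ Finset.range r, (row p i : ℤ)) +
      ((∑ i : Fin k, if (i : ℕ) < r then ((w⁻¹ i : Fin k) : ℤ) else 0) -
        ∑ i : Fin k, if (i : ℕ) < r then (i : ℤ) else 0) ≤
      ((∑ i ∈ Finset.range r, row q i : ℕ) : ℤ) := by
    intro r
    have hJ := not_lt.1 fun hlt => h (ip_permChar_chi_eq_zero _ q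
      (Finset.univ.filter fun j : Fin k => (j : ℕ) < r) hlt)
    have hcard : (Finset.univ.filter fun j : Fin k => (j : ℕ) < r).card ≤ r := by
      rw [← Finset.card_range r]
      exact Finset.card_le_card_of_injOn (fun j => (j : ℕ)) (by intro j hj; simpa using hj)
        (fun a _ b _ hab => Fin.ext hab)
    have hJ2 : ∑ j ∈ Finset.univ.filter (fun j : Fin k => (j : ℕ) < r),
        (beta k p j + ((w⁻¹ j : Fin k) : ℤ)).toNat ≤ ∑ i ∈ Finset.range r, row q i :=
      hJ.trans (Finset.sum_le_sum_of_subset (by simpa using hcard))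
    have hJ3 : ((∑ j ∈ Finset.univ.filter (fun j : Fin k => (j : ℕ) < r),
        (beta k p j + ((w⁻¹ j : Fin k) : ℤ)).toNat : ℕ) : ℤ) =
        ∑ i : Fin k, if (i : ℕ) < r then (row p i : ℤ) + (((w⁻¹ i : Fin k) : ℤ) - i) else 0 := by
      rw [Nat.cast_sum, Finset.sum_filter]
      refine Finset.sum_congr rfl fun i _ => ?_
      have := h0 i
      simp only [beta] at this ⊢
      split_ifs <;> omega
    rw [← sum_if_lt_row p hk, ← Finset.sum_sub_distrib, ← Finset.sum_add_distrib]
    refine le_trans (le_of_eq ?_) (hJ3.symm.le.trans (Int.ofNat_le.2 hJ2))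
    refine Finset.sum_congr rfl fun i _ => ?_
    split_ifs <;> simp
  constructor
  · intro r
    have h1 := hr r
    have h2 := sum_range_le_sum_perm w⁻¹ r
    have h7 : ∑ i ∈ Finset.range r, (row p i : ℤ) =
      ((∑ i ∈ Finset.range r, row p i : ℕ) : ℤ) := by push_cast; rfl
    rw [h7] at h1
    omega
  · rintro rfl
    rw [← inv_eq_one]
    refine perm_eq_one_of_sum_le _ fun r => ?_
    have h1 := hr r
    push_cast at h1
    linarith

theorem ip_psi_chi_eq (p q : n.Partition) (k : ℕ) :
    ip (psi (X := Fin n) (beta k p)) (chi q) =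
      ∑ w : Perm (Fin k), (((Perm.sign w : ℤˣ) : ℤ) : ℂ) *
        if (∀ j, 0 ≤ beta k p j + ((w⁻¹ j : Fin k) : ℤ)) then
          ip (permChar (fun j => (beta k p j + ((w⁻¹ j : Fin k) : ℤ)).toNat)) (chi q) else 0 := by
  rw [psi_eq_sum_permChar, ip_sum_left]
  refine Finset.sum_congr rfl fun w _ => ?_
  rw [ip_smul_left]
  split_ifs
  · rfl
  · simp [ip]

theorem dominates_of_ip_psi_chi_ne_zero {p q : n.Partition} (hk : p.parts.card ≤ k)
    (h : ip (psi (X := Fin n) (beta k p)) (chi q) ≠ 0) : Dominates q p := by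
  by_contra hd
  apply h
  rw [ip_psi_chi_eq]
  refine Finset.sum_eq_zero fun w _ => ?_
  split_ifs with h0
  · rw [mul_eq_zero]
    right
    by_contra hne
    exact hd (ip_psi_chi_cases hk w h0 hne).1
  · rw [mul_zero]

theorem ip_psi_chi_self {p : n.Partition} (hk : p.parts.card ≤ k) :
    ip (psi (X := Fin n) (beta k p)) (chi p) = 1 := by
  rw [ip_psi_chi_eq, Finset.sum_eq_single_of_mem 1 (Finset.mem_univ _)]
  · have h0 : ∀ j : Fin k, beta k p j + (((1 : Perm (Fin k))⁻¹ j : Fin k) : ℤ) = row p j := by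
      intro j
      simp [beta]
    simp only [h0]
    simp only [Nat.cast_nonneg, implies_true, if_true, Int.toNat_natCast]
    rw [ip_permChar_chi_self p hk]
    simp
  · intro w _ hw
    split_ifs with h0
    · rw [mul_eq_zero]
      right
      by_contra hne
      exact hw ((ip_psi_chi_cases hk w h0 hne).2 rfl)
    · rw [mul_zero]

theorem dominates_of_ip_permChar_row_chi_ne_zero {p q : n.Partition}
    (h : ip (permChar fun j : Fin p.parts.card => row p j) (chi q) ≠ 0) : Dominates q p := by
  rw [← character_tabloid p le_rfl, chi, ip_character, Nat.cast_ne_zero] at h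
  exact dominates_of_finrank_hom_ne_zero h

/-- Take a highest counterexample `q`. The permutation character of `q` is `chi q` plus multiples of
characters of higher partitions, which by maximality do not pair with `psi`. Its own pairing with
`psi` vanishes by `dominates_of_ip_psi_permChar_ne_zero`, hence so does that of `chi q`. -/
theorem dominates_of_ip_psi_chi_ne_zero' {p q : n.Partition} (hk : p.parts.card ≤ k)
    (h : ip (psi (X := Fin n) (beta k p)) (chi q) ≠ 0) : Dominates p q := by
  classical
  by_contra hd
  -- A number that strictly increases along dominance, so a maximum of it over a finite set is
  -- maximal for dominance.
  let height : n.Partition → ℕ := fun q => ∑ r ∈ Finset.range (n + 1), ∑ i ∈ Finset.range r, row q i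
  have hheight : ∀ q κ : n.Partition, Dominates κ q → κ ≠ q → height q < height κ := by
    intro q κ hdom hne
    refine Finset.sum_lt_sum (fun r _ => hdom r) ?_
    by_contra hall
    push Not at hall
    apply hne
    refine ext_of_row (card_parts_le κ) (card_parts_le q) fun i hi => ?_
    have h1 := le_antisymm (hdom i) (hall i (by simp; omega))
    have h2 := le_antisymm (hdom (i + 1)) (hall (i + 1) (by simp; omega))
    rw [Finset.sum_range_succ, Finset.sum_range_succ] at h2
    omega
  let S : Finset n.Partition := Finset.univ.filter fun q =>
    ip (psi (X := Fin n) (beta k p)) (chi q) ≠ 0 ∧ ¬ Dominates p q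
  obtain ⟨q, hq, hmax⟩ := Finset.exists_max_image S height ⟨q, by simp [S, h, hd]⟩
  simp only [S, Finset.mem_filter, Finset.mem_univ, true_and] at hq hmax
  obtain ⟨hq0, hqd⟩ := hq
  have hz : ip (psi (X := Fin n) (beta k p)) (permChar fun j : Fin q.parts.card => row q j) = 0 :=
    by_contra fun hc => hqd (dominates_of_ip_psi_permChar_ne_zero hk hc)
  have hcl : (permChar fun j : Fin q.parts.card => row q j) ∈ classFunctions (Perm (Fin n)) := by
    rw [← character_tabloid q le_rfl]
    exact character_mem_classFunctions _
  rw [ip_comm, eq_sum_ip_chi hcl, ip_sum_left, Finset.sum_eq_single_of_mem q (Finset.mem_univ _),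
    ip_smul_left, ip_permChar_chi_self q le_rfl, one_mul, ip_comm] at hz
  · exact hq0 hz
  · intro κ _ hκ
    rw [ip_smul_left, mul_eq_zero]
    by_contra hc
    push Not at hc
    have hκq := dominates_of_ip_permChar_row_chi_ne_zero hc.1
    have hκp : ¬ Dominates p κ := fun hpk => hqd (hpk.trans hκq)
    have h1 := hmax κ ⟨by rw [ip_comm]; exact hc.2, hκp⟩
    have h2 := hheight q κ hκq hκ
    omega

/-- The determinantal formula: irreducible characters are alternating sums of permutation
characters. -/
theorem chi_eq_psi (p : n.Partition) (hk : p.parts.card ≤ k) : chi p = psi (beta k p) := by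
  classical
  rw [eq_sum_ip_chi (psi_mem_classFunctions (beta k p)),
    Finset.sum_eq_single_of_mem p (Finset.mem_univ _)]
  · rw [ip_psi_chi_self hk, one_smul]
  · intro q _ hq
    rw [smul_eq_zero]
    left
    by_contra hc
    exact hq ((dominates_of_ip_psi_chi_ne_zero hk hc).antisymm
      (dominates_of_ip_psi_chi_ne_zero' hk hc))

end Determinantal

/-! ### Vectors that come from partitions -/

section Classify

variable {k n : ℕ}

theorem beta_injective {p q : n.Partition} (hp : p.parts.card ≤ k) (hq : q.parts.card ≤ k)
    (h : beta k p = beta k q) : p = q := by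
  refine ext_of_row hp hq fun i hi => ?_
  have := congrFun h ⟨i, hi⟩
  simp only [beta] at this
  omega

theorem sum_beta (p : n.Partition) (hp : p.parts.card ≤ k) : ∑ i, (beta k p i + i) = n := by
  simp only [beta, sub_add_cancel]
  rw [← Finset.sum_range (fun i => (row p i : ℤ)), ← Nat.cast_sum, sum_row p hp]

theorem exists_beta_eq {β : Fin k → ℤ} (hβ : StrictAnti β) (h0 : ∀ i, -((k : ℤ) - 1) ≤ β i)
    (hs : ∑ i, (β i + i) = n) : ∃ p : n.Partition, p.parts.card ≤ k ∧ beta k p = β := by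
  have hstep : ∀ i (hi : i + 1 < k), β ⟨i + 1, hi⟩ < β ⟨i, by omega⟩ := fun i hi => hβ (by simp)
  -- Induction on the distance `d` from the last index, where the lower bound `1 - k` says exactly
  -- that the row is nonnegative.
  have hnn : ∀ d i (hi : i < k), i + d + 1 = k → 0 ≤ β ⟨i, hi⟩ + i := by
    intro d
    induction d with
    | zero => intro i hi h; have := h0 ⟨i, hi⟩; omega
    | succ d ih =>
      intro i hi h
      have h1 := ih (i + 1) (by omega) (by omega)
      have h2 := hstep i (by omega)
      push_cast at h1
      omega
  have hnn' : ∀ i (hi : i < k), 0 ≤ β ⟨i, hi⟩ + i := fun i hi => hnn (k - 1 - i) i hi (by omega)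
  let r : ℕ → ℕ := fun i => if h : i < k then (β ⟨i, h⟩ + i).toNat else 0
  have hr : ∀ i (h : i < k), (r i : ℤ) = β ⟨i, h⟩ + i := by
    intro i h
    have := hnn' i h
    simp only [r, h, dif_pos]
    omega
  have hanti : Antitone r := by
    refine antitone_nat_of_succ_le fun i => ?_
    by_cases hi : i + 1 < k
    · have h1 := hr (i + 1) hi
      have h2 := hr i (by omega)
      have h3 := hstep i hi
      push_cast at h1
      omega
    · simp [r, hi]
  obtain ⟨p, hp, hpk⟩ := exists_partition_row (n := n) r hanti (k := k) (by simp [r]) (by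
    zify
    rw [← hs, Finset.sum_range (fun i => (r i : ℤ))]
    exact Finset.sum_congr rfl fun i _ => hr i i.2)
  refine ⟨p, hpk, funext fun i => ?_⟩
  rw [beta, hp, hr i i.2]
  simp

theorem IsAlternating.eq_zero_of_antitone {A : (Fin k → ℤ) → ℂ} (hA : IsAlternating A)
    {β : Fin k → ℤ} (h : Antitone β) (h' : ¬ StrictAnti β) : A β = 0 := by
  have hinj : ¬ Function.Injective β := fun hi => h' (h.strictAnti_of_injective hi)
  simp only [Function.Injective, not_forall] at hinj
  obtain ⟨i, j, hij, hne⟩ := hinj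
  exact hA.eq_zero hne hij

/-- A weakly decreasing vector is attached to a partition, or its alternating sum vanishes. -/
theorem exists_beta_eq_or_eq_zero {β : Fin k → ℤ} (hβ : Antitone β) (hs : ∑ i, (β i + i) = n)
    {A : (Fin k → ℤ) → ℂ} (hA : IsAlternating A)
    (hA' : ∀ γ (i : Fin k), γ i < -((k : ℤ) - 1) → A γ = 0) :
    (∃ p : n.Partition, p.parts.card ≤ k ∧ beta k p = β) ∨ A β = 0 := by
  by_cases h : StrictAnti β
  · by_cases h0 : ∀ i, -((k : ℤ) - 1) ≤ β i
    · exact Or.inl (exists_beta_eq h h0 hs)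
    · push Not at h0
      obtain ⟨i, hi⟩ := h0
      exact Or.inr (hA' β i hi)
  · exact Or.inr (hA.eq_zero_of_antitone hβ h)

/-- A strictly decreasing vector stays weakly decreasing when one entry changes by one. So no
sorting is needed after moving a cell: the result comes from a partition, repeats an entry, or falls
below `1 - k`. -/
theorem antitone_beta_sub (p : n.Partition) (i : Fin k) :
    Antitone (beta k p - Pi.single i 1) := by
  intro a b hab
  rcases hab.eq_or_lt with rfl | hlt
  · exact le_rfl
  · have := beta_strictAnti p hlt
    simp only [Pi.sub_apply, Pi.single_apply]
    split_ifs <;> omega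

theorem antitone_beta_add (p : n.Partition) (i : Fin k) :
    Antitone (beta k p + Pi.single i 1) := by
  intro a b hab
  rcases hab.eq_or_lt with rfl | hlt
  · exact le_rfl
  · have := beta_strictAnti p hlt
    simp only [Pi.add_apply, Pi.single_apply]
    split_ifs <;> omega

end Classify

/-! ### Class functions on the permutations of an arbitrary finite type -/

section Transport

variable {k n : ℕ} {X : Type*} [Fintype X] [DecidableEq X]

theorem chi_permCongr (p : n.Partition) (hp : p.parts.card ≤ k) (e : X ≃ Fin n) (σ : Perm X) :
    chi p (e.permCongr σ) = psi (beta k p) σ := by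
  rw [chi_eq_psi p hp, psi_permCongr]

theorem ip_comp_permCongr {Y : Type*} [Fintype Y] [DecidableEq Y] (e : X ≃ Y) (F H : Perm Y → ℂ) :
    ip (fun σ => F (e.permCongr σ)) (fun σ => H (e.permCongr σ)) = ip F H := by
  rw [ip_def, ip_def, Fintype.card_congr e.permCongr]
  congr 1
  exact Equiv.sum_comp e.permCongr fun σ => F σ * H σ

theorem psi_orthonormal (hX : Fintype.card X = n) {p q : n.Partition} (hp : p.parts.card ≤ k)
    (hq : q.parts.card ≤ k) :
    ip (psi (X := X) (beta k p)) (psi (beta k q)) = if p = q then 1 else 0 := by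
  have e : X ≃ Fin n := Fintype.equivFinOfCardEq hX
  rw [← chi_orthonormal, ← ip_comp_permCongr e]
  simp only [chi_permCongr p hp, chi_permCongr q hq]

theorem eq_sum_ip_psi (hX : Fintype.card X = n) (hk : n ≤ k) {F : Perm X → ℂ}
    (hF : F ∈ classFunctions (Perm X)) :
    F = ∑ p : n.Partition, ip F (psi (beta k p)) • psi (X := X) (beta k p) := by
  have e : X ≃ Fin n := Fintype.equivFinOfCardEq hX
  have hF' : (fun σ => F (e.symm.permCongr σ)) ∈ classFunctions (Perm (Fin n)) := by
    intro g h
    have : e.symm.permCongr (h * g * h⁻¹) = e.symm.permCongr h * e.symm.permCongr g *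
        (e.symm.permCongr h)⁻¹ := by
      exact (map_mul e.symm.permCongrHom _ _).trans
        (congrArg₂ (· * ·) (map_mul e.symm.permCongrHom _ _) (map_inv e.symm.permCongrHom _))
    simp only [this]
    exact hF _ _
  funext σ
  have h := congrFun (eq_sum_ip_chi hF') (e.permCongr σ)
  have hs : ∀ σ, e.symm.permCongr (e.permCongr σ) = σ := by intro σ; ext x; simp
  simp only [hs] at h
  rw [h, Finset.sum_apply, Finset.sum_apply]
  refine Finset.sum_congr rfl fun p _ => ?_
  have hp := (card_parts_le p).trans hk
  rw [Pi.smul_apply, Pi.smul_apply, chi_permCongr p hp, ← ip_comp_permCongr e]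
  simp only [hs, chi_permCongr p hp]

end Transport

/-! ### Induction from the stabilizer of a point -/

section Branching

theorem exists_optionCongr_eq {Y : Type*} (g : Perm (Option Y)) (hg : g none = none) :
    ∃ h : Perm Y, Equiv.optionCongr h = g := by
  refine ⟨Equiv.removeNone g, ?_⟩
  ext1 x
  cases x with
  | none => simp [hg]
  | some x =>
    rw [Equiv.optionCongr_apply, Option.map_some]
    refine Equiv.removeNone_some g (Option.ne_none_iff_exists'.1 fun h => ?_)
    exact Option.some_ne_none x (g.injective (h.trans hg.symm))

theorem optionCongr_mul {Y : Type*} (g h : Perm Y) :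
    Equiv.optionCongr (g * h) = Equiv.optionCongr g * Equiv.optionCongr h := by
  ext1 x
  cases x <;> rfl

theorem optionCongr_inv {Y : Type*} (g : Perm Y) :
    Equiv.optionCongr g⁻¹ = (Equiv.optionCongr g)⁻¹ := rfl

variable {Y : Type*} [Fintype Y] [DecidableEq Y]

/-- The class function on the permutations of `Option Y` induced from the stabilizer of `none`. -/
def indOption (f : Perm Y → ℂ) (g : Perm (Option Y)) : ℂ :=
  (Fintype.card (Perm Y) : ℂ)⁻¹ * ∑ x : Perm (Option Y), ∑ h : Perm Y,
    if Equiv.optionCongr h = x * g * x⁻¹ then f h else 0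

theorem indOption_mem_classFunctions (f : Perm Y → ℂ) :
    indOption f ∈ classFunctions (Perm (Option Y)) := by
  intro g c
  rw [indOption, indOption]
  congr 1
  rw [← Equiv.sum_comp (Equiv.mulRight c⁻¹)]
  refine Finset.sum_congr rfl fun x _ => Finset.sum_congr rfl fun h _ => ?_
  simp [mul_assoc]

/-- Frobenius reciprocity, by the substitution `g = x⁻¹ * h * x` in each summand. -/
theorem ip_indOption (f : Perm Y → ℂ) {F : Perm (Option Y) → ℂ}
    (hF : F ∈ classFunctions (Perm (Option Y))) :
    ip (indOption f) F = ip f fun h => F (Equiv.optionCongr h) := by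
  rw [ip_def, ip_def]
  simp only [indOption]
  simp_rw [mul_assoc (Fintype.card (Perm Y) : ℂ)⁻¹, Finset.sum_mul]
  rw [← Finset.mul_sum, mul_left_comm]
  congr 1
  rw [Finset.sum_comm]
  have hx : ∀ x : Perm (Option Y), ∑ g : Perm (Option Y), (∑ h : Perm Y,
      (if Equiv.optionCongr h = x * g * x⁻¹ then f h else 0) * F g) =
      ∑ h : Perm Y, f h * F (Equiv.optionCongr h) := by
    intro x
    rw [Finset.sum_comm]
    refine Finset.sum_congr rfl fun h _ => ?_
    rw [Finset.sum_eq_single_of_mem (x⁻¹ * Equiv.optionCongr h * x) (Finset.mem_univ _)]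
    · have h1 := hF (Equiv.optionCongr h) x⁻¹
      rw [inv_inv] at h1
      rw [h1, if_pos (by group)]
    · intro g _ hg
      rw [if_neg, zero_mul]
      intro he
      apply hg
      rw [he]
      group
  simp only [hx, Finset.sum_const, Finset.card_univ, nsmul_eq_mul]
  rw [inv_mul_cancel_left₀]
  exact Nat.cast_ne_zero.2 Fintype.card_ne_zero

/-- The average of an induced class function over a transitive group. -/
theorem sum_indOption {W : Type*} [Group W] [Fintype W] (φ : W →* Perm (Option Y))
    (hφ : ∀ y, ∃ w, φ w none = y) {f : Perm Y → ℂ} (hf : f ∈ classFunctions (Perm Y)) :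
    ∑ w, indOption f (φ w) = (Fintype.card Y + 1 : ℂ) *
      ∑ w, ∑ h : Perm Y, if Equiv.optionCongr h = φ w then f h else 0 := by
  simp only [indOption]
  rw [← Finset.mul_sum, Finset.sum_comm]
  have hx : ∀ x : Perm (Option Y), ∑ w, (∑ h : Perm Y,
      if Equiv.optionCongr h = x * φ w * x⁻¹ then f h else 0) =
      ∑ w, ∑ h : Perm Y, if Equiv.optionCongr h = φ w then f h else 0 := by
    intro x
    -- Transitivity means a single double coset: `x` is a permutation fixing `none` times the
    -- inverse of an element of the image of `φ`. Conjugation by the two factors is absorbed by the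
    -- sums over `h` and `w`.
    obtain ⟨w₀, hw₀⟩ := hφ (x⁻¹ none)
    obtain ⟨c, hc⟩ := exists_optionCongr_eq (x * φ w₀) (by
      rw [Perm.mul_apply, hw₀, Perm.inv_def, Equiv.apply_symm_apply])
    have hxc : x = Equiv.optionCongr c * (φ w₀)⁻¹ := by rw [hc]; group
    rw [← Equiv.sum_comp (MulAut.conj w₀).toEquiv]
    refine Finset.sum_congr rfl fun w _ => ?_
    rw [← Equiv.sum_comp (MulAut.conj c).toEquiv]
    refine Finset.sum_congr rfl fun h _ => ?_
    simp only [MulEquiv.toEquiv_eq_coe, MulEquiv.coe_toEquiv, MulAut.conj_apply, hf h c]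
    refine if_congr ?_ rfl rfl
    rw [hxc, optionCongr_mul, optionCongr_mul, optionCongr_inv, map_mul, map_mul, map_inv]
    constructor
    · intro he
      have : Equiv.optionCongr h = (Equiv.optionCongr c)⁻¹ * (Equiv.optionCongr c *
        Equiv.optionCongr h * (Equiv.optionCongr c)⁻¹) * Equiv.optionCongr c := by group
      rw [this, he]
      group
    · intro he
      rw [he]
      group
  simp only [hx, Finset.sum_const, Finset.card_univ, nsmul_eq_mul]
  rw [← mul_assoc]
  congr 1
  -- The factor `|Y| + 1` is the index of the point stabilizer.
  rw [Fintype.card_perm, Fintype.card_perm, Fintype.card_option, Nat.factorial_succ]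
  have : ((Fintype.card Y).factorial : ℂ) ≠ 0 := Nat.cast_ne_zero.2 (Nat.factorial_ne_zero _)
  push_cast
  field_simp

variable {k n : ℕ}

theorem sum_vec_add_single (β : Fin k → ℤ) (i : Fin k) (c : ℤ) :
    ∑ j, ((β + Pi.single i c : Fin k → ℤ) j + j) = ∑ j, (β j + j) + c := by
  simp only [Pi.add_apply, Finset.sum_add_distrib, Finset.sum_pi_single', Finset.mem_univ, if_true]
  ring

theorem sum_vec_sub_single (β : Fin k → ℤ) (i : Fin k) (c : ℤ) :
    ∑ j, ((β - Pi.single i c : Fin k → ℤ) j + j) = ∑ j, (β j + j) - c := by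
  have h : β - Pi.single i c = β + Pi.single i (-c) := by rw [Pi.single_neg, sub_eq_add_neg]
  rw [h, sum_vec_add_single]
  ring

/-- The branching rule for induction. -/
theorem indOption_psi (hY : Fintype.card Y = n) (hk : n + 1 ≤ k) (p : n.Partition) :
    indOption (psi (X := Y) (beta k p)) = ∑ i, psi (beta k p + Pi.single i 1) := by
  classical
  have hpk := (card_parts_le p).trans ((Nat.le_succ n).trans hk)
  have hY' : Fintype.card (Option Y) = n + 1 := by rw [Fintype.card_option, hY]
  rw [eq_sum_ip_psi hY' hk (indOption_mem_classFunctions _)]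
  -- Reciprocity turns each coefficient into one of a restriction, in which a lowered vector either
  -- comes from a partition or contributes zero.
  have hcoef : ∀ q : (n + 1).Partition, ip (indOption (psi (X := Y) (beta k p))) (psi (beta k q)) =
      ∑ i, if beta k q = beta k p + Pi.single i 1 then 1 else 0 := by
    intro q
    have hqk := (card_parts_le q).trans hk
    rw [ip_indOption _ (psi_mem_classFunctions _), ip_comm]
    simp only [psi_optionCongr]
    have : (fun h : Perm Y => ∑ i, psi (beta k q - Pi.single i 1) h) =
        ∑ i, psi (X := Y) (beta k q - Pi.single i 1) := by
      funext h; rw [Finset.sum_apply]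
    rw [this, ip_sum_left]
    refine Finset.sum_congr rfl fun i _ => ?_
    by_cases hex : ∃ p' : n.Partition, p'.parts.card ≤ k ∧ beta k p' = beta k q - Pi.single i 1
    · obtain ⟨p', hp', he⟩ := hex
      rw [← he, psi_orthonormal hY hp' hpk]
      refine if_congr ?_ rfl rfl
      constructor
      · rintro rfl; rw [he, sub_add_cancel]
      · intro h; exact beta_injective hp' hpk (by rw [he, h, add_sub_cancel_right])
    · rw [if_neg]
      · have hz : psi (X := Y) (beta k q - Pi.single i 1) = 0 := by
          funext σ
          refine (exists_beta_eq_or_eq_zero (n := n) (antitone_beta_sub q i) ?_ (isAlternating_psi σ)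
            fun γ j hj => psi_eq_zero_of_lt j hj σ).resolve_left hex
          rw [sum_vec_sub_single, sum_beta q hqk]
          push_cast; ring
        rw [hz]
        simp [ip]
      · intro h
        exact hex ⟨p, hpk, by rw [h, add_sub_cancel_right]⟩
  simp only [hcoef, Finset.sum_smul]
  rw [Finset.sum_comm]
  refine Finset.sum_congr rfl fun i _ => ?_
  by_cases hex : ∃ q : (n + 1).Partition, q.parts.card ≤ k ∧ beta k q = beta k p + Pi.single i 1
  · obtain ⟨q, hq, he⟩ := hex
    rw [Finset.sum_eq_single_of_mem q (Finset.mem_univ _), if_pos he, one_smul, he]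
    intro q' _ hne
    rw [if_neg, zero_smul]
    intro h
    exact hne (beta_injective ((card_parts_le q').trans hk) hq (h.trans he.symm))
  · rw [Finset.sum_eq_zero]
    · symm
      funext σ
      refine (exists_beta_eq_or_eq_zero (n := n + 1) (antitone_beta_add p i) ?_ (isAlternating_psi σ)
            fun γ j hj => psi_eq_zero_of_lt j hj σ).resolve_left hex
      rw [sum_vec_add_single, sum_beta p hpk]
      push_cast; ring
    · intro q _
      rw [if_neg, zero_smul]
      exact fun h => hex ⟨q, (card_parts_le q).trans hk, h⟩

end Branching

/-! ### Averages over the imprimitive group with blocks of size two -/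

section Blocks

/-- The wreath product `S₂ ≀ Sym(ι)`. -/
abbrev BlockGroup (ι : Type*) : Type _ :=
  (ι → Perm (Fin 2)) ⋊[mulAutArrow (G := Perm ι) (A := ι) (M := Perm (Fin 2))] Perm ι

/-- The imprimitive action of `S₂ ≀ Sym(ι)` on blocks of size two indexed by `ι`. -/
def blockPerm (ι : Type*) : BlockGroup ι →* Perm (Fin 2 × ι) where
  toFun w :=
    { toFun := fun x => (w.left (w.right x.2) x.1, w.right x.2)
      invFun := fun x => ((w.left x.2)⁻¹ x.1, w.right⁻¹ x.2)
      left_inv := fun x => by simp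
      right_inv := fun x => by simp }
  map_one' := by ext x <;> simp
  map_mul' v w := by
    ext x
    · have h : ∀ y, (mulAutArrow (G := Perm ι) (A := ι) (M := Perm (Fin 2)) v.right
          w.left) (v.right y) = w.left y := fun y => by
        change w.left (v.right⁻¹ (v.right y)) = w.left y
        simp
      simp only [SemidirectProduct.mul_left, SemidirectProduct.mul_right, Perm.coe_mul,
        Function.comp_apply, Equiv.coe_fn_mk, Pi.mul_apply, h]
    · simp

theorem blockPerm_apply {ι : Type*} (w : BlockGroup ι) (x : Fin 2 × ι) :
    blockPerm ι w x = (w.left (w.right x.2) x.1, w.right x.2) := rfl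

variable {ι : Type*} [Fintype ι] [DecidableEq ι]

instance : Fintype (BlockGroup ι) := Fintype.ofEquiv _ SemidirectProduct.equivProd.symm

theorem card_blockGroup :
    Fintype.card (BlockGroup ι) = 2 ^ Fintype.card ι * (Fintype.card ι).factorial := by
  rw [Fintype.card_congr SemidirectProduct.equivProd, Fintype.card_prod, Fintype.card_fun,
    Fintype.card_perm, Fintype.card_perm, Fintype.card_fin]
  rfl

theorem card_blockGroup_option : (Fintype.card (BlockGroup (Option ι)) : ℂ) =
    2 * (Fintype.card ι + 1) * Fintype.card (BlockGroup ι) := by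
  rw [card_blockGroup, card_blockGroup, Fintype.card_option, Nat.factorial_succ, pow_succ]
  push_cast
  ring

theorem card_blockGroup_ne_zero : (Fintype.card (BlockGroup ι) : ℂ) ≠ 0 :=
  Nat.cast_ne_zero.2 Fintype.card_ne_zero

variable {k : ℕ}

/-- The average of an alternating sum over `S₂ ≀ Sym(ι)`. -/
def blockAvg (ι : Type*) [Fintype ι] [DecidableEq ι] {k : ℕ} (β : Fin k → ℤ) : ℂ :=
  (Fintype.card (BlockGroup ι) : ℂ)⁻¹ * ∑ w : BlockGroup ι, psi β (blockPerm ι w)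

/-- The average of an alternating sum over `S₂ ≀ Sym(ι)`, weighted by the number of fixed
blocks. -/
def markedAvg (ι : Type*) [Fintype ι] [DecidableEq ι] {k : ℕ} (β : Fin k → ℤ) : ℂ :=
  (Fintype.card (BlockGroup ι) : ℂ)⁻¹ * ∑ w : BlockGroup ι,
    ((Finset.univ.filter fun i => w.right i = i).card : ℂ) * psi β (blockPerm ι w)

/-- Relabelling the blocks. -/
def blockGroupCongr {κ : Type*} (e : ι ≃ κ) : BlockGroup ι ≃ BlockGroup κ where
  toFun w := ⟨fun j => w.left (e.symm j), e.permCongr w.right⟩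
  invFun w := ⟨fun i => w.left (e i), e.symm.permCongr w.right⟩
  left_inv w := by
    refine SemidirectProduct.ext (funext fun i => ?_) (Equiv.ext fun i => ?_) <;> simp
  right_inv w := by
    refine SemidirectProduct.ext (funext fun i => ?_) (Equiv.ext fun i => ?_) <;> simp

theorem psi_blockGroupCongr {κ : Type*} [Fintype κ] [DecidableEq κ] (e : ι ≃ κ) (β : Fin k → ℤ)
    (w : BlockGroup ι) :
    psi β (blockPerm κ (blockGroupCongr e w)) = psi β (blockPerm ι w) := by
  rw [← psi_permCongr β (Equiv.prodCongr (Equiv.refl (Fin 2)) e)]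
  congr 1
  ext x : 1
  simp [blockPerm_apply, blockGroupCongr]

theorem blockAvg_congr {κ : Type*} [Fintype κ] [DecidableEq κ] (e : ι ≃ κ) (β : Fin k → ℤ) :
    blockAvg ι β = blockAvg κ β := by
  rw [blockAvg, blockAvg, Fintype.card_congr (blockGroupCongr e),
    ← Equiv.sum_comp (blockGroupCongr e)]
  simp only [psi_blockGroupCongr]

theorem markedAvg_congr {κ : Type*} [Fintype κ] [DecidableEq κ] (e : ι ≃ κ) (β : Fin k → ℤ) :
    markedAvg ι β = markedAvg κ β := by
  rw [markedAvg, markedAvg, Fintype.card_congr (blockGroupCongr e),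
    ← Equiv.sum_comp (blockGroupCongr e)]
  congr 1
  refine Finset.sum_congr rfl fun w _ => ?_
  rw [psi_blockGroupCongr]
  congr 2
  refine Finset.card_bij (fun i _ => e i) ?_ ?_ ?_
  · intro i hi; simpa [blockGroupCongr] using hi
  · intro a _ b _ h; exact e.injective h
  · intro j hj
    refine ⟨e.symm j, ?_, by simp⟩
    have hj' : e (w.right (e.symm j)) = j := (Finset.mem_filter.1 hj).2
    refine Finset.mem_filter.2 ⟨Finset.mem_univ _, ?_⟩
    rw [Equiv.eq_symm_apply, hj']

theorem isAlternating_blockAvg : IsAlternating (blockAvg ι (k := k)) := by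
  intro β u
  rw [blockAvg, blockAvg, mul_left_comm]
  congr 1
  rw [Finset.mul_sum]
  exact Finset.sum_congr rfl fun w _ => isAlternating_psi (blockPerm ι w) β u

theorem blockAvg_eq_zero_of_lt {β : Fin k → ℤ} (i : Fin k) (h : β i < -((k : ℤ) - 1)) :
    blockAvg ι β = 0 := by
  rw [blockAvg, Finset.sum_eq_zero fun w _ => psi_eq_zero_of_lt i h _, mul_zero]

/-- The elements of `S₂ ≀ Sym(Option ι)` that fix the block `none`. -/
def extendBlock (s : Perm (Fin 2)) (w : BlockGroup ι) : BlockGroup (Option ι) :=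
  ⟨fun o => o.elim s w.left, Equiv.optionCongr w.right⟩

/-- The stabilizer of the block `none` is `S₂ × (S₂ ≀ Sym(ι))`. -/
theorem sum_filter_fix_none (F : BlockGroup (Option ι) → ℂ) :
    ∑ w : BlockGroup (Option ι) with w.right none = none, F w =
      ∑ s : Perm (Fin 2), ∑ w : BlockGroup ι, F (extendBlock s w) := by
  rw [← Finset.sum_product']
  symm
  refine Finset.sum_bij (fun sw _ => extendBlock sw.1 sw.2) ?_ ?_ ?_ ?_
  · intro sw _; simp [extendBlock]
  · rintro ⟨s, w⟩ _ ⟨s', w'⟩ _ h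
    have hl := congrArg SemidirectProduct.left h
    have hr := congrArg SemidirectProduct.right h
    have h1 : s = s' := congrFun hl none
    have h2 : w.left = w'.left := funext fun i => congrFun hl (some i)
    exact Prod.ext h1 (SemidirectProduct.ext h2 (Equiv.optionCongr_injective hr))
  · intro w hw
    simp only [Finset.mem_filter, Finset.mem_univ, true_and] at hw
    obtain ⟨h, hh⟩ := exists_optionCongr_eq w.right hw
    refine ⟨(w.left none, ⟨fun i => w.left (some i), h⟩), by simp, ?_⟩
    refine SemidirectProduct.ext (funext fun o => ?_) hh
    cases o <;> rfl
  · intro _ _; rfl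

/-- Splitting off the points of the block `none`. -/
def splitNone (ι : Type*) : Fin 2 × Option ι ≃ Fin 2 ⊕ Fin 2 × ι where
  toFun x := x.2.elim (.inl x.1) fun i => .inr (x.1, i)
  invFun := Sum.elim (fun a => (a, none)) fun x => (x.1, some x.2)
  left_inv := by rintro ⟨a, _ | i⟩ <;> rfl
  right_inv := by rintro (a | ⟨a, i⟩) <;> rfl

theorem psi_blockPerm_extendBlock (β : Fin k → ℤ) (s : Perm (Fin 2)) (w : BlockGroup ι) :
    psi β (blockPerm _ (extendBlock s w)) = psi β (Equiv.sumCongr s (blockPerm ι w)) := by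
  rw [← psi_permCongr β (splitNone ι)]
  congr 1
  ext x : 1
  rcases x with a | ⟨a, i⟩ <;> rfl

theorem sum_perm_fin_two (F : Perm (Fin 2) → ℂ) : ∑ s, F s = F 1 + F (Equiv.swap 0 1) := by
  have : (Finset.univ : Finset (Perm (Fin 2))) = {1, Equiv.swap 0 1} := by decide
  rw [this, Finset.sum_pair (by decide)]

theorem sum_fixed_blocks (β : Fin k → ℤ) (i : ι) (j : ι) :
    ∑ w : BlockGroup ι with w.right i = i, psi β (blockPerm ι w) =
      ∑ w : BlockGroup ι with w.right j = j, psi β (blockPerm ι w) := by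
  refine Finset.sum_equiv (blockGroupCongr (Equiv.swap i j)) ?_ fun w _ => ?_
  · intro w
    simp only [Finset.mem_filter, Finset.mem_univ, true_and, blockGroupCongr, Equiv.coe_fn_mk,
      Equiv.permCongr_apply, Equiv.symm_swap, Equiv.swap_apply_right]
    rw [← Equiv.apply_eq_iff_eq (Equiv.swap i j), Equiv.swap_apply_left]
  · rw [psi_blockGroupCongr]

/-- The number of fixed blocks is a sum of indicators with equal contributions, so the average
reduces to the stabilizer of one block. The identity and the swap in its factor `S₂` give the two
sums, and the group orders combine to the constant `1/2`. -/
theorem markedAvg_option (β : Fin k → ℤ) : markedAvg (Option ι) β =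
    2⁻¹ * (∑ i, ∑ j, blockAvg ι (β - Pi.single i 1 - Pi.single j 1) +
      ∑ i, blockAvg ι (β - Pi.single i 2)) := by
  have h1 : ∑ w : BlockGroup (Option ι),
      ((Finset.univ.filter fun i => w.right i = i).card : ℂ) * psi β (blockPerm _ w) =
      (Fintype.card ι + 1) *
        ∑ w : BlockGroup (Option ι) with w.right none = none, psi β (blockPerm _ w) := by
    trans ∑ w : BlockGroup (Option ι), ∑ i, if w.right i = i then psi β (blockPerm _ w) else 0
    · refine Finset.sum_congr rfl fun w _ => ?_
      rw [← Finset.sum_filter, Finset.sum_const, nsmul_eq_mul]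
    · rw [Finset.sum_comm]
      simp only [← Finset.sum_filter]
      rw [Finset.sum_congr rfl fun i _ => sum_fixed_blocks β i none, Finset.sum_const,
        Finset.card_univ, Fintype.card_option, nsmul_eq_mul]
      push_cast
      rfl
  rw [markedAvg, h1, sum_filter_fix_none, sum_perm_fin_two, card_blockGroup_option]
  simp only [psi_blockPerm_extendBlock, psi_sumCongr_one, psi_sumCongr_swap, blockAvg]
  simp only [← Finset.mul_sum]
  rw [Finset.sum_comm (s := (Finset.univ : Finset (BlockGroup ι))),
    Finset.sum_comm (s := (Finset.univ : Finset (BlockGroup ι)))]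
  have h2 : ∀ i : Fin k, ∑ w : BlockGroup ι, ∑ j, psi (β - Pi.single i 1 - Pi.single j 1)
      (blockPerm ι w) = ∑ j, ∑ w : BlockGroup ι, psi (β - Pi.single i 1 - Pi.single j 1)
      (blockPerm ι w) := fun i => Finset.sum_comm
  simp only [h2]
  have h3 := card_blockGroup_ne_zero (ι := ι)
  have h4 : (Fintype.card ι + 1 : ℂ) ≠ 0 := Nat.cast_add_one_ne_zero _
  field_simp

/-- Splitting off the two points of the block `none` one after the other. -/
def splitNone₂ (ι : Type*) : Fin 2 × Option ι ≃ Option (Option (Fin 2 × ι)) where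
  toFun x := x.2.elim (if x.1 = 0 then none else some none) fun i => some (some (x.1, i))
  invFun x := x.elim (0, none) fun y => y.elim (1, none) fun z => (z.1, some z.2)
  left_inv := by
    rintro ⟨a, _ | i⟩
    · fin_cases a <;> rfl
    · rfl
  right_inv := by rintro (_ | _ | ⟨a, i⟩) <;> rfl

theorem permCongr_splitNone₂_extendBlock {ι : Type*} (w : BlockGroup ι) :
    (splitNone₂ ι).permCongr (blockPerm _ (extendBlock 1 w)) =
      Equiv.optionCongr (Equiv.optionCongr (blockPerm ι w)) := by
  ext1 x
  rcases x with _ | _ | ⟨a, i⟩ <;> rfl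

theorem permCongr_splitNone₂_none {ι : Type*} (w : BlockGroup (Option ι)) :
    (splitNone₂ ι).permCongr (blockPerm _ w) none = none ↔
      w.right none = none ∧ w.left none 0 = 0 := by
  have : (splitNone₂ ι).permCongr (blockPerm _ w) none = none ↔
      blockPerm _ w (0, none) = (0, none) := by
    rw [Equiv.permCongr_apply, ← Equiv.eq_symm_apply]
    rfl
  rw [this, blockPerm_apply, Prod.mk.injEq]
  constructor
  · rintro ⟨h1, h2⟩
    simp only at h1 h2
    rw [h2] at h1
    exact ⟨h2, h1⟩
  · rintro ⟨h1, h2⟩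
    simp only [h1]
    exact ⟨h2, trivial⟩

/-- The branching rule for the averages. -/
theorem sum_blockAvg_add (hk : 2 * Fintype.card ι + 2 ≤ k)
    (p : (2 * Fintype.card ι + 1).Partition) :
    ∑ i, blockAvg (Option ι) (beta k p + Pi.single i 1) =
      ∑ i, blockAvg ι (beta k p - Pi.single i 1) := by
  have hY : Fintype.card (Option (Fin 2 × ι)) = 2 * Fintype.card ι + 1 := by simp
  let φ : BlockGroup (Option ι) →* Perm (Option (Option (Fin 2 × ι))) :=
    (splitNone₂ ι).permCongrHom.toMonoidHom.comp (blockPerm (Option ι))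
  have hφw : ∀ w, φ w = (splitNone₂ ι).permCongr (blockPerm _ w) := fun _ => rfl
  have hφ : ∀ y, ∃ w, φ w none = y := by
    intro y
    obtain ⟨⟨a, o⟩, rfl⟩ := (splitNone₂ ι).surjective y
    refine ⟨⟨fun _ => Equiv.swap 0 a, Equiv.swap none o⟩, ?_⟩
    rw [hφw, Equiv.permCongr_apply, Equiv.apply_eq_iff_eq]
    have : (splitNone₂ ι).symm none = (0, none) := rfl
    rw [this, blockPerm_apply]
    simp
  -- An element fixing the point `(0, none)` also fixes its partner `(1, none)`, so it is an element
  -- of `S₂ ≀ Sym(ι)` acting with one extra fixed point. That extra point accounts for the further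
  -- lowering of the vector.
  have hS : ∑ w, ∑ h : Perm (Option (Fin 2 × ι)),
      (if Equiv.optionCongr h = φ w then psi (beta k p) h else 0) =
      ∑ w : BlockGroup ι, ∑ i, psi (beta k p - Pi.single i 1) (blockPerm ι w) := by
    have h0 : ∀ w, ¬ (w.right none = none ∧ w.left none 0 = 0) →
        ∑ h : Perm (Option (Fin 2 × ι)),
          (if Equiv.optionCongr h = φ w then psi (beta k p) h else 0) = 0 := by
      intro w hw
      refine Finset.sum_eq_zero fun h _ => if_neg fun he => hw ?_
      rw [← permCongr_splitNone₂_none, ← hφw, ← he]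
      rfl
    rw [← Finset.sum_filter_of_ne (p := fun w => w.right none = none)
      (fun w _ hne => by_contra fun hc => hne (h0 w fun h => hc h.1)), sum_filter_fix_none,
      sum_perm_fin_two]
    rw [Finset.sum_eq_zero (f := fun w : BlockGroup ι => ∑ h : Perm (Option (Fin 2 × ι)),
      (if Equiv.optionCongr h = φ (extendBlock (Equiv.swap 0 1) w) then psi (beta k p) h else 0)),
      add_zero]
    · refine Finset.sum_congr rfl fun w _ => ?_
      rw [hφw, permCongr_splitNone₂_extendBlock, ← psi_optionCongr,
        Finset.sum_eq_single_of_mem (Equiv.optionCongr (blockPerm ι w)) (Finset.mem_univ _),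
        if_pos rfl]
      intro h _ hne
      exact if_neg fun he => hne (Equiv.optionCongr_injective he)
    · intro w _
      refine h0 _ fun h => ?_
      have : Equiv.swap (0 : Fin 2) 1 0 = 0 := h.2
      simp at this
  have hL : ∑ i, blockAvg (Option ι) (beta k p + Pi.single i 1) =
      (Fintype.card (BlockGroup (Option ι)) : ℂ)⁻¹ *
        ∑ w, indOption (psi (beta k p)) (φ w) := by
    simp only [blockAvg]
    rw [← Finset.mul_sum, Finset.sum_comm]
    congr 1
    refine Finset.sum_congr rfl fun w _ => ?_
    rw [indOption_psi hY hk p, Finset.sum_apply]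
    refine Finset.sum_congr rfl fun i _ => ?_
    rw [hφw, psi_permCongr]
  -- The index `2|ι| + 2` of the point stabilizer equals the ratio of the orders of the two block
  -- groups, and the constants cancel.
  rw [hL, sum_indOption φ hφ (psi_mem_classFunctions _), hS, Finset.sum_comm, hY,
    card_blockGroup_option]
  simp only [blockAvg]
  rw [← Finset.mul_sum]
  have h3 := card_blockGroup_ne_zero (ι := ι)
  have h4 : (Fintype.card ι + 1 : ℂ) ≠ 0 := Nat.cast_add_one_ne_zero _
  push_cast
  field_simp
  ring

end Blocks

/-! ### Removing and adding cells -/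

section Cells

variable {k N : ℕ}

/-- Take the last row of the same length. -/
theorem exists_removable {p : N.Partition} {i : ℕ} (hi : row p i ≠ 0) :
    ∃ j, i ≤ j ∧ row p j = row p i ∧ row p (j + 1) < row p j := by
  have hex : ∃ j, row p (i + j + 1) < row p i :=
    ⟨p.parts.card, by rw [row_eq_zero p (by omega)]; omega⟩
  obtain ⟨h1, h2⟩ : row p (i + Nat.find hex + 1) < row p i ∧
      row p (i + Nat.find hex) = row p i := by
    refine ⟨Nat.find_spec hex, ?_⟩
    rcases Nat.eq_zero_or_pos (Nat.find hex) with h | h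
    · rw [h]; rfl
    · have := Nat.find_min hex (m := Nat.find hex - 1) (by omega)
      rw [show i + (Nat.find hex - 1) + 1 = i + Nat.find hex by omega] at this
      exact le_antisymm (row_antitone p (by omega)) (not_lt.1 this)
  exact ⟨i + Nat.find hex, by omega, h2, by omega⟩

theorem lt_of_row_ne_zero {p : N.Partition} (hk : N ≤ k) {i : ℕ} (hi : row p i ≠ 0) : i < k := by
  by_contra hc
  exact hi (row_eq_zero p ((card_parts_le p).trans (hk.trans (not_lt.1 hc))))

/-- Removing the last cell of a row that is longer than the next one. -/
theorem exists_remove {p : (N + 1).Partition} (hk : N + 1 ≤ k) {i : Fin k}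
    (h : row p (i + 1) < row p i) :
    ∃ q : N.Partition, beta k p = beta k q + Pi.single i 1 := by
  have hp := (card_parts_le p).trans hk
  have hβ : StrictAnti (beta k p - Pi.single i 1) := by
    intro a b hab
    have h1 := beta_strictAnti p hab
    simp only [Pi.sub_apply, Pi.single_apply]
    by_cases ha : a = i
    · subst ha
      have hba : b ≠ a := hab.ne'
      simp only [hba, if_false, if_true, beta] at h1 ⊢
      have h2 : (a : ℕ) < b := hab
      have h3 := row_antitone p (show (a : ℕ) + 1 ≤ b by omega)
      omega
    · simp only [ha, if_false]
      split_ifs <;> omega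
  obtain ⟨q, -, hq⟩ := exists_beta_eq (n := N) hβ (by
    intro j
    have := j.2
    simp only [Pi.sub_apply, Pi.single_apply, beta]
    split_ifs with hj
    · subst hj; omega
    · omega) (by rw [sum_vec_sub_single, sum_beta p hp]; push_cast; ring)
  exact ⟨q, by rw [hq, sub_add_cancel]⟩

theorem row_of_beta_add {p : (N + 1).Partition} {q : N.Partition} (hk : N + 1 ≤ k) {i : Fin k}
    (h : beta k p = beta k q + Pi.single i 1) :
    row p i = row q i + 1 ∧ ∀ j : ℕ, j ≠ i → row p j = row q j := by
  constructor
  · have := congrFun h i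
    simp only [beta, Pi.add_apply, Pi.single_eq_same] at this
    omega
  · intro j hj
    by_cases hjk : j < k
    · have := congrFun h ⟨j, hjk⟩
      have hne : (⟨j, hjk⟩ : Fin k) ≠ i := fun he => hj (congrArg Fin.val he)
      simp only [beta, Pi.add_apply, Pi.single_apply, hne, if_false] at this
      omega
    · rw [row_eq_zero p ((card_parts_le p).trans (by omega)),
        row_eq_zero q ((card_parts_le q).trans (by omega))]

theorem exists_odd_row_ne {p : N.Partition} (hN : Even N) {i : ℕ} (hi : Odd (row p i)) :
    ∃ j, j ≠ i ∧ Odd (row p j) := by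
  by_contra hc
  push Not at hc
  have hik : i < N := lt_of_row_ne_zero le_rfl (by rintro h; rw [h] at hi; simp at hi)
  have hs := sum_row p (card_parts_le p)
  rw [← Finset.add_sum_erase _ _ (Finset.mem_range.2 hik)] at hs
  have he : Even (∑ j ∈ (Finset.range N).erase i, row p j) :=
    Finset.even_sum _ fun j hj => Nat.not_odd_iff_even.1 (hc j (Finset.ne_of_mem_erase hj))
  have := hi.add_even he
  rw [hs] at this
  exact (Nat.not_odd_iff_even.2 hN) this

end Cells

/-! ### Averages are indicators of even partitions -/

section Even

variable {k N : ℕ}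

open Classical in
/-- An alternating function of vectors that is supported on vectors with entries at least
`1 - k`, and counts even partitions among partitions of `N`. -/
structure CountsEven (k N : ℕ) (M : (Fin k → ℤ) → ℂ) : Prop where
  alternating : IsAlternating M
  eq_zero_of_lt : ∀ γ (i : Fin k), γ i < -((k : ℤ) - 1) → M γ = 0
  eq_ite : ∀ p : N.Partition, M (beta k p) = if ∀ i, Even (row p i) then 1 else 0

open Classical in
-- Removing a cell from row `i` leaves only even rows exactly when `i` is the unique odd row. In
-- that case the next row is even, hence shorter, so the cell is removable; vectors that come from
-- no partition therefore give zero on both sides.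
theorem CountsEven.sub_single {M : (Fin k → ℤ) → ℂ} (hM : CountsEven k N M) (hk : N + 1 ≤ k)
    (q : (N + 1).Partition) (i : Fin k) :
    M (beta k q - Pi.single i 1) = if ∀ j : ℕ, Odd (row q j) ↔ j = i then 1 else 0 := by
  have hq := (card_parts_le q).trans hk
  by_cases hex : ∃ p : N.Partition, p.parts.card ≤ k ∧ beta k p = beta k q - Pi.single i 1
  · obtain ⟨p, -, hp⟩ := hex
    have hp' : beta k q = beta k p + Pi.single i 1 := by rw [hp, sub_add_cancel]
    obtain ⟨h1, h2⟩ := row_of_beta_add hk hp'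
    rw [← hp, hM.eq_ite]
    refine if_congr ?_ rfl rfl
    refine forall_congr' fun j => ?_
    by_cases hj : j = i
    · subst hj
      rw [h1, iff_true_right rfl, Nat.odd_add_one, Nat.not_odd_iff_even]
    · rw [h2 j hj, iff_false_right hj, Nat.not_odd_iff_even]
  · rw [(exists_beta_eq_or_eq_zero (n := N) (antitone_beta_sub q i)
      (by rw [sum_vec_sub_single, sum_beta q hq]; push_cast; ring) hM.alternating
      hM.eq_zero_of_lt).resolve_left hex, if_neg]
    intro h
    apply hex
    have hi : Odd (row q i) := (h i).2 rfl
    have hi' : ¬ Odd (row q (i + 1)) := fun ho => by have := (h _).1 ho; omega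
    have hle := row_antitone q (Nat.le_succ i)
    have hne : row q (i + 1) ≠ row q i := fun he => hi' (he ▸ hi)
    obtain ⟨p, hp⟩ := exists_remove hk (i := i) (p := q) (lt_of_le_of_ne hle hne)
    exact ⟨p, (card_parts_le p).trans (by omega), by rw [hp, add_sub_cancel_right]⟩

variable {M M' : (Fin k → ℤ) → ℂ}

theorem CountsEven.sum_eq_zero (hM : CountsEven k N M') (hk : N + 1 ≤ k) (q : (N + 1).Partition)
    {a b : ℕ} (hab : a ≠ b) (ha : Odd (row q a)) (hb : Odd (row q b)) :
    ∑ i, M' (beta k q - Pi.single i 1) = 0 := by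
  refine Finset.sum_eq_zero fun i _ => ?_
  rw [hM.sub_single hk, if_neg]
  intro h
  exact hab (((h a).1 ha).trans ((h b).1 hb).symm)

theorem CountsEven.sum_eq_one (hM : CountsEven k N M') (hk : N + 1 ≤ k) (q : (N + 1).Partition)
    {a : ℕ} (ha : Odd (row q a)) (hb : ∀ b ≠ a, Even (row q b)) :
    ∑ i, M' (beta k q - Pi.single i 1) = 1 := by
  have hak : a < k := lt_of_row_ne_zero hk (by rintro h; rw [h] at ha; simp at ha)
  rw [Finset.sum_eq_single_of_mem ⟨a, hak⟩ (Finset.mem_univ _), hM.sub_single hk, if_pos]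
  · intro j
    constructor
    · intro hj
      by_contra hne
      exact (Nat.not_odd_iff_even.2 (hb j hne)) hj
    · rintro rfl; exact ha
  · intro i _ hi
    rw [hM.sub_single hk, if_neg]
    intro h
    exact hi (Fin.ext ((h a).1 ha).symm)

/-- The hypotheses under which the even partitions of `N + 2` are counted by branching. -/
structure Branches (k N : ℕ) (M M' : (Fin k → ℤ) → ℂ) : Prop where
  alternating : IsAlternating M
  eq_zero_of_lt : ∀ γ (i : Fin k), γ i < -((k : ℤ) - 1) → M γ = 0
  exists_nat : ∀ p : (N + 2).Partition, ∃ c : ℕ, M (beta k p) = c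
  sum_add : ∀ q : (N + 1).Partition,
    ∑ i, M (beta k q + Pi.single i 1) = ∑ i, M' (beta k q - Pi.single i 1)
  one_row : ∀ p : (N + 2).Partition, row p 1 = 0 → M (beta k p) = 1

theorem Branches.exists_partition_or (hB : Branches k N M M') (hk : N + 2 ≤ k)
    (q : (N + 1).Partition) (i : Fin k) :
    (∃ p : (N + 2).Partition, beta k p = beta k q + Pi.single i 1) ∨
      M (beta k q + Pi.single i 1) = 0 := by
  rcases exists_beta_eq_or_eq_zero (n := N + 2) (antitone_beta_add q i)
    (by rw [sum_vec_add_single, sum_beta q ((card_parts_le q).trans (by omega))]; push_cast; ring)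
      hB.alternating hB.eq_zero_of_lt with ⟨p, -, hp⟩ | h
  · exact Or.inl ⟨p, hp⟩
  · exact Or.inr h

/-- No removal from `q` yields an even partition, so the branching sum is zero; its terms are
natural numbers, so each of them vanishes. -/
theorem Branches.eq_zero_of_two_odd (hB : Branches k N M M') (hM : CountsEven k N M')
    (hk : N + 2 ≤ k) {p : (N + 2).Partition} {j : Fin k} {q : (N + 1).Partition}
    (hq : beta k p = beta k q + Pi.single j 1) {a b : ℕ} (hab : a ≠ b)
    (ha : Odd (row q a)) (hb : Odd (row q b)) : M (beta k p) = 0 := by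
  have hc : ∀ i, ∃ c : ℕ, M (beta k q + Pi.single i 1) = c := by
    intro i
    rcases hB.exists_partition_or hk q i with ⟨r, hr⟩ | h
    · rw [← hr]; exact hB.exists_nat r
    · exact ⟨0, by simpa using h⟩
  choose c hc using hc
  have hs := hB.sum_add q
  rw [hM.sum_eq_zero (by omega) q hab ha hb] at hs
  simp only [hc] at hs
  have hs' : ∑ i, c i = 0 := by exact_mod_cast hs
  have := Finset.sum_eq_zero_iff.1 hs' j (Finset.mem_univ _)
  rw [hq, hc, this, Nat.cast_zero]

/-- Removing a cell from the even row `j` makes it odd, next to the odd row `a`. -/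
theorem Branches.eq_zero_of_even_removable (hB : Branches k N M M') (hM : CountsEven k N M')
    (hk : N + 2 ≤ k) {p : (N + 2).Partition} {j a : ℕ} (hj : row p (j + 1) < row p j)
    (hje : Even (row p j)) (ha : Odd (row p a)) : M (beta k p) = 0 := by
  have hjk : j < k := lt_of_row_ne_zero hk (by omega : row p j ≠ 0)
  obtain ⟨q, hq⟩ := exists_remove hk (i := ⟨j, hjk⟩) (p := p) hj
  obtain ⟨h1, h2⟩ := row_of_beta_add hk hq
  have haj : a ≠ j := by rintro rfl; exact (Nat.not_odd_iff_even.2 hje) ha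
  refine hB.eq_zero_of_two_odd hM hk hq haj ?_ ?_
  · rw [← h2 a haj]; exact ha
  · simp only at h1
    rw [h1] at hje
    exact Nat.not_even_iff_odd.1 fun h => by
      rw [Nat.even_add_one] at hje; exact hje h

/-- Two odd rows may leave no even row to shorten, so nonnegativity alone does not settle this case.
Branching at `q = (N + 1 - b, b)` shows that the values at second rows `b` and `b + 1` sum to 1, so
they alternate, starting from the one-row value. -/
theorem Branches.two_rows (hB : Branches k N M M') (hM : CountsEven k N M') (hN : Even N)
    (hk : N + 2 ≤ k) (b : ℕ) (p : (N + 2).Partition) (hp1 : row p 1 = b) (hp2 : row p 2 = 0) :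
    M (beta k p) = if Even b then 1 else 0 := by
  induction b generalizing p with
  | zero => simpa using hB.one_row p hp1
  | succ b ih =>
    have h0k : 0 < k := by omega
    have h1k : 1 < k := by omega
    obtain ⟨q, hq⟩ := exists_remove hk (i := ⟨1, h1k⟩) (p := p)
      (by simp only [hp2, hp1]; omega)
    obtain ⟨hr1, hr⟩ := row_of_beta_add hk hq
    simp only at hr1 hr
    have hq1 : row q 1 = b := by omega
    have hq0 : row q 0 = row p 0 := (hr 0 (by omega)).symm
    have hq2 : row q 2 = 0 := by rw [← hr 2 (by omega), hp2]
    have hqz : ∀ j, 2 ≤ j → row q j = 0 := fun j hj =>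
      Nat.le_zero.1 (hq2 ▸ row_antitone q hj)
    have hsum : row q 0 + b = N + 1 := by
      have h := sum_row q ((card_parts_le q).trans (show N + 1 ≤ N + 2 by omega))
      rw [Finset.sum_range_succ', Finset.sum_range_succ', Finset.sum_eq_zero
        (fun j _ => hqz _ (by omega))] at h
      simp only [zero_add] at h
      omega
    have hle : b + 1 ≤ row q 0 := by
      rw [hq0, ← hp1]; exact row_antitone p (by omega)
    have hone : ∑ i, M (beta k q + Pi.single i 1) = 1 := by
      rw [hB.sum_add]
      have hodd : Odd (row q 0 + b) := by rw [hsum]; exact hN.add_one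
      rcases Nat.even_or_odd b with hb | hb
      · refine hM.sum_eq_one (by omega) q (a := 0) ((Nat.odd_add.1 hodd).2 hb) ?_
        intro j hj
        rcases Nat.lt_or_ge j 2 with h | h
        · obtain rfl : j = 1 := by omega
          rw [hq1]; exact hb
        · rw [hqz j h]; exact Even.zero
      · refine hM.sum_eq_one (by omega) q (a := 1) (hq1 ▸ hb) ?_
        intro j hj
        rcases Nat.lt_or_ge j 2 with h | h
        · obtain rfl : j = 0 := by omega
          by_contra hc
          have := (Nat.odd_add.1 hodd).1 (Nat.not_even_iff_odd.1 hc)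
          exact (Nat.not_odd_iff_even.2 this) hb
        · rw [hqz j h]; exact Even.zero
    -- The only other partition above `q` has a third row of length 1. As `row q 0 + b` is odd, one
    -- of the first two rows is even, and it is longer than the next, so `eq_zero_of_even_removable`
    -- applies.
    have hother : ∀ i : Fin k, i ≠ ⟨0, h0k⟩ ∧ i ≠ ⟨1, h1k⟩ →
        M (beta k q + Pi.single i 1) = 0 := by
      rintro i ⟨hi0, hi1⟩
      have hi2 : 2 ≤ (i : ℕ) := by
        have h0 : (i : ℕ) ≠ 0 := fun h => hi0 (Fin.ext h)
        have h1 : (i : ℕ) ≠ 1 := fun h => hi1 (Fin.ext h)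
        omega
      rcases hB.exists_partition_or hk q i with ⟨r, hr'⟩ | h
      · rw [← hr']
        obtain ⟨hs1, hs2⟩ := row_of_beta_add hk hr'
        rw [hqz i hi2] at hs1
        have hi2' : (i : ℕ) = 2 := by
          by_contra hne
          have h3 := row_antitone r (show (i : ℕ) - 1 ≤ i by omega)
          rw [hs2 (i - 1) (by omega), hqz (i - 1) (by omega)] at h3
          omega
        rw [hi2'] at hs1
        have hr0 : row r 0 = row q 0 := hs2 0 (by omega)
        have hr1 : row r 1 = b := by rw [hs2 1 (by omega), hq1]
        have hb1 : 1 ≤ b := by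
          rw [← hr1]
          have := row_antitone r (show 1 ≤ 2 by omega)
          omega
        have hodd2 : Odd (row r 2) := by rw [hs1]; exact odd_one
        rcases Nat.even_or_odd b with hb | hb
        · refine hB.eq_zero_of_even_removable hM hk (j := 1) ?_ (hr1 ▸ hb) hodd2
          change row r 2 < row r 1
          rw [hs1, hr1]
          rcases hb with ⟨c, hc⟩
          omega
        · refine hB.eq_zero_of_even_removable hM hk (j := 0) ?_ ?_ hodd2
          · change row r 1 < row r 0
            omega
          · rw [hr0]
            by_contra hc
            have hodd : Odd (row q 0 + b) := by rw [hsum]; exact hN.add_one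
            have := (Nat.odd_add.1 hodd).1 (Nat.not_even_iff_odd.1 hc)
            exact (Nat.not_odd_iff_even.2 this) hb
      · exact h
    rw [Finset.sum_eq_add_of_mem (⟨0, h0k⟩ : Fin k) ⟨1, h1k⟩ (Finset.mem_univ _)
      (Finset.mem_univ _) (fun h => by simpa using congrArg Fin.val h) (fun i _ hi => hother i hi), ← hq] at hone
    have hfirst : M (beta k q + Pi.single (⟨0, h0k⟩ : Fin k) 1) =
        if Even b then 1 else 0 := by
      obtain ⟨r, hrr, -⟩ := exists_partition_row (n := N + 2) (k := 2)
        (fun j => if j = 0 then row q 0 + 1 else row q j)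
        (by
          refine antitone_nat_of_succ_le fun j => ?_
          have := row_antitone q (Nat.le_succ j)
          rcases Nat.eq_zero_or_pos j with rfl | hj
          · simp only [Nat.add_eq_zero_iff, one_ne_zero, and_false, if_false, if_true]
            exact this.trans (Nat.le_succ _)
          · simp [hj.ne', this])
        (by simp [hq2])
        (by
          rw [Finset.sum_range_succ, Finset.sum_range_one]
          simp only [if_true, one_ne_zero, if_false, hq1]
          omega)
      have hr' : beta k r = beta k q + Pi.single (⟨0, h0k⟩ : Fin k) 1 := by
        funext j
        simp only [beta, hrr, Pi.add_apply, Pi.single_apply, Fin.ext_iff]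
        split_ifs with hj
        · rw [hj]; push_cast; ring
        · ring
      rw [← hr']
      refine ih r ?_ ?_
      · rw [hrr]; simp [hq1]
      · rw [hrr]; simp [hq2]
    rw [hfirst] at hone
    simp only [Nat.even_add_one]
    by_cases hb : Even b
    · simp only [hb, if_true, not_true, if_false] at hone ⊢
      linear_combination hone
    · simp only [hb, if_false, not_false_iff, if_true] at hone ⊢
      linear_combination hone

/-- Unless some even row can be shortened, every nonzero row is odd, having the length of a
removable one. With at least three rows, shortening a row below the first two leaves those two odd.
Otherwise parity of the total gives exactly two odd rows, which is `two_rows`. -/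
theorem Branches.eq_zero_of_odd (hB : Branches k N M M') (hM : CountsEven k N M') (hN : Even N)
    (hk : N + 2 ≤ k) (p : (N + 2).Partition) {a : ℕ} (ha : Odd (row p a)) :
    M (beta k p) = 0 := by
  by_cases hev : ∃ j, row p (j + 1) < row p j ∧ Even (row p j)
  · obtain ⟨j, hj, hje⟩ := hev
    exact hB.eq_zero_of_even_removable hM hk hj hje ha
  push Not at hev
  have hodd : ∀ i, row p i ≠ 0 → Odd (row p i) := by
    intro i hi
    obtain ⟨j, -, h1, h2⟩ := exists_removable hi
    rw [← h1]
    exact Nat.not_even_iff_odd.1 (hev j h2)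
  by_cases h2 : row p 2 = 0
  · have hz : ∀ j, 2 ≤ j → row p j = 0 := fun j hj => Nat.le_zero.1 (h2 ▸ row_antitone p hj)
    have hlt : ∀ j, Odd (row p j) → j < 2 := by
      intro j hj
      by_contra hc
      rw [hz j (not_lt.1 hc)] at hj
      simp at hj
    have hN2 : Even (N + 2) := hN.add even_two
    obtain ⟨b, hba, hb⟩ := exists_odd_row_ne hN2 ha
    have h1 : Odd (row p 1) := by
      have := hlt a ha
      have := hlt b hb
      rcases (show a = 1 ∨ b = 1 by omega) with rfl | rfl
      · exact ha
      · exact hb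
    rw [hB.two_rows hM hN hk _ p rfl h2, if_neg (Nat.not_even_iff_odd.2 h1)]
  · have h1 : row p 1 ≠ 0 := fun h => h2 (Nat.le_zero.1 (h ▸ row_antitone p (by omega : 1 ≤ 2)))
    have h0 : row p 0 ≠ 0 := fun h => h2 (Nat.le_zero.1 (h ▸ row_antitone p (by omega : 0 ≤ 2)))
    obtain ⟨j, hj2, hj, hj'⟩ := exists_removable h2
    have hjk : j < k := lt_of_row_ne_zero hk (by omega : row p j ≠ 0)
    obtain ⟨q, hq⟩ := exists_remove hk (i := ⟨j, hjk⟩) (p := p) hj'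
    obtain ⟨-, hr⟩ := row_of_beta_add hk hq
    simp only at hr
    refine hB.eq_zero_of_two_odd hM hk hq zero_ne_one ?_ ?_
    · rw [← hr 0 (by omega)]; exact hodd 0 h0
    · rw [← hr 1 (by omega)]; exact hodd 1 h1

/-- Even partitions of `N + 2` are counted if even partitions of `N` are. -/
theorem Branches.countsEven (hB : Branches k N M M') (hM : CountsEven k N M') (hN : Even N)
    (hk : N + 2 ≤ k) : CountsEven k (N + 2) M where
  alternating := hB.alternating
  eq_zero_of_lt := hB.eq_zero_of_lt
  eq_ite p := by
    split_ifs with he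
    · have h0 : row p 0 ≠ 0 := by
        intro h
        have hs := sum_row p (card_parts_le p)
        rw [Finset.sum_eq_zero fun j _ => Nat.le_zero.1 (h ▸ row_antitone p (Nat.zero_le j))] at hs
        omega
      obtain ⟨j, -, -, hj'⟩ := exists_removable h0
      have hjk : j < k := lt_of_row_ne_zero hk (by omega : row p j ≠ 0)
      obtain ⟨q, hq⟩ := exists_remove hk (i := ⟨j, hjk⟩) (p := p) hj'
      obtain ⟨hr1, hr⟩ := row_of_beta_add hk hq
      simp only at hr1 hr
      have hqj : Odd (row q j) := by
        have := he j
        rw [hr1, Nat.even_add_one] at this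
        exact Nat.not_even_iff_odd.1 this
      -- `q` has the single odd row `j`, so the branching sum is 1. Adding the cell in any other row
      -- keeps row `j` odd, and such terms vanish.
      have hs := hB.sum_add q
      rw [hM.sum_eq_one (by omega) q hqj (fun b hb => by rw [← hr b hb]; exact he b),
        Finset.sum_eq_single_of_mem ⟨j, hjk⟩ (Finset.mem_univ _), ← hq] at hs
      · exact hs
      · intro i _ hi
        rcases hB.exists_partition_or hk q i with ⟨r, hr'⟩ | h
        · rw [← hr']
          obtain ⟨-, hs2⟩ := row_of_beta_add hk hr'
          refine hB.eq_zero_of_odd hM hN hk r (a := j) ?_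
          rw [hs2 j (fun h => hi (Fin.ext h.symm))]
          exact hqj
        · exact h
    · push Not at he
      obtain ⟨a, ha⟩ := he
      exact hB.eq_zero_of_odd hM hN hk p (Nat.not_even_iff_odd.1 ha)

end Even

/-! ### The permutation character on the blocks -/

section Thrall

variable {k N : ℕ}

theorem card_parts_le_of_row_eq_zero {p : N.Partition} (h : row p k = 0) : p.parts.card ≤ k := by
  have hz : ∀ j, k ≤ j → row p j = 0 := fun j hj => Nat.le_zero.1 (h ▸ row_antitone p hj)
  have hs := sum_row p ((card_parts_le p).trans (Nat.le_add_left N k))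
  rw [Finset.sum_range_add, Finset.sum_eq_zero (s := Finset.range N)
    (fun j _ => hz _ (Nat.le_add_right k j)), add_zero] at hs
  obtain ⟨q, hq, hqk⟩ := exists_partition_row _ (row_antitone p) h hs
  rwa [row_injective hq] at hqk

/-- The determinantal formula with a `1 × 1` determinant and a single function to `Fin 1`. -/
theorem chi_eq_one {p : N.Partition} (h : row p 1 = 0) (σ : Perm (Fin N)) : chi p σ = 1 := by
  have hp := card_parts_le_of_row_eq_zero h
  have h0 : row p 0 = N := by simpa using sum_row p hp
  rw [chi_eq_psi p hp, psi, Finset.sum_eq_single_of_mem (fun _ => 0) (by simp)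
    (fun f _ hf => (hf (Subsingleton.elim _ _)).elim)]
  simp [altDet, Matrix.det_unique, beta, content, h0]

theorem psi_blockPerm {m : ℕ} (p : (2 * m).Partition) (hp : p.parts.card ≤ k) (w : Wreath 2 m) :
    psi (beta k p) (blockPerm (Fin m) w) = chi p (Wreath.embedding 2 m w) :=
  (chi_permCongr p hp finProdFinEquiv _).symm

/-- The average of a character over a group is the dimension of the space of invariants. -/
theorem exists_nat_blockAvg {m : ℕ} (hk : 2 * m ≤ k) (p : (2 * m).Partition) :
    ∃ c : ℕ, blockAvg (Fin m) (beta k p) = c := by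
  have : Invertible (Nat.card (BlockGroup (Fin m)) : ℂ) :=
    invertibleOfNonzero (Nat.cast_ne_zero.2 Nat.card_pos.ne')
  refine ⟨_, Eq.trans ?_ (Representation.card_inv_mul_sum_char_eq_finrank
    ((specht p).toRepresentation.comp (Wreath.embedding 2 m)))⟩
  rw [blockAvg, Nat.card_eq_fintype_card]
  congr 1
  exact Finset.sum_congr rfl fun w _ => psi_blockPerm p ((card_parts_le p).trans hk) w

theorem blockAvg_eq_one {m : ℕ} (hk : 2 * m ≤ k) (p : (2 * m).Partition) (h : row p 1 = 0) :
    blockAvg (Fin m) (beta k p) = 1 := by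
  rw [blockAvg, Finset.sum_congr rfl fun w _ =>
    (psi_blockPerm p ((card_parts_le p).trans hk) w).trans (chi_eq_one h _)]
  simp

theorem branches_blockAvg {m : ℕ} (hk : 2 * m + 2 ≤ k) :
    Branches k (2 * m) (blockAvg (Fin (m + 1))) (blockAvg (Fin m)) where
  alternating := isAlternating_blockAvg
  eq_zero_of_lt _ i h := blockAvg_eq_zero_of_lt i h
  exists_nat p := exists_nat_blockAvg (m := m + 1) hk p
  sum_add q := by
    -- The cardinality is replaced by a variable because it occurs in the type of `q`.
    have h : ∀ c, Fintype.card (Fin m) = c → 2 * c + 2 ≤ k → ∀ q : (2 * c + 1).Partition,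
        ∑ i, blockAvg (Option (Fin m)) (beta k q + Pi.single i 1) =
          ∑ i, blockAvg (Fin m) (beta k q - Pi.single i 1) := by
      rintro _ rfl h q
      exact sum_blockAvg_add h q
    simp only [blockAvg_congr (finSuccEquiv m)]
    exact h m (Fintype.card_fin m) hk q
  one_row p h := blockAvg_eq_one (m := m + 1) hk p h

/-- The average of an irreducible character of `S_{2m}` over `S₂ ≀ S_m` is `1` on partitions
with even parts, and `0` otherwise. -/
theorem countsEven_blockAvg (m : ℕ) (hk : 2 * m ≤ k) :
    CountsEven k (2 * m) (blockAvg (Fin m)) := by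
  induction m with
  | zero =>
    have hz : ∀ (p : (2 * 0).Partition) (i : ℕ), row p i = 0 := fun p i =>
      row_eq_zero p ((card_parts_le p).trans (Nat.zero_le _))
    refine ⟨isAlternating_blockAvg, fun _ i h => blockAvg_eq_zero_of_lt i h, fun p => ?_⟩
    rw [blockAvg_eq_one hk p (hz p 1), if_pos]
    intro i
    simp [hz p i]
  | succ m ih =>
    exact (branches_blockAvg hk).countsEven (ih (by omega)) (even_two_mul m) hk

end Thrall

/-! ### Removing two cells -/

section Pairs

variable {k N : ℕ} {M : (Fin k → ℤ) → ℂ}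

theorem row_sub_of_beta {N' : ℕ} {p : N'.Partition} {q : N.Partition} {v : Fin k → ℤ}
    (h : beta k q = beta k p - v) (i : Fin k) : (row q i : ℤ) = row p i - v i := by
  have := congrFun h i
  simp only [beta, Pi.sub_apply] at this
  linarith

/-- `p` has odd rows exactly at `i` and `j`. -/
def OddRowsAt (p : N.Partition) (i j : ℕ) : Prop := ∀ l, Odd (row p l) ↔ l = i ∨ l = j

theorem OddRowsAt.symm {p : N.Partition} {i j : ℕ} (h : OddRowsAt p i j) : OddRowsAt p j i :=
  fun l => (h l).trans or_comm

theorem OddRowsAt.eq_or {p : N.Partition} {a b i j : ℕ} (h : OddRowsAt p a b)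
    (h' : OddRowsAt p i j) (hij : i ≠ j) : i = a ∧ j = b ∨ i = b ∧ j = a := by
  have h1 := (h i).1 ((h' i).2 (Or.inl rfl))
  have h2 := (h j).1 ((h' j).2 (Or.inr rfl))
  omega

theorem antitone_beta_sub_pair (p : N.Partition) {i j : Fin k} (hij : i ≠ j) :
    Antitone (beta k p - Pi.single i 1 - Pi.single j 1) := by
  intro a b hab
  rcases hab.eq_or_lt with rfl | hlt
  · exact le_rfl
  · have := beta_strictAnti p hlt
    simp only [Pi.sub_apply, Pi.single_apply]
    split_ifs <;> omega

open Classical in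
-- If exactly rows `i` and `j` are odd, an odd row above an even one is strictly longer, so lowering
-- both rows still gives a partition, now with even rows. In the other cases the vector is that of a
-- partition with an odd row, or gives zero.
theorem CountsEven.sub_pair (hM : CountsEven k N M) (hk : N + 2 ≤ k) (p : (N + 2).Partition)
    {i j : Fin k} (hij : i ≠ j) :
    M (beta k p - Pi.single i 1 - Pi.single j 1) = if OddRowsAt p i j then 1 else 0 := by
  have hp := (card_parts_le p).trans hk
  have hs : ∑ l : Fin k, ((beta k p - Pi.single i 1 - Pi.single j 1 : Fin k → ℤ) l + l) = N := by
    rw [sum_vec_sub_single, sum_vec_sub_single, sum_beta p hp]; push_cast; ring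
  have key : ∀ q : N.Partition, beta k q = beta k p - Pi.single i 1 - Pi.single j 1 →
      ((∀ l, Even (row q l)) ↔ OddRowsAt p i j) := by
    intro q hq
    refine forall_congr' fun l => ?_
    by_cases hl : l < k
    · have := row_sub_of_beta (hq.trans (sub_sub _ _ _)) ⟨l, hl⟩
      simp only [Pi.add_apply, Pi.single_apply, Fin.ext_iff] at this
      have hij' : (i : ℕ) ≠ j := fun h => hij (Fin.ext h)
      rw [Nat.even_iff, Nat.odd_iff]
      split_ifs at this <;> omega
    · have h1 := row_eq_zero q ((card_parts_le q).trans (show N ≤ l by omega))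
      have h2 := row_eq_zero p (hp.trans (not_lt.1 hl))
      have := i.2
      have := j.2
      rw [h1, h2]
      simp
      omega
  split_ifs with h
  · obtain ⟨q, -, hq⟩ := exists_beta_eq (n := N)
      (β := beta k p - Pi.single i 1 - Pi.single j 1) (by
        intro a b hab
        have h1 := beta_strictAnti p hab
        have h2 := row_antitone p (show (a : ℕ) ≤ b from hab.le)
        have hab' : (a : ℕ) < b := hab
        have ha := h a
        have hb := h b
        rw [Nat.odd_iff] at ha hb
        simp only [Pi.sub_apply, Pi.single_apply, beta, Fin.ext_iff] at h1 ⊢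
        split_ifs <;> omega) (by
        intro l
        have := l.2
        have hl := h l
        rw [Nat.odd_iff] at hl
        simp only [Pi.sub_apply, Pi.single_apply, beta, Fin.ext_iff]
        have hij' : (i : ℕ) ≠ j := fun h => hij (Fin.ext h)
        split_ifs <;> omega) hs
    rw [← hq, hM.eq_ite, if_pos ((key q hq).2 h)]
  · rcases exists_beta_eq_or_eq_zero (antitone_beta_sub_pair p hij) hs hM.alternating
      hM.eq_zero_of_lt with ⟨q, -, hq⟩ | h0
    · rw [← hq, hM.eq_ite, if_neg fun he => h ((key q hq).1 he)]
    · exact h0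

open Classical in
-- For equal consecutive rows, swapping entries `i` and `i + 1` turns the vector lowered by 2 at `i`
-- into the one lowered by 1 at both places: a vertical domino, with sign `-1`.
theorem CountsEven.sub_two_of_eq (hM : CountsEven k N M) (hk : N + 2 ≤ k)
    (p : (N + 2).Partition) {i : Fin k} (hi : row p (i + 1) = row p i) :
    M (beta k p - Pi.single i 2) = -if OddRowsAt p i (i + 1) then 1 else 0 := by
  by_cases hik : (i : ℕ) + 1 < k
  · have hne : i ≠ ⟨i + 1, hik⟩ := fun h => by simpa using congrArg Fin.val h
    rw [← hM.sub_pair hk p hne, ← hM.alternating.swap _ hne]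
    congr 1
    funext l
    simp only [Function.comp_apply, Pi.sub_apply]
    rcases eq_or_ne l i with rfl | h1
    · rw [Equiv.swap_apply_left]
      simp [beta, hi, hne.symm]
      ring
    · rcases eq_or_ne l ⟨i + 1, hik⟩ with rfl | h2
      · rw [Equiv.swap_apply_right]
        simp [beta, hi, hne, hne.symm]
        ring
      · rw [Equiv.swap_apply_of_ne_of_ne h1 h2]
        simp [h1, h2]
  · have hz : row p i = 0 := by
      rw [← hi]; exact row_eq_zero p ((card_parts_le p).trans (by omega))
    rw [hM.eq_zero_of_lt _ i (by simp [beta, hz]; omega), if_neg, neg_zero]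
    intro h
    have := (h i).2 (Or.inl rfl)
    simp [hz] at this

open Classical in
-- A horizontal domino: if it fits, removing it preserves the parity of every row.
theorem CountsEven.sub_two_of_lt (hM : CountsEven k N M) (hk : N + 2 ≤ k)
    (p : (N + 2).Partition) {i : Fin k} (hi : row p (i + 1) < row p i) :
    M (beta k p - Pi.single i 2) = if ∀ l, Even (row p l) then 1 else 0 := by
  have hp := (card_parts_le p).trans hk
  by_cases h2 : row p (i + 1) + 2 ≤ row p i
  · obtain ⟨q, -, hq⟩ := exists_beta_eq (n := N) (β := beta k p - Pi.single i 2) (by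
        intro a b hab
        have h1 := beta_strictAnti p hab
        have hab' : (a : ℕ) < b := hab
        simp only [Pi.sub_apply, Pi.single_apply, beta, Fin.ext_iff] at h1 ⊢
        by_cases ha : (a : ℕ) = i
        · have h3 := row_antitone p (show (a : ℕ) + 1 ≤ b from hab)
          rw [ha] at h3 h1 hab' ⊢
          rw [if_neg (by omega), if_pos rfl]
          omega
        · rw [if_neg ha]
          split_ifs <;> omega) (by
        intro l
        have := l.2
        simp only [Pi.sub_apply, Pi.single_apply, beta]
        split_ifs with hl
        · subst hl; omega
        · omega) (by rw [sum_vec_sub_single, sum_beta p hp]; push_cast; ring)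
    rw [← hq, hM.eq_ite]
    refine if_congr (forall_congr' fun l => ?_) rfl rfl
    by_cases hl : l < k
    · have := row_sub_of_beta hq ⟨l, hl⟩
      simp only [Pi.single_apply, Fin.ext_iff] at this
      rw [Nat.even_iff, Nat.even_iff]
      split_ifs at this <;> omega
    · rw [row_eq_zero q ((card_parts_le q).trans (show N ≤ l by omega)),
        row_eq_zero p (hp.trans (not_lt.1 hl))]
  -- The rows differ by exactly one, so they are not both even. Correspondingly the lowered vector
  -- repeats the entry at `i + 1`, or falls below `1 - k` if `i` is the last index.
  · rw [if_neg (fun h => by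
      have h3 := h i
      have h4 := h (i + 1)
      rw [Nat.even_iff] at h3 h4
      omega)]
    by_cases hik : (i : ℕ) + 1 < k
    · have hne : i ≠ ⟨i + 1, hik⟩ := fun h => by simpa using congrArg Fin.val h
      refine hM.alternating.eq_zero hne ?_
      simp [beta, hne.symm]
      omega
    · have hz : row p (i + 1) = 0 := row_eq_zero p (hp.trans (not_lt.1 hik))
      exact hM.eq_zero_of_lt _ i (by simp [beta]; omega)

theorem sum_pairs (M : (Fin k → ℤ) → ℂ) (p : N.Partition) :
    ∑ i, ∑ j, M (beta k p - Pi.single i 1 - Pi.single j 1) + ∑ i, M (beta k p - Pi.single i 2) =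
      ∑ i, ∑ j ∈ Finset.univ.erase i, M (beta k p - Pi.single i 1 - Pi.single j 1) +
        2 * ∑ i, M (beta k p - Pi.single i 2) := by
  have h : ∀ i : Fin k, beta k p - Pi.single i 1 - Pi.single i 1 = beta k p - Pi.single i 2 := by
    intro i
    rw [sub_sub, ← Pi.single_add]
    rfl
  have h' : ∀ i, ∑ j, M (beta k p - Pi.single i 1 - Pi.single j 1) =
      M (beta k p - Pi.single i 2) +
        ∑ j ∈ Finset.univ.erase i, M (beta k p - Pi.single i 1 - Pi.single j 1) := by
    intro i
    rw [← Finset.add_sum_erase _ _ (Finset.mem_univ i), h]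
  simp only [h', Finset.sum_add_distrib]
  ring

open Classical in
-- The value 2 counts the two orders of the pair of odd rows.
theorem CountsEven.sum_off_diagonal (hM : CountsEven k N M) (hk : N + 2 ≤ k)
    (p : (N + 2).Partition) :
    ∑ i, ∑ j ∈ Finset.univ.erase i, M (beta k p - Pi.single i 1 - Pi.single j 1) =
      if ∃ a b, a ≠ b ∧ OddRowsAt p a b then 2 else 0 := by
  have h1 : ∀ i : Fin k, ∑ j ∈ Finset.univ.erase i, M (beta k p - Pi.single i 1 - Pi.single j 1) =
      ∑ j ∈ Finset.univ.erase i, if OddRowsAt p i j then 1 else 0 := fun i =>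
    Finset.sum_congr rfl fun j hj => hM.sub_pair hk p (Finset.ne_of_mem_erase hj).symm
  simp only [h1]
  split_ifs with h
  · obtain ⟨a, b, hab, h⟩ := h
    have hlt : ∀ l, Odd (row p l) → l < k := fun l hl =>
      lt_of_row_ne_zero hk (by rintro h; rw [h] at hl; simp at hl)
    obtain ⟨a, rfl⟩ : ∃ a' : Fin k, (a' : ℕ) = a := ⟨⟨a, hlt a ((h a).2 (Or.inl rfl))⟩, rfl⟩
    obtain ⟨b, rfl⟩ : ∃ b' : Fin k, (b' : ℕ) = b := ⟨⟨b, hlt b ((h b).2 (Or.inr rfl))⟩, rfl⟩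
    have hab' : a ≠ b := fun h => hab (congrArg Fin.val h)
    have hcase : ∀ i j : Fin k, i ≠ j → OddRowsAt p i j → i = a ∧ j = b ∨ i = b ∧ j = a := by
      intro i j hij h'
      have := h.eq_or h' (fun h => hij (Fin.ext h))
      simpa only [Fin.ext_iff] using this
    rw [Finset.sum_eq_add_of_mem a b (Finset.mem_univ _) (Finset.mem_univ _) hab',
      Finset.sum_eq_single_of_mem b (by simp [hab'.symm]),
      Finset.sum_eq_single_of_mem a (by simp [hab']), if_pos h, if_pos h.symm]
    · norm_num
    · intro j hj hja
      rw [if_neg]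
      intro h'
      have := hcase b j (Finset.ne_of_mem_erase hj).symm h'
      tauto
    · intro j hj hjb
      rw [if_neg]
      intro h'
      have := hcase a j (Finset.ne_of_mem_erase hj).symm h'
      tauto
    · rintro i - ⟨hia, hib⟩
      refine Finset.sum_eq_zero fun j hj => if_neg fun h' => ?_
      have := hcase i j (Finset.ne_of_mem_erase hj).symm h'
      tauto
  · refine Finset.sum_eq_zero fun i _ => Finset.sum_eq_zero fun j hj => if_neg fun h' => h ?_
    exact ⟨i, j, fun he => Finset.ne_of_mem_erase hj (Fin.ext he.symm), h'⟩

/-- The number of rows of a partition that are longer than the next row. -/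
def numRemovable (k : ℕ) (p : N.Partition) : ℕ :=
  (Finset.univ.filter fun i : Fin k => row p (i + 1) < row p i).card

open Classical in
-- Horizontal dominoes contribute only if all rows are even, once for each row longer than the next;
-- vertical ones contribute `-1` for a pair of equal odd rows.
theorem CountsEven.sum_diagonal (hM : CountsEven k N M) (hk : N + 2 ≤ k)
    (p : (N + 2).Partition) :
    ∑ i, M (beta k p - Pi.single i 2) =
      (if ∀ l, Even (row p l) then (numRemovable k p : ℂ) else 0) -
        if ∃ a b, a ≠ b ∧ OddRowsAt p a b ∧ row p a = row p b then 1 else 0 := by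
  have h1 : ∀ i : Fin k, M (beta k p - Pi.single i 2) =
      (if row p (i + 1) < row p i then (if ∀ l, Even (row p l) then 1 else 0) else 0) -
        if row p (i + 1) = row p i ∧ OddRowsAt p i (i + 1) then 1 else 0 := by
    intro i
    rcases (row_antitone p (Nat.le_succ i)).lt_or_eq with h | h
    · rw [hM.sub_two_of_lt hk p h, if_pos h,
        if_neg (c := _ ∧ _) (fun h' => h.ne h'.1), sub_zero]
    · rw [hM.sub_two_of_eq hk p h, if_neg h.not_lt, zero_sub]
      congr 1
      exact if_congr (by rw [and_iff_right h]) rfl rfl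
  simp only [h1, Finset.sum_sub_distrib]
  congr 1
  · rw [← Finset.sum_filter, Finset.sum_const, nsmul_eq_mul, numRemovable]
    split_ifs <;> simp
  · split_ifs with h
    · obtain ⟨a, b, hab, h, he⟩ := h
      wlog hlt : a < b generalizing a b
      · exact this b a hab.symm h.symm he.symm (by omega)
      -- A row between two equal odd rows would be a third odd row.
      have hb : b = a + 1 := by
        have h3 := row_antitone p (Nat.le_succ a)
        have h4 := row_antitone p (show a + 1 ≤ b from hlt)
        have h5 : row p (a + 1) = row p a := by simp only [Nat.succ_eq_add_one] at h3; omega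
        have := (h (a + 1)).1 (by rw [h5]; exact (h a).2 (Or.inl rfl))
        omega
      subst hb
      have hak : a < k := lt_of_row_ne_zero hk (p := p) (by
        intro h0
        have := (h a).2 (Or.inl rfl)
        simp [h0] at this)
      rw [Finset.sum_eq_single_of_mem ⟨a, hak⟩ (Finset.mem_univ _), if_pos ⟨he.symm, h⟩]
      intro i _ hi
      rw [if_neg]
      rintro ⟨-, h'⟩
      have := h.eq_or h' (by omega)
      exact hi (Fin.ext (by simp only; omega))
    · refine Finset.sum_eq_zero fun i _ => if_neg ?_
      rintro ⟨h1, h2⟩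
      exact h ⟨i, i + 1, by omega, h2, h1.symm⟩

open Classical in
/-- The sum over the ways to remove two cells. -/
theorem CountsEven.sum_remove_pairs (hM : CountsEven k N M) (hk : N + 2 ≤ k)
    (p : (N + 2).Partition) :
    2⁻¹ * (∑ i, ∑ j, M (beta k p - Pi.single i 1 - Pi.single j 1) +
      ∑ i, M (beta k p - Pi.single i 2)) =
      (if ∀ l, Even (row p l) then (numRemovable k p : ℂ) else 0) +
        if ∃ a b, a ≠ b ∧ OddRowsAt p a b ∧ row p a ≠ row p b then 1 else 0 := by
  rw [sum_pairs, hM.sum_off_diagonal hk, hM.sum_diagonal hk]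
  -- The unordered pair of odd rows is unique, so whether their lengths agree does not depend on the
  -- chosen labels.
  have hor : ∀ {a b}, OddRowsAt p a b → ∀ {c d}, c ≠ d → OddRowsAt p c d →
      (row p a = row p b ↔ row p c = row p d) := by
    intro a b h c d hcd h'
    rcases h.eq_or h' hcd with ⟨rfl, rfl⟩ | ⟨rfl, rfl⟩
    · rfl
    · exact eq_comm
  by_cases h : ∃ a b, a ≠ b ∧ OddRowsAt p a b
  · rw [if_pos h]
    obtain ⟨a, b, hab, h⟩ := h
    by_cases he : row p a = row p b
    · have h1 : ∃ a b, a ≠ b ∧ OddRowsAt p a b ∧ row p a = row p b := ⟨a, b, hab, h, he⟩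
      have h2 : ¬ ∃ a b, a ≠ b ∧ OddRowsAt p a b ∧ row p a ≠ row p b := by
        rintro ⟨c, d, hcd, h', hne⟩
        exact hne ((hor h hcd h').1 he)
      rw [if_pos h1, if_neg h2]
      ring
    · have h1 : ¬ ∃ a b, a ≠ b ∧ OddRowsAt p a b ∧ row p a = row p b := by
        rintro ⟨c, d, hcd, h', hne⟩
        exact he ((hor h hcd h').2 hne)
      have h2 : ∃ a b, a ≠ b ∧ OddRowsAt p a b ∧ row p a ≠ row p b := ⟨a, b, hab, h, he⟩
      rw [if_neg h1, if_pos h2]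
      ring
  · have h1 : ¬ ∃ a b, a ≠ b ∧ OddRowsAt p a b ∧ row p a = row p b :=
      fun ⟨a, b, hab, h', _⟩ => h ⟨a, b, hab, h'⟩
    have h2 : ¬ ∃ a b, a ≠ b ∧ OddRowsAt p a b ∧ row p a ≠ row p b :=
      fun ⟨a, b, hab, h', _⟩ => h ⟨a, b, hab, h'⟩
    rw [if_neg h, if_neg h1, if_neg h2]
    ring

end Pairs

/-! ### The character of `(n - 1, 1)` -/

section NearRow

variable {n : ℕ}

theorem row_nearRow (hn : 2 ≤ n) :
    row (nearRow n hn) = fun i => if i = 0 then n - 1 else if i = 1 then 1 else 0 := by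
  obtain ⟨p, hp, hc⟩ := exists_partition_row (n := n) (k := 2)
    (fun i => if i = 0 then n - 1 else if i = 1 then 1 else 0)
    (by
      refine antitone_nat_of_succ_le fun i => ?_
      rcases i with _ | _ | i
      · simp; omega
      · simp
      · simp)
    (by simp) (by simp [Finset.sum_range_succ]; omega)
  rw [← hp]
  congr 1
  ext1
  rw [parts_eq_filter p hc, hp]
  have h2 : Multiset.range 2 = {0, 1} := rfl
  have h3 : n - 1 ≠ 0 := by omega
  rw [h2]
  simp only [Multiset.insert_eq_cons, Multiset.map_cons, Multiset.map_singleton, if_true,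
    one_ne_zero, if_false]
  rw [Multiset.filter_cons_of_pos (p := (· ≠ 0)) _ h3, Multiset.filter_singleton, if_pos one_ne_zero]
  rfl

theorem content_add {X : Type*} [Fintype X] (f : X → Fin 2) :
    content f 0 + content f 1 = Fintype.card X := by
  rw [content, content, ← Finset.card_univ (α := X),
    ← Finset.card_filter_add_card_filter_not (s := Finset.univ) fun x => f x = 0]
  congr 2
  ext x
  simp only [Finset.mem_filter, Finset.mem_univ, true_and]
  omega

/-- The `2 × 2` determinant is the indicator of content `(n - 1, 1)` minus that of content `(n, 0)`.
The invariant functions of the first kind are the indicators of fixed points of `σ`, and only the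
zero function is of the second kind. -/
theorem chi_nearRow (hn : 2 ≤ n) (σ : Perm (Fin n)) :
    chi (nearRow n hn) σ = ((Finset.univ.filter fun i => σ i = i).card : ℂ) - 1 := by
  have hr := row_nearRow hn
  have hterm : ∀ f : Fin n → Fin 2, altDet (fun i => beta 2 (nearRow n hn) i - content f i) =
      (if content f 1 = 1 then 1 else 0) - if content f 1 = 0 then 1 else 0 := by
    intro f
    have hc := content_add f
    rw [Fintype.card_fin] at hc
    have e0 : ((n - 1 : ℕ) : ℤ) = n - 1 := by omega
    simp only [altDet, Matrix.det_fin_two, Matrix.of_apply, beta, hr]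
    simp only [Fin.isValue, Fin.val_zero, Fin.val_one, if_true, one_ne_zero, if_false]
    have h1 : ((n - 1 : ℕ) : ℤ) - (0 : ℕ) - (content f 0 : ℤ) = -(0 : ℕ) ↔ content f 1 = 1 := by
      omega
    have h2 : ((1 : ℕ) : ℤ) - (1 : ℕ) - (content f 1 : ℤ) = -(1 : ℕ) ↔ content f 1 = 1 := by
      omega
    have h3 : ((n - 1 : ℕ) : ℤ) - (0 : ℕ) - (content f 0 : ℤ) = -(1 : ℕ) ↔ content f 1 = 0 := by
      omega
    have h4 : ((1 : ℕ) : ℤ) - (1 : ℕ) - (content f 1 : ℤ) = -(0 : ℕ) ↔ content f 1 = 0 := by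
      omega
    simp only [h1, h2, h3, h4]
    split_ifs <;> simp
  rw [chi_eq_psi (k := 2) _ (by simp [nearRow]), psi, Finset.sum_congr rfl fun f _ => hterm f,
    Finset.sum_sub_distrib]
  congr 1
  · rw [Finset.sum_boole]
    congr 1
    rw [Finset.filter_filter]
    symm
    have hsingle : ∀ x : Fin n,
        (Finset.univ.filter fun y => (if y = x then (1 : Fin 2) else 0) = 1) = {x} := by
      intro x
      ext y
      by_cases h : y = x <;> simp [h]
    refine Finset.card_bij (fun x _ y => if y = x then (1 : Fin 2) else 0) ?_ ?_ ?_
    · intro x hx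
      simp only [Finset.mem_filter, Finset.mem_univ, true_and] at hx ⊢
      refine ⟨fun y => if_congr ?_ rfl rfl, ?_⟩
      · rw [← σ.apply_eq_iff_eq (x := y) (y := x), hx]
      · rw [content, hsingle, Finset.card_singleton]
    · intro x _ y _ h
      have := congrFun h x
      by_contra hne
      simp [hne] at this
    · intro f hf
      simp only [Finset.mem_filter, Finset.mem_univ, true_and] at hf
      obtain ⟨hinv, hf⟩ := hf
      obtain ⟨x, hx⟩ := Finset.card_eq_one.1 hf
      have hmem : ∀ y, f y = 1 ↔ y = x := fun y => by
        simpa using Finset.ext_iff.1 hx y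
      refine ⟨x, ?_, ?_⟩
      · simp only [Finset.mem_filter, Finset.mem_univ, true_and]
        exact (hmem _).1 ((hinv x).trans ((hmem x).2 rfl))
      · funext y
        by_cases h : y = x
        · rw [if_pos h, (hmem y).2 h]
        · rw [if_neg h]
          have : f y ≠ 1 := fun h' => h ((hmem y).1 h')
          omega
  · rw [Finset.sum_eq_single_of_mem (fun _ => 0) (by simp), if_pos (by simp [content])]
    intro f _ hf
    rw [if_neg]
    intro h
    apply hf
    rw [content, Finset.card_eq_zero, Finset.filter_eq_empty_iff] at h
    funext x
    have := h (Finset.mem_univ x)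
    omega

end NearRow

/-! ### Frobenius reciprocity -/

section Frobenius

instance {G H V : Type*} [Group G] [Group H] [Finite H] [AddCommGroup V] [Module ℂ V]
    [FiniteDimensional ℂ V] (φ : G →* H) (ρ : Representation ℂ G V) :
    FiniteDimensional ℂ (Representation.IndV φ ρ) := by
  have : FiniteDimensional ℂ (MonoidAlgebra ℂ H) :=
    Module.Finite.equiv (MonoidAlgebra.coeffLinearEquiv ℂ).symm
  exact Module.Finite.of_surjective (Representation.Coinvariants.mk _)
    (Representation.Coinvariants.mk_surjective _)

/-- Frobenius reciprocity, from the adjunction between induction and restriction in the category of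
representations. -/
theorem finrank_intertwiningMap_ind {G H V W : Type} [Group G] [Group H] [AddCommGroup V]
    [Module ℂ V] [AddCommGroup W] [Module ℂ W] (φ : G →* H) (ρ : Representation ℂ G V)
    (τ : Representation ℂ H W) :
    Module.finrank ℂ ((Representation.ind φ ρ).IntertwiningMap τ) =
      Module.finrank ℂ (ρ.IntertwiningMap (τ.comp φ)) :=
  ((Rep.homLinearEquiv (Rep.of (Representation.ind φ ρ)) (Rep.of τ)).symm ≪≫ₗ
    Rep.indResHomEquiv φ (Rep.of ρ) (Rep.of τ) ≪≫ₗ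
      Rep.homLinearEquiv (Rep.of ρ) (Rep.res φ (Rep.of τ))).finrank_eq

theorem ip_twistedFoulkes {n : ℕ} (ν : n.Partition) (p : (2 * n).Partition) :
    ip (twistedFoulkes 2 ν) (chi p) = (Fintype.card (BlockGroup (Fin n)) : ℂ)⁻¹ *
      ∑ w : BlockGroup (Fin n), chi ν w.right * chi p (Wreath.embedding 2 n w) := by
  have : Invertible (Nat.card (BlockGroup (Fin n)) : ℂ) :=
    invertibleOfNonzero (Nat.cast_ne_zero.2 Nat.card_pos.ne')
  rw [ip_comm, twistedFoulkes, chi, ip_character, finrank_intertwiningMap_ind,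
    ← Representation.card_inv_mul_sum_char_mul_char_eq_finrank, Nat.card_eq_fintype_card]
  congr 1
  refine Finset.sum_congr rfl fun w _ => ?_
  rw [mul_comm, ← classFunctions_inv (chi_mem_classFunctions ν)]
  rfl

theorem ip_twistedFoulkes_nearRow {n k : ℕ} (hn : 2 ≤ n) (hk : 2 * n ≤ k)
    (p : (2 * n).Partition) : ip (twistedFoulkes 2 (nearRow n hn)) (chi p) =
      markedAvg (Fin n) (beta k p) - blockAvg (Fin n) (beta k p) := by
  rw [ip_twistedFoulkes, markedAvg, blockAvg, ← mul_sub, ← Finset.sum_sub_distrib]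
  congr 1
  refine Finset.sum_congr rfl fun w _ => ?_
  rw [chi_nearRow, ← psi_blockPerm p ((card_parts_le p).trans hk), sub_one_mul]

end Frobenius

/-! ### Rows and parts -/

section Parts

variable {k N : ℕ}

theorem mem_parts_iff {p : N.Partition} {x : ℕ} : x ∈ p.parts ↔ x ≠ 0 ∧ ∃ i, row p i = x := by
  rw [parts_eq_filter p (card_parts_le p), Multiset.mem_filter, Multiset.mem_map, and_comm]
  refine and_congr_right fun hx => ⟨fun ⟨i, _, h⟩ => ⟨i, h⟩, fun ⟨i, h⟩ => ⟨i, ?_, h⟩⟩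
  exact Multiset.mem_range.2 (lt_of_row_ne_zero le_rfl (h ▸ hx))

theorem even_rows_iff {p : N.Partition} : (∀ i, Even (row p i)) ↔ ∀ x ∈ p.parts, Even x := by
  constructor
  · intro h x hx
    obtain ⟨-, i, rfl⟩ := mem_parts_iff.1 hx
    exact h i
  · intro h i
    by_cases h0 : row p i = 0
    · simp [h0]
    · exact h _ (mem_parts_iff.2 ⟨h0, i, rfl⟩)

/-- Each part size corresponds to the last row of that length. -/
theorem numRemovable_eq (hk : N ≤ k) (p : N.Partition) : numRemovable k p = numDistinctParts p := by
  rw [numRemovable, numDistinctParts]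
  refine Finset.card_bij (fun i _ => row p i) ?_ ?_ ?_
  · intro i hi
    rw [Finset.mem_filter] at hi
    exact Multiset.mem_toFinset.2 (mem_parts_iff.2 ⟨by omega, i, rfl⟩)
  · have key : ∀ i j : Fin k, row p (i + 1) < row p i → row p i = row p j → j ≤ i := by
      intro i j hi he
      by_contra hlt
      have := row_antitone p (show (i : ℕ) + 1 ≤ j from not_le.1 hlt)
      omega
    intro i hi j hj he
    rw [Finset.mem_filter] at hi hj
    exact le_antisymm (key j i hj.2 he.symm) (key i j hi.2 he)
  · intro x hx
    obtain ⟨h0, i, rfl⟩ := mem_parts_iff.1 (Multiset.mem_toFinset.1 hx)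
    obtain ⟨j, -, h1, h2⟩ := exists_removable h0
    exact ⟨⟨j, lt_of_row_ne_zero hk (h1 ▸ h0)⟩, by simpa using h2, h1⟩

theorem twoDistinctOddParts_iff {p : N.Partition} : TwoDistinctOddParts p ↔
    ∃ a b, a ≠ b ∧ OddRowsAt p a b ∧ row p a ≠ row p b := by
  -- The multiset of odd parts is the image of the set of odd rows, so its cardinality counts
  -- positions, and absence of duplicates says that their lengths differ.
  let s : Finset ℕ := (Finset.range N).filter fun i => Odd (row p i)
  have hs : ∀ i, i ∈ s ↔ Odd (row p i) := by
    intro i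
    simp only [s, Finset.mem_filter, Finset.mem_range, and_iff_right_iff_imp]
    intro h
    exact lt_of_row_ne_zero (p := p) le_rfl fun h0 => by simp [h0] at h
  have hparts : p.parts.filter Odd = s.val.map (row p) := by
    conv_lhs => rw [parts_eq_filter p (card_parts_le p)]
    rw [Multiset.filter_filter, Multiset.filter_congr (q := Odd), Multiset.filter_map]
    · rfl
    · intro x _
      exact and_iff_left_of_imp fun h h0 => by simp [h0] at h
  rw [TwoDistinctOddParts, hparts, Multiset.card_map, Finset.card_val, Finset.card_eq_two]
  constructor
  · rintro ⟨⟨a, b, hab, he⟩, hnd⟩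
    refine ⟨a, b, hab, fun l => ?_, fun h => hab ?_⟩
    · rw [← hs, he, Finset.mem_insert, Finset.mem_singleton]
    · exact Multiset.inj_on_of_nodup_map hnd a (by rw [Finset.mem_val, he]; simp) b
        (by rw [Finset.mem_val, he]; simp) h
  · rintro ⟨a, b, hab, h, hne⟩
    have he : s = {a, b} := by
      ext l
      rw [hs, h l, Finset.mem_insert, Finset.mem_singleton]
    refine ⟨⟨a, b, hab, he⟩, ?_⟩
    have hv : s.val = {a, b} := by rw [he, Finset.insert_val_of_notMem (by simpa using hab)]; rfl
    rw [hv]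
    simpa using hne

theorem double_injective {n : ℕ} : Function.Injective (double (n := n)) := by
  intro γ δ h
  ext1
  exact Multiset.map_injective (fun a b h => by simpa using h)
    (congrArg Nat.Partition.parts h)

theorem even_rows_iff_exists_double {n : ℕ} {p : (2 * n).Partition} :
    (∀ i, Even (row p i)) ↔ ∃ γ : n.Partition, double γ = p := by
  rw [even_rows_iff]
  constructor
  · intro h
    have hm : (p.parts.map (· / 2)).map (2 * ·) = p.parts := by
      rw [Multiset.map_map]
      conv_rhs => rw [← Multiset.map_id p.parts]
      refine Multiset.map_congr rfl fun x hx => ?_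
      exact Nat.two_mul_div_two_of_even (h x hx)
    refine ⟨⟨p.parts.map (· / 2), ?_, ?_⟩, ?_⟩
    · intro i hi
      obtain ⟨x, hx, rfl⟩ := Multiset.mem_map.1 hi
      have := p.parts_pos hx
      obtain ⟨c, hc⟩ := h x hx
      omega
    · have := congrArg Multiset.sum hm
      rw [Multiset.sum_map_mul_left, Multiset.map_id', p.parts_sum] at this
      omega
    · ext1
      exact hm
  · rintro ⟨γ, rfl⟩ x hx
    obtain ⟨y, -, rfl⟩ := Multiset.mem_map.1 hx
    exact even_two_mul y

end Parts

open Classical in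
/-- The multiplicities of the irreducible characters in the twisted Foulkes character. -/
theorem ip_twistedFoulkes_eq {n : ℕ} (hn : 2 ≤ n) (p : (2 * n).Partition) :
    ip (twistedFoulkes 2 (nearRow n hn)) (chi p) =
      (if ∃ γ : n.Partition, double γ = p then (numDistinctParts p : ℂ) - 1 else 0) +
        if TwoDistinctOddParts p then 1 else 0 := by
  rw [ip_twistedFoulkes_nearRow hn le_rfl, (countsEven_blockAvg n le_rfl).eq_ite]
  -- The marked average is computed by splitting off one block, so the even-row count is applied to
  -- the remaining `m` blocks.
  obtain ⟨m, rfl⟩ : ∃ m, n = m + 1 := ⟨n - 1, by omega⟩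
  rw [markedAvg_congr (finSuccEquiv m), markedAvg_option,
    (countsEven_blockAvg m (by omega)).sum_remove_pairs (show 2 * m + 2 ≤ 2 * (m + 1) from le_rfl) p,
    numRemovable_eq le_rfl p]
  simp only [even_rows_iff_exists_double (n := m + 1), twoDistinctOddParts_iff]
  split_ifs <;> ring

end Foulkes

end

theorem corollary3p2 (n : ℕ) (hn : 2 ≤ n) :
    Foulkes.twistedFoulkes 2 (Foulkes.nearRow n hn) =
      ∑ γ : n.Partition,
          ((Foulkes.numDistinctParts (Foulkes.double γ) : ℂ) - 1) •
            Foulkes.chi (Foulkes.double γ) +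
        ∑ μ : (2 * n).Partition with Foulkes.TwoDistinctOddParts μ, Foulkes.chi μ := by
  classical
  rw [Foulkes.eq_sum_ip_chi (F := Foulkes.twistedFoulkes 2 (Foulkes.nearRow n hn))
    (Foulkes.character_mem_classFunctions _)]
  simp only [Foulkes.ip_twistedFoulkes_eq, add_smul, Finset.sum_add_distrib, ite_smul, one_smul,
    zero_smul]
  rw [← Finset.sum_filter, ← Finset.sum_filter]
  congr 1
  symm
  refine Finset.sum_bij (fun γ _ => Foulkes.double γ) ?_ ?_ ?_ fun _ _ => rfl
  · intro γ _
    simp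
  · intro γ _ δ _ h
    exact Foulkes.double_injective h
  · intro p hp
    obtain ⟨γ, hγ⟩ := (Finset.mem_filter.1 hp).2
    exact ⟨γ, Finset.mem_univ _, hγ⟩
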